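/- **Conventions.** A *$G$-tree* is an $\mathbb R$-tree with an isometric action of the group $G$; it is *minimal* if it has no proper $G$-invariant subtree. A *morphism* from a $G$-tree $S$ to an $H$-tree $T$ is a homomorphism $\tilde\phi\colon G\to H$ together with a $\tilde\phi$-equivariant map $\phi\colon S\to T$ such that each non-degenerate segment $[x,y]$ of $S$ has a non-degenerate initial segment $[x,w]$ on which $\phi$ is an isometry. Let $\mathcal T$ be the category of $\mathbb R$-trees with group actions and these morphisms. A point $x$ of a $G$-tree is *ordinary* if there are exactly two directions at $x$ and no element of $G$ fixing $x$ transposes them. A *simplicial* $G$-tree is a $G$-tree with a non-empty closed discrete $G$-invariant set of vertices that contains all non-ordinary points, such that the closures of the components of its complement (the edges) are segments whose endpoints are vertices. Let $e_1=[v,x]$ and $e_2=[v,y]$ be distinct edges of equal length of a simplicial $G$-tree, with neither $x$ nor $y$ in the orbit of $v$. The *fold* of $e_1$ and $e_2$ is the simplicial $G$-tree obtained by identifying $ge_1$ with $ge_2$, isometrically and fixing $gv$, for every $g\in G$. It is of type I if $x,y$ lie in different orbits, of type II if $e_2=ge_1$ for some $g\in G_v$, and of type III if $x,y$ lie in the same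 orbit but $e_1,e_2$ do not. A *vertex morphism* is a morphism $(\tilde\theta,\theta)$ from a simplicial $G$-tree $S$ to a simplicial $H$-tree $S'$ with $\theta$, $\tilde\theta$ surjective, mapping vertices to vertices and edges isometrically onto edges, inducing an isomorphism of quotient graphs $G\backslash S\to H\backslash S'$, surjective on all point stabilizers, and injective on the stabilizers of all points outside the orbit of one vertex (so only one vertex label of the graph of groups changes: it is replaced by a quotient into which the incident edge groups still embed). A *folding sequence* of simplicial trees is a sequence $(T_n)_{n\ge 0}$, where each $T_n$ is a minimal simplicial $G_n$-tree and $G_n$ is finitely generated, with morphisms $T_n\to T_{n+1}$ each of which is either a subdivision or a fold of type I, II or III followed by a vertex morphism. **Theorem 3.3.** Let the $G$-tree $T$, with morphisms $(\tilde\phi_n,\phi_n)$ from the $G_n$-trees $T_n$ to $T$, be the direct limit in $\mathcal T$ of a folding sequence $(T_n)$ of simplicial trees, and suppose that, for every $n$, the homomorphism $\tilde\phi_n\colon G_n\to G$ is injective on the stabilizer of each point of $T_n$. Then either there is $m$ such that $\tilde\phi_n\colon G_n\to G$ is an isomorphism for all $n\ge m$, or $G$ contains a subgroup $H$ that is not finitely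 generated but such that every finitely generated subgroup of $H$ fixes (pointwise) an arc, that is, a non-degenerate segment, of $T$. -/

import Mathlib

universe u v

namespace Folding

/-- The segment `[x, y]` of a metric space: the points between `x` and `y`. -/
def seg {X : Type*} [MetricSpace X] (x y : X) : Set X :=
  {z | dist x z + dist z y = dist x y}

/-- An `ℝ`-tree: a non-empty geodesic metric space that satisfies the four-point condition
(is `0`-hyperbolic). -/
structure IsRTree (X : Type*) [MetricSpace X] : Prop where
  nonempty : Nonempty X
  geodesic : ∀ x y : X, ∃ f : ℝ → X, f 0 = x ∧ f (dist x y) = y ∧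
    ∀ s ∈ Set.Icc 0 (dist x y), ∀ t ∈ Set.Icc 0 (dist x y), dist (f s) (f t) = |s - t|
  four_point : ∀ x y z w : X,
    dist x y + dist z w ≤ max (dist x z + dist y w) (dist x w + dist y z)

/-- A group together with an `ℝ`-tree on which it acts by isometries. -/
structure GTree where
  G : Type u
  X : Type v
  [group : Group G]
  [metric : MetricSpace X]
  [action : MulAction G X]
  isRTree : IsRTree X
  isometric : ∀ (g : G) (x y : X), dist (g • x) (g • y) = dist x y

attribute [instance] GTree.group GTree.metric GTree.action

/-- `x` and `y` lie in the same orbit. -/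
def GTree.SameOrbit (T : GTree.{u, v}) (x y : T.X) : Prop := ∃ g : T.G, g • x = y

/-- `T` has no proper invariant subtree. -/
def GTree.IsMinimal (T : GTree.{u, v}) : Prop :=
  ∀ Y : Set T.X, Y.Nonempty → (∀ x ∈ Y, ∀ y ∈ Y, seg x y ⊆ Y) →
    (∀ (g : T.G), ∀ x ∈ Y, g • x ∈ Y) → Y = Set.univ

/-- The points `y` and `z`, both different from `x`, determine the same direction at `x`. -/
def GTree.SameDirection (T : GTree.{u, v}) (x y z : T.X) : Prop :=
  ∃ w, w ≠ x ∧ w ∈ seg x y ∧ w ∈ seg x z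

/-- There are exactly two directions at `x`, those of `y` and of `z`, and no group element
that fixes `x` transposes them. -/
def GTree.IsOrdinary (T : GTree.{u, v}) (x : T.X) : Prop :=
  ∃ y z : T.X, y ≠ x ∧ z ≠ x ∧ ¬ T.SameDirection x y z ∧
    (∀ w, w ≠ x → T.SameDirection x w y ∨ T.SameDirection x w z) ∧
    ¬ ∃ g : T.G, g • x = x ∧ T.SameDirection x (g • y) z ∧ T.SameDirection x (g • z) y

/-- A morphism `S → T`: a homomorphism of the groups and an equivariant map of the trees such
that each non-degenerate segment `[x, y]` has a non-degenerate initial segment `[x, w]` on which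
the map is an isometry. -/
@[ext]
structure Morphism (S T : GTree.{u, v}) where
  hom : S.G →* T.G
  map : S.X → T.X
  map_smul : ∀ (g : S.G) (x : S.X), map (g • x) = hom g • map x
  isometric : ∀ x y : S.X, x ≠ y → ∃ w ∈ seg x y, w ≠ x ∧
    ∀ p ∈ seg x w, ∀ q ∈ seg x w, dist (map p) (map q) = dist p q

/-- A simplicial `ℝ`-tree with a group acting on it, and a chosen set of vertices. The edges are
the segments `[a, b]` that meet the vertex set in exactly `{a, b}`, where `a ≠ b`. -/
structure SimplicialTree extends GTree.{u, v} where
  verts : Set X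
  nonempty : verts.Nonempty
  closed : IsClosed verts
  discrete : DiscreteTopology verts
  smul_mem : ∀ (g : G), ∀ x ∈ verts, g • x ∈ verts
  mem_of_not_ordinary : ∀ x, ¬ toGTree.IsOrdinary x → x ∈ verts
  covered : ∀ p, p ∈ verts ∨ ∃ a b, a ≠ b ∧ seg a b ∩ verts = {a, b} ∧ p ∈ seg a b

/-- `[a, b]` is an edge. -/
def SimplicialTree.IsEdge (T : SimplicialTree.{u, v}) (a b : T.X) : Prop :=
  a ≠ b ∧ seg a b ∩ T.verts = {a, b}

/-- A morphism that maps vertices to vertices and each edge isometrically onto an edge. -/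
def IsSimplicialMap (S T : SimplicialTree.{u, v}) (α : Morphism S.toGTree T.toGTree) : Prop :=
  (∀ x ∈ S.verts, α.map x ∈ T.verts) ∧
  ∀ a b, S.IsEdge a b → T.IsEdge (α.map a) (α.map b) ∧
    ∀ p ∈ seg a b, ∀ q ∈ seg a b, dist (α.map p) (α.map q) = dist p q

/-- `T` is obtained from `S` by subdivision: the same action on the same tree, with a possibly
larger vertex set. -/
def IsSubdivision (S T : SimplicialTree.{u, v}) (α : Morphism S.toGTree T.toGTree) : Prop :=
  Function.Bijective α.hom ∧ Function.Surjective α.map ∧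
  (∀ p q, dist (α.map p) (α.map q) = dist p q) ∧ ∀ x ∈ S.verts, α.map x ∈ T.verts

/-- Edges `[v, x]`, `[v, y]` as in a fold of type I: in the quotient graph they are two edges
with one common vertex and three vertices altogether. -/
def IsTypeI (T : GTree.{u, v}) (v x y : T.X) : Prop :=
  ¬ T.SameOrbit v x ∧ ¬ T.SameOrbit v y ∧ ¬ T.SameOrbit x y

/-- Edges `[v, x]`, `[v, y]` as in a fold of type II: an element of the stabilizer of `v` carries
the first edge to the second; in the quotient graph they become one edge, not a loop. -/
def IsTypeII (T : GTree.{u, v}) (v x y : T.X) : Prop :=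
  ¬ T.SameOrbit v x ∧ ∃ g : T.G, g • v = v ∧ g • x = y

/-- Edges `[v, x]`, `[v, y]` as in a fold of type III: in the quotient graph they are two distinct
edges joining the same two distinct vertices. -/
def IsTypeIII (T : GTree.{u, v}) (v x y : T.X) : Prop :=
  ¬ T.SameOrbit v x ∧ T.SameOrbit x y ∧ ¬ ∃ g : T.G, g • v = v ∧ g • x = y

/-- `p` and `q` correspond to each other in some translate `g • [v, x]`, `g • [v, y]` of the pair
of edges that are folded together. -/
def FoldRel (T : GTree.{u, v}) (v x y : T.X) (p q : T.X) : Prop :=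
  ∃ (g : T.G), ∃ p' ∈ seg v x, ∃ q' ∈ seg v y, dist v p' = dist v q' ∧ p = g • p' ∧ q = g • q'

/-- `T` is obtained from `S` by a fold of type I, II or III: the group does not change, and two
edges `[v, x]`, `[v, y]` of the same length, together with their translates, are identified. -/
def IsFold (S T : SimplicialTree.{u, v}) (α : Morphism S.toGTree T.toGTree) : Prop :=
  Function.Bijective α.hom ∧ Function.Surjective α.map ∧ IsSimplicialMap S T α ∧
  ∃ v x y : S.X, S.IsEdge v x ∧ S.IsEdge v y ∧ x ≠ y ∧ dist v x = dist v y ∧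
    (IsTypeI S.toGTree v x y ∨ IsTypeII S.toGTree v x y ∨ IsTypeIII S.toGTree v x y) ∧
    ∀ p q, α.map p = α.map q ↔ Relation.EqvGen (FoldRel S.toGTree v x y) p q

/-- A vertex morphism: it induces an isomorphism of quotient graphs, and on stabilizers of points
it is surjective everywhere and injective (hence an isomorphism) at all points outside the orbit
of one vertex `u`. So the graph of groups changes only in the label of the image of `u`, which is
replaced by a quotient into which the labels of the incident edges still embed. -/
def IsVertexMorphism (S T : SimplicialTree.{u, v}) (θ : Morphism S.toGTree T.toGTree) : Prop :=
  Function.Surjective θ.hom ∧ Function.Surjective θ.map ∧ IsSimplicialMap S T θ ∧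
  (∀ p q, T.SameOrbit (θ.map p) (θ.map q) → S.SameOrbit p q) ∧
  (∀ p, ∀ h : T.G, h • θ.map p = θ.map p → ∃ g : S.G, g • p = p ∧ θ.hom g = h) ∧
  ∃ u ∈ S.verts, ∀ p, ¬ S.SameOrbit u p → ∀ g : S.G, g • p = p → θ.hom g = 1 → g = 1

/-- A folding sequence of simplicial `ℝ`-trees: minimal trees with actions of finitely generated
groups, each obtained from the preceding one either by subdivision or by a fold of type I, II or
III followed by a vertex morphism. -/
structure FoldingSequence where
  tree : ℕ → SimplicialTree.{u, v}
  step : ∀ n, Morphism (tree n).toGTree (tree (n + 1)).toGTree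
  fg : ∀ n, Group.FG (tree n).G
  minimal : ∀ n, (tree n).toGTree.IsMinimal
  isStep : ∀ n, IsSubdivision (tree n) (tree (n + 1)) (step n) ∨
    ∃ (S : SimplicialTree.{u, v}) (α : Morphism (tree n).toGTree S.toGTree)
      (θ : Morphism S.toGTree (tree (n + 1)).toGTree),
      IsFold (tree n) S α ∧ IsVertexMorphism S (tree (n + 1)) θ ∧
      (∀ g, (step n).hom g = θ.hom (α.hom g)) ∧ ∀ x, (step n).map x = θ.map (α.map x)

/-- The morphisms `φ n : T n → T` are compatible with the morphisms `T n → T (n + 1)` of the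
sequence. -/
def IsCocone (F : FoldingSequence.{u, v}) (T : GTree.{u, v})
    (φ : ∀ n, Morphism (F.tree n).toGTree T) : Prop :=
  ∀ n, (∀ g, (φ (n + 1)).hom ((F.step n).hom g) = (φ n).hom g) ∧
    ∀ x, (φ (n + 1)).map ((F.step n).map x) = (φ n).map x

/-- `T`, with the morphisms `φ n`, is the direct limit of the sequence in the category of
`ℝ`-trees with group actions and morphisms. -/
def IsDirectLimit (F : FoldingSequence.{u, v}) (T : GTree.{u, v})
    (φ : ∀ n, Morphism (F.tree n).toGTree T) : Prop :=
  IsCocone F T φ ∧ ∀ (T' : GTree.{u, v}) (φ' : ∀ n, Morphism (F.tree n).toGTree T'),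
    IsCocone F T' φ' → ∃! ψ : Morphism T T',
      ∀ n, (∀ g, ψ.hom ((φ n).hom g) = (φ' n).hom g) ∧ ∀ x, ψ.map ((φ n).map x) = (φ' n).map x

/-- The subgroup `K` fixes an arc (a non-degenerate segment) of `T` pointwise. -/
def FixesArc (T : GTree.{u, v}) (K : Subgroup T.G) : Prop :=
  ∃ x y : T.X, x ≠ y ∧ ∀ k ∈ K, ∀ z ∈ seg x y, k • z = z

end Folding

/-!
Since `T` is a direct limit, the groups `G n` map onto `T.G`, and an element of `G n` that becomes
trivial in `T.G` becomes trivial at some finite stage (`IsDirectLimit.surjective`,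
`IsDirectLimit.exists_trans_eq_one`; both follow from the universal property, applied to other
actions on the tree of `T`). So it suffices to show, if no subgroup `H` as in the second alternative
exists, that from some stage on all steps are injective on the groups.

*Where a step can fail to be injective.* By hypothesis no element of a point stabilizer is killed.
The fold of `[v, x]` and `[v, y]` enlarges the stabilizer of the common image of `x` and `y` to the
group generated by the stabilizers of `x` and of `y` and the elements carrying `x` to `y`. If this
group is contained in the stabilizer of `v`, `x` or `y`, the fold is called degenerate, the vertex
morphism that follows is injective on stabilizers, hence injective, and so is the step
(`FoldStep.injective`). A non-degenerate fold not of type III has an *active* edge: `[v, x]` with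
the stabilizer of `x` not fixing `v`, or likewise `[v, y]`. Folds of type III occur finitely often,
because each strictly decreases the finite number of homomorphisms `G n → ℤ/2` that vanish on point
stabilizers (`FoldingSequence.exists_forall_untwisted`). So the aim is to show that eventually there
are no active edges (`exists_forall_not_isActive`).

*Ranks.* The label of a point is the image of its stabilizer in `T.G`; labels of points inside edges
fix arcs of `T`. If no `H` exists, ascending chains of arc-fixing subgroups are finite
(`wellFounded_arcRel`), and each arc-fixing subgroup has an ordinal rank, which drops strictly when
the subgroup grows. Let `A` be the least ordinal such that from some stage `N` on all active edges
have labels of rank less than `A`, and call a point `A`-thick if its label does not fix an arc or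
has rank less than `A`.

*Finitely many ranks.* From stage `N` on the active edges are `A`-thick, and then the image of the
`A`-thick part of `T N` remains a *core* of the `A`-thick part of `T n` (`FoldAt.core_image`,
`IsQuot.core_image`), one that contains every active edge (`FoldAt.seg_subset_core`). Hence the rank
of an active edge is bounded by the rank, less than `A`, of some label in `T N` (`Quiet.rank_mem`).
As `T N` is minimal and `G N` is finitely generated, the quotient graph is finite, and only finitely
many ranks occur in `T N`. Let `B < A` be the largest of those below `A`.

*The descent.* Consider the `ℤ/2`-valued invariant cocycles on the `B`-thick points of `T n` that
vanish on pairs of points in the same component. There are finitely many (`finite_setOf_isCocycle`).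
Past stage `N` each component of the `B`-thick part of `T (n + 1)` meets the image of that of `T n`,
so pulling back cocycles is injective and their number does not increase. If an active edge of rank
exactly `B` is folded, it separates `B`-thick points whose images are joined by `B`-thick points, so
counting crossings of its translates modulo 2 is a cocycle that is not a pullback, and the number
drops (`FoldAt.exists_isCocycle`, `ncard_isCocycle_step_le`). So eventually all active edges have
rank less than `B`, against the choice of `A`, unless there were no active edges at all.
-/

namespace Folding

/-! ### Segments in `ℝ`-trees -/

section Segments

variable {X : Type*} [MetricSpace X]

theorem mem_seg {x y z : X} : z ∈ seg x y ↔ dist x z + dist z y = dist x y := Iff.rfl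

theorem left_mem_seg (x y : X) : x ∈ seg x y := by simp [mem_seg]

theorem right_mem_seg (x y : X) : y ∈ seg x y := by simp [mem_seg]

theorem seg_comm (x y : X) : seg x y = seg y x := by
  ext z
  rw [mem_seg, mem_seg, dist_comm x z, dist_comm z y, dist_comm x y, add_comm]

theorem mem_seg_comm {x y z : X} : z ∈ seg x y ↔ z ∈ seg y x := by rw [seg_comm]

theorem mem_seg_self {x z : X} : z ∈ seg x x ↔ z = x := by
  rw [mem_seg, dist_self]
  constructor
  · intro h
    have h1 := dist_nonneg (x := x) (y := z)
    have h2 := dist_nonneg (x := z) (y := x)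
    exact dist_le_zero.1 (by linarith)
  · rintro rfl
    simp

theorem dist_le_of_mem_seg {x y z : X} (h : z ∈ seg x y) : dist x z ≤ dist x y := by
  have := dist_nonneg (x := z) (y := y)
  rw [mem_seg] at h
  linarith

theorem mem_seg_trans {x y z w : X} (hz : z ∈ seg x y) (hw : w ∈ seg x z) : w ∈ seg x y := by
  rw [mem_seg] at *
  linarith [dist_triangle x w y, dist_triangle w z y]

theorem mem_seg_trans_right {x y z w : X} (hz : z ∈ seg x y) (hw : w ∈ seg x z) :
    z ∈ seg w y := by
  rw [mem_seg] at *
  linarith [dist_triangle x w y, dist_triangle w z y]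

theorem seg_subset_left {x y z : X} (hz : z ∈ seg x y) : seg x z ⊆ seg x y :=
  fun _ hw => mem_seg_trans hz hw

theorem seg_subset_right {x y z : X} (hz : z ∈ seg x y) : seg z y ⊆ seg x y := by
  rw [seg_comm z y, seg_comm x y]
  exact seg_subset_left (mem_seg_comm.1 hz)

theorem eq_of_mem_seg_of_mem_seg {x z w : X} (hz : z ∈ seg x w) (hw : w ∈ seg x z) : z = w := by
  rw [mem_seg] at *
  have h1 := dist_nonneg (x := w) (y := z)
  rw [dist_comm w z] at hw h1
  exact dist_le_zero.1 (by linarith)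

/-- The part of `[x, y]` before `z` meets the part after `z` in `z` only. -/
theorem eq_of_mem_seg_both {x y z w : X} (hz : z ∈ seg x y) (h1 : w ∈ seg x z)
    (h2 : w ∈ seg z y) : w = z := by
  rw [mem_seg] at *
  have h0 := dist_nonneg (x := z) (y := w)
  rw [dist_comm w z] at h1
  exact (dist_le_zero.1 (by linarith [dist_triangle x w y])).symm

namespace IsRTree

variable (h : IsRTree X)
include h

theorem exists_mem_seg {x y : X} {t : ℝ} (h0 : 0 ≤ t) (h1 : t ≤ dist x y) :
    ∃ z ∈ seg x y, dist x z = t := by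
  obtain ⟨f, f0, f1, hf⟩ := h.geodesic x y
  have hd : (0 : ℝ) ≤ dist x y := dist_nonneg
  have e1 : dist x (f t) = t := by
    have := hf 0 ⟨le_rfl, hd⟩ t ⟨h0, h1⟩
    rw [f0] at this
    rw [this, zero_sub, abs_neg, abs_of_nonneg h0]
  have e2 : dist (f t) y = dist x y - t := by
    have := hf t ⟨h0, h1⟩ (dist x y) ⟨hd, le_rfl⟩
    rw [f1] at this
    rw [this, abs_sub_comm, abs_of_nonneg (by linarith)]
  exact ⟨f t, by rw [mem_seg, e1, e2]; ring, e1⟩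

theorem eq_of_dist_eq {x y z w : X} (hz : z ∈ seg x y) (hw : w ∈ seg x y)
    (hd : dist x z = dist x w) : z = w := by
  have := h.four_point x y z w
  rw [mem_seg] at *
  have hle : max (dist x z + dist y w) (dist x w + dist y z) ≤ dist x y := by
    rw [dist_comm y w, dist_comm y z]
    exact max_le (by linarith) (by linarith)
  exact dist_le_zero.1 (by linarith)

theorem mem_seg_of_dist_le {x y z w : X} (hz : z ∈ seg x y) (hw : w ∈ seg x y)
    (hd : dist x z ≤ dist x w) : z ∈ seg x w := by
  obtain ⟨z', hz', e⟩ := h.exists_mem_seg dist_nonneg hd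
  rwa [h.eq_of_dist_eq hz (mem_seg_trans hw hz') e.symm]

theorem seg_subset_union (x y z : X) : seg x y ⊆ seg x z ∪ seg z y := by
  intro p hp
  have h4 := h.four_point x y p z
  rw [mem_seg] at hp
  rcases le_max_iff.1 h4 with h4 | h4
  · right
    rw [mem_seg]
    have := dist_triangle z p y
    rw [dist_comm z p, dist_comm z y] at *
    linarith
  · left
    rw [mem_seg]
    have := dist_triangle x p z
    rw [dist_comm y p] at h4
    linarith

theorem exists_median (x y z : X) : ∃ o, o ∈ seg x y ∧ o ∈ seg x z ∧ o ∈ seg y z := by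
  have t1 := dist_triangle x y z
  have t2 := dist_triangle x z y
  have t3 := dist_triangle y x z
  rw [dist_comm z y] at t2
  rw [dist_comm y x] at t3
  obtain ⟨o, ho, e⟩ := h.exists_mem_seg (x := x) (y := y)
    (t := (dist x y + dist x z - dist y z) / 2) (by linarith) (by linarith)
  have ho' := ho
  rw [mem_seg] at ho'
  refine ⟨o, ho, ?_⟩
  rcases h.seg_subset_union x y z ho with hz | hz
  · refine ⟨hz, ?_⟩
    rw [mem_seg] at *
    rw [dist_comm y o]
    linarith
  · have hz' := mem_seg_comm.1 hz
    refine ⟨?_, hz'⟩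
    rw [mem_seg] at *
    rw [dist_comm y o] at hz'
    linarith

theorem mem_seg_of_inter {p q x : X} (hx : ∀ z, z ∈ seg x p → z ∈ seg x q → z = x) :
    x ∈ seg p q := by
  obtain ⟨o, h1, h2, h3⟩ := h.exists_median x p q
  rwa [← hx o h1 h2]

theorem mem_seg_of_overlap {p q x v : X} (h1 : x ∈ seg p v) (h2 : v ∈ seg x q) (hne : x ≠ v) :
    x ∈ seg p q ∧ v ∈ seg p q := by
  have h4 := h.four_point p v x q
  have hpos := dist_pos.2 hne
  simp only [mem_seg] at *
  rw [dist_comm v x] at h4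
  have key : dist p x + dist x v + dist v q ≤ dist p q := by
    rcases le_max_iff.1 h4 with h4 | h4 <;> linarith
  have a1 := dist_triangle p x q
  have a2 := dist_triangle p v q
  have a3 := dist_triangle x v q
  have a4 := dist_triangle p x v
  constructor <;> linarith

theorem exists_continuous_image (x y : X) :
    ∃ f : ℝ → X, ContinuousOn f (Set.Icc 0 (dist x y)) ∧ f '' Set.Icc 0 (dist x y) = seg x y ∧
      ∀ t ∈ Set.Icc 0 (dist x y), dist x (f t) = t := by
  obtain ⟨f, f0, f1, hf⟩ := h.geodesic x y
  have hd : (0 : ℝ) ≤ dist x y := dist_nonneg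
  have e : ∀ t ∈ Set.Icc 0 (dist x y), dist x (f t) = t := by
    intro t ht
    have := hf 0 ⟨le_rfl, hd⟩ t ht
    rw [f0] at this
    rw [this, zero_sub, abs_neg, abs_of_nonneg ht.1]
  have m : ∀ t ∈ Set.Icc 0 (dist x y), f t ∈ seg x y := by
    intro t ht
    have e2 := hf t ht (dist x y) ⟨hd, le_rfl⟩
    rw [f1, abs_sub_comm, abs_of_nonneg (by linarith [ht.2])] at e2
    rw [mem_seg, e t ht, e2]
    ring
  refine ⟨f, ?_, ?_, e⟩
  · have : LipschitzOnWith 1 f (Set.Icc 0 (dist x y)) :=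
      LipschitzOnWith.of_dist_le_mul fun s hs t ht => by simp [hf s hs t ht, Real.dist_eq]
    exact this.continuousOn
  · ext z
    constructor
    · rintro ⟨t, ht, rfl⟩
      exact m t ht
    · intro hz
      have ht : dist x z ∈ Set.Icc 0 (dist x y) := ⟨dist_nonneg, dist_le_of_mem_seg hz⟩
      exact ⟨_, ht, h.eq_of_dist_eq (m _ ht) hz (e _ ht)⟩

theorem isCompact_seg (x y : X) : IsCompact (seg x y) := by
  obtain ⟨f, hf, e, -⟩ := h.exists_continuous_image x y
  rw [← e]
  exact isCompact_Icc.image_of_continuousOn hf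

theorem isPreconnected_seg (x y : X) : IsPreconnected (seg x y) := by
  obtain ⟨f, hf, e, -⟩ := h.exists_continuous_image x y
  rw [← e]
  exact isPreconnected_Icc.image f hf

/-- Connected subsets of `ℝ`-trees are convex. -/
theorem seg_subset_of_isPreconnected {Z : Set X} (hZ : IsPreconnected Z) {x y : X} (hx : x ∈ Z)
    (hy : y ∈ Z) : seg x y ⊆ Z := by
  intro m hm
  by_contra hmZ
  -- Off `m`, whether `m` separates a point from `x` is locally constant.
  have loc : ∀ z z' : X, dist z z' < dist z m → (m ∈ seg x z ↔ m ∈ seg x z') := by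
    intro z z' hd
    have hnot : m ∉ seg z z' := fun hmem => absurd (dist_le_of_mem_seg hmem) (not_le.2 hd)
    constructor
    · intro hz
      rcases h.seg_subset_union x z z' hz with h1 | h1
      · exact h1
      · exact absurd (mem_seg_comm.1 h1) hnot
    · intro hz
      rcases h.seg_subset_union x z' z hz with h1 | h1
      · exact h1
      · exact absurd h1 hnot
  have hU : IsOpen {z : X | z ≠ m ∧ m ∈ seg x z} := by
    rw [Metric.isOpen_iff]
    rintro z ⟨hz, hz'⟩
    refine ⟨dist z m, dist_pos.2 hz, fun w hw => ?_⟩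
    rw [Metric.mem_ball'] at hw
    exact ⟨fun e => by rw [e] at hw; exact lt_irrefl _ hw, (loc z w hw).1 hz'⟩
  have hV : IsOpen {z : X | z ≠ m ∧ m ∉ seg x z} := by
    rw [Metric.isOpen_iff]
    rintro z ⟨hz, hz'⟩
    refine ⟨dist z m, dist_pos.2 hz, fun w hw => ?_⟩
    rw [Metric.mem_ball'] at hw
    exact ⟨fun e => by rw [e] at hw; exact lt_irrefl _ hw, fun h' => hz' ((loc z w hw).2 h')⟩
  have hne : ∀ z ∈ Z, z ≠ m := fun z hz e => hmZ (e ▸ hz)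
  have hxm : m ∉ seg x x := fun e => hne x hx (mem_seg_self.1 e).symm
  have := hZ.subset_or_subset hU hV
    (Set.disjoint_left.2 fun z h1 h2 => h2.2 h1.2)
    (fun z hz => by
      by_cases hc : m ∈ seg x z
      · exact Or.inl ⟨hne z hz, hc⟩
      · exact Or.inr ⟨hne z hz, hc⟩)
  rcases this with h1 | h1
  · exact hxm (h1 hx).2
  · exact (h1 hy).2 hm

theorem exists_mid {x y : X} (hne : x ≠ y) :
    ∃ m ∈ seg x y, m ≠ x ∧ m ≠ y ∧ dist x m = dist x y / 2 := by
  have hp := dist_pos.2 hne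
  obtain ⟨m, hm, e⟩ := h.exists_mem_seg (x := x) (y := y) (t := dist x y / 2)
    (by linarith) (by linarith)
  refine ⟨m, hm, ?_, ?_, e⟩
  · rintro rfl
    rw [dist_self] at e
    linarith
  · rintro rfl
    linarith

end IsRTree

theorem image_mem_seg {Y : Type*} [MetricSpace Y] {f : X → Y} {a b : X}
    (hf : ∀ p ∈ seg a b, ∀ q ∈ seg a b, dist (f p) (f q) = dist p q) {z : X} (hz : z ∈ seg a b) :
    f z ∈ seg (f a) (f b) := by
  rw [mem_seg, hf a (left_mem_seg a b) z hz, hf z hz b (right_mem_seg a b),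
    hf a (left_mem_seg a b) b (right_mem_seg a b)]
  exact hz

theorem image_seg {Y : Type*} [MetricSpace Y] (hX : IsRTree X) (hY : IsRTree Y) {f : X → Y}
    {a b : X} (hf : ∀ p ∈ seg a b, ∀ q ∈ seg a b, dist (f p) (f q) = dist p q) :
    f '' seg a b = seg (f a) (f b) := by
  ext z
  constructor
  · rintro ⟨p, hp, rfl⟩
    exact image_mem_seg hf hp
  · intro hz
    have e := hf a (left_mem_seg a b) b (right_mem_seg a b)
    obtain ⟨p, hp, hd⟩ := hX.exists_mem_seg (x := a) (y := b) (t := dist (f a) z) dist_nonneg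
      (by rw [← e]; exact dist_le_of_mem_seg hz)
    refine ⟨p, hp, hY.eq_of_dist_eq (image_mem_seg hf hp) hz ?_⟩
    rw [hf a (left_mem_seg a b) p hp, hd]

/-- A map that is isometric on an initial part of each segment does not increase distances. -/
theorem dist_le_of_locally_isometric {Y : Type*} [MetricSpace Y] (hX : IsRTree X) {f : X → Y}
    (hf : ∀ x y : X, x ≠ y → ∃ w ∈ seg x y, w ≠ x ∧
      ∀ p ∈ seg x w, ∀ q ∈ seg x w, dist (f p) (f q) = dist p q) (x y : X) :
    dist (f x) (f y) ≤ dist x y := by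
  obtain ⟨γ, hγ, hi, hd⟩ := hX.exists_continuous_image x y
  have hmem : ∀ t ∈ Set.Icc 0 (dist x y), γ t ∈ seg x y := fun t ht => hi ▸ ⟨t, ht, rfl⟩
  have h0 : (0 : ℝ) ≤ dist x y := dist_nonneg
  -- near each parameter `t`, on either side, `f ∘ γ` is isometric
  have hR : ∀ t ∈ Set.Ico 0 (dist x y), ∃ ε > 0, ∀ s ∈ Set.Icc 0 (dist x y), t ≤ s → s ≤ t + ε →
      dist (f (γ t)) (f (γ s)) = s - t := by
    intro t ht
    have htc : t ∈ Set.Icc 0 (dist x y) := ⟨ht.1, ht.2.le⟩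
    have hne : γ t ≠ y := fun e => by
      have := hd t htc
      rw [e] at this
      linarith [ht.2]
    obtain ⟨w, hw, hwne, hiso⟩ := hf _ _ hne
    refine ⟨dist (γ t) w, dist_pos.2 hwne.symm, fun s hs h1 h2 => ?_⟩
    have hts : γ t ∈ seg x (γ s) := hX.mem_seg_of_dist_le (hmem t htc) (hmem s hs)
      (by rw [hd t htc, hd s hs]; exact h1)
    have hdist : dist (γ t) (γ s) = s - t := by
      have := hts
      rw [mem_seg, hd t htc, hd s hs] at this
      linarith
    have hs' : γ s ∈ seg (γ t) y := mem_seg_trans_right (hmem s hs) hts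
    have : γ s ∈ seg (γ t) w := hX.mem_seg_of_dist_le hs' hw (by rw [hdist]; linarith)
    rw [hiso _ (left_mem_seg _ _) _ this, hdist]
  have hL : ∀ t ∈ Set.Ioc 0 (dist x y), ∃ ε > 0, ∀ s ∈ Set.Icc 0 (dist x y), s ≤ t → t ≤ s + ε →
      dist (f (γ t)) (f (γ s)) = t - s := by
    intro t ht
    have htc : t ∈ Set.Icc 0 (dist x y) := ⟨ht.1.le, ht.2⟩
    have hne : γ t ≠ x := fun e => by
      have := hd t htc
      rw [e, dist_self] at this
      linarith [ht.1]
    obtain ⟨w, hw, hwne, hiso⟩ := hf _ _ hne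
    refine ⟨dist (γ t) w, dist_pos.2 hwne.symm, fun s hs h1 h2 => ?_⟩
    have hts : γ s ∈ seg x (γ t) := hX.mem_seg_of_dist_le (hmem s hs) (hmem t htc)
      (by rw [hd t htc, hd s hs]; exact h1)
    have hdist : dist (γ t) (γ s) = t - s := by
      have := hts
      rw [mem_seg, hd t htc, hd s hs, dist_comm] at this
      linarith
    have : γ s ∈ seg (γ t) w := hX.mem_seg_of_dist_le (mem_seg_comm.1 hts) hw
      (by rw [hdist]; linarith)
    rw [hiso _ (left_mem_seg _ _) _ this, hdist]
  have hcont : ContinuousOn (fun t => f (γ t)) (Set.Icc 0 (dist x y)) := by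
    intro t ht
    rw [Metric.continuousWithinAt_iff]
    intro δ hδ
    have r1 : ∃ ε > 0, ∀ s ∈ Set.Icc 0 (dist x y), t ≤ s → s ≤ t + ε →
        dist (f (γ t)) (f (γ s)) = s - t := by
      rcases ht.2.lt_or_eq with hlt | heq
      · exact hR t ⟨ht.1, hlt⟩
      · refine ⟨1, one_pos, fun s hs h1 _ => ?_⟩
        have : s = t := le_antisymm (heq ▸ hs.2) h1
        simp [this]
    have r2 : ∃ ε > 0, ∀ s ∈ Set.Icc 0 (dist x y), s ≤ t → t ≤ s + ε →
        dist (f (γ t)) (f (γ s)) = t - s := by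
      rcases ht.1.lt_or_eq with hlt | heq
      · exact hL t ⟨hlt, ht.2⟩
      · refine ⟨1, one_pos, fun s hs h1 _ => ?_⟩
        have : s = t := le_antisymm h1 (heq ▸ hs.1)
        simp [this]
    obtain ⟨ε₁, p1, q1⟩ := r1
    obtain ⟨ε₂, p2, q2⟩ := r2
    refine ⟨min δ (min ε₁ ε₂), by positivity, fun s hs hst => ?_⟩
    rw [Real.dist_eq] at hst
    have b1 : |s - t| < δ := lt_of_lt_of_le hst (min_le_left _ _)
    have b2 : |s - t| < ε₁ := lt_of_lt_of_le hst ((min_le_right _ _).trans (min_le_left _ _))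
    have b3 : |s - t| < ε₂ := lt_of_lt_of_le hst ((min_le_right _ _).trans (min_le_right _ _))
    rw [dist_comm]
    rcases le_total t s with hle | hle
    · rw [abs_of_nonneg (by linarith)] at b1 b2
      rw [q1 s hs hle (by linarith)]
      exact b1
    · rw [abs_of_nonpos (by linarith)] at b1 b3
      rw [q2 s hs hle (by linarith)]
      linarith
  have hclosed : IsClosed ({t | dist (f (γ 0)) (f (γ t)) ≤ t} ∩ Set.Icc 0 (dist x y)) := by
    have : ContinuousOn (fun t => dist (f (γ 0)) (f (γ t)) - t) (Set.Icc 0 (dist x y)) :=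
      (continuous_dist.comp_continuousOn (continuousOn_const.prodMk hcont)).sub continuousOn_id
    have h2 := this.preimage_isClosed_of_isClosed isClosed_Icc (isClosed_Iic (a := (0 : ℝ)))
    convert h2 using 1
    ext t
    simp [and_comm]
  have key := hclosed.Icc_subset_of_forall_exists_gt (by simp) (fun t ht b hb => by
    obtain ⟨ε, hε, hε'⟩ := hR t ht.2
    have htb : t < b := hb
    set s := min b (min (t + ε) (dist x y)) with hs
    have hts : t < s := lt_min htb (lt_min (by linarith) ht.2.2)
    have hs1 : s ≤ t + ε := (min_le_right _ _).trans (min_le_left _ _)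
    have hs2 : s ≤ dist x y := (min_le_right _ _).trans (min_le_right _ _)
    refine ⟨s, ?_, hts, min_le_left _ _⟩
    have e1 := hε' s ⟨ht.2.1.trans hts.le, hs2⟩ hts.le hs1
    have e2 : dist (f (γ 0)) (f (γ t)) ≤ t := ht.1
    have := dist_triangle (f (γ 0)) (f (γ t)) (f (γ s))
    show dist (f (γ 0)) (f (γ s)) ≤ s
    linarith)
  have e0 : γ 0 = x := (dist_eq_zero.1 (hd 0 ⟨le_rfl, h0⟩)).symm
  have e1 : γ (dist x y) = y := hX.eq_of_dist_eq (hmem _ ⟨h0, le_rfl⟩) (right_mem_seg x y)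
    (hd _ ⟨h0, le_rfl⟩)
  have := key (Set.right_mem_Icc.2 h0)
  change dist (f (γ 0)) (f (γ (dist x y))) ≤ dist x y at this
  rwa [e0, e1] at this

end Segments

theorem Morphism.dist_le {S T : GTree.{u, v}} (f : Morphism S T) (x y : S.X) :
    dist (f.map x) (f.map y) ≤ dist x y :=
  dist_le_of_locally_isometric S.isRTree f.isometric x y

theorem Morphism.continuous {S T : GTree.{u, v}} (f : Morphism S T) : Continuous f.map :=
  (LipschitzWith.of_dist_le_mul (K := 1) fun x y => by simpa using f.dist_le x y).continuous

theorem Morphism.seg_subset_image {S T : GTree.{u, v}} (f : Morphism S T) (x y : S.X) :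
    seg (f.map x) (f.map y) ⊆ f.map '' seg x y :=
  T.isRTree.seg_subset_of_isPreconnected
    ((S.isRTree.isPreconnected_seg x y).image _ f.continuous.continuousOn)
    ⟨x, left_mem_seg x y, rfl⟩ ⟨y, right_mem_seg x y, rfl⟩

/-! ### Ordinary points and stabilizers -/

namespace GTree

variable (T : GTree.{u, v})

theorem smul_mem_seg {g : T.G} {x y z : T.X} : g • z ∈ seg (g • x) (g • y) ↔ z ∈ seg x y := by
  simp only [mem_seg, T.isometric]

theorem smul_mem_seg' {g : T.G} {x y z : T.X} : z ∈ seg (g • x) (g • y) ↔ g⁻¹ • z ∈ seg x y := by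
  rw [← T.smul_mem_seg (g := g) (z := g⁻¹ • z), smul_inv_smul]

theorem smul_eq_of_mem_seg {g : T.G} {a b z : T.X} (ha : g • a = a) (hb : g • b = b)
    (hz : z ∈ seg a b) : g • z = z := by
  have h1 : g • z ∈ seg a b := by
    have := T.smul_mem_seg (g := g).2 hz
    rwa [ha, hb] at this
  refine T.isRTree.eq_of_dist_eq h1 hz ?_
  have := T.isometric g a z
  rwa [ha] at this

theorem sameDirection_iff {x y z : T.X} : T.SameDirection x y z ↔ x ∉ seg y z := by
  constructor
  · rintro ⟨w, hne, h1, h2⟩ hx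
    have hp := dist_pos.2 hne
    simp only [mem_seg] at *
    have := dist_triangle y w z
    rw [dist_comm y x] at hx
    rw [dist_comm y w] at this
    rw [dist_comm w x] at hp
    linarith
  · intro hx
    obtain ⟨o, h1, h2, h3⟩ := T.isRTree.exists_median x y z
    exact ⟨o, fun e => hx (e ▸ h3), h1, h2⟩

variable {T}

theorem SameOrbit.symm {x y : T.X} (h : T.SameOrbit x y) : T.SameOrbit y x := by
  obtain ⟨g, rfl⟩ := h
  exact ⟨g⁻¹, inv_smul_smul g x⟩

/-- An ordinary point has two sides: it separates exactly the pairs of points that lie on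
different sides, and its stabilizer preserves the sides. -/
theorem IsOrdinary.exists_side {x : T.X} (hx : T.IsOrdinary x) :
    ∃ side : T.X → Prop, (∀ p q, p ≠ x → q ≠ x → (x ∈ seg p q ↔ ¬ (side p ↔ side q))) ∧
      ∀ g : T.G, g • x = x → ∀ p, p ≠ x → (side (g • p) ↔ side p) := by
  obtain ⟨y, z, hy, hz, hyz, hall, hno⟩ := hx
  simp only [T.sameDirection_iff, not_not] at hyz hall hno
  -- the sides are those of `y` and of `z`
  have tri : ∀ p q r : T.X, x ∉ seg p q → x ∉ seg q r → x ∉ seg p r := fun p q r h1 h2 h3 =>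
    (T.isRTree.seg_subset_union p r q h3).elim h1 h2
  have comm : ∀ p q : T.X, x ∉ seg p q → x ∉ seg q p := fun p q h h' => h (mem_seg_comm.1 h')
  have other : ∀ p, p ≠ x → (x ∈ seg p y ↔ x ∉ seg p z) := by
    intro p hp
    constructor
    · intro h1 h2
      exact (hall p hp).elim (fun h => h h1) (fun h => h h2)
    · intro h1 
      by_contra h2
      exact tri y p z (comm _ _ h2) h1 hyz
  have sep : ∀ p q, p ≠ x → q ≠ x → (x ∈ seg p q ↔ ¬ (x ∉ seg p y ↔ x ∉ seg q y)) := by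
    intro p q hp hq
    by_cases h1 : x ∈ seg p y <;> by_cases h2 : x ∈ seg q y
    · simp only [h1, h2, not_true_eq_false, iff_false]
      exact tri p z q ((other p hp).1 h1) (comm _ _ ((other q hq).1 h2))
    · simp only [h1, h2, not_true_eq_false, not_false_eq_true, iff_true]
      by_contra h3
      exact tri p q y h3 h2 h1
    · simp only [h1, h2, not_true_eq_false, not_false_eq_true, iff_false, iff_true]
      by_contra h3
      exact tri q p y (comm _ _ h3) h1 h2
    · simp only [h1, h2, not_false_eq_true, not_true_eq_false, iff_false]
      exact tri p y q h1 (comm _ _ h2)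
  refine ⟨fun p => x ∉ seg p y, sep, ?_⟩
  intro g hg p hp
  have hne : ∀ q, q ≠ x → g • q ≠ x := fun q hq e => hq (by
    rw [← hg] at e
    exact MulAction.injective g e)
  have inv : ∀ p q, x ∈ seg (g • p) (g • q) ↔ x ∈ seg p q := by
    intro p q
    conv_lhs => rw [← hg]
    exact T.smul_mem_seg
  by_contra hcon
  have hpg : x ∈ seg (g • p) p := (sep _ _ (hne p hp) hp).2 hcon
  have e1 := sep _ _ (hne p hp) (hne y hy)
  have e2 := sep _ _ (hne p hp) (hne z hz)
  rw [inv] at e1 e2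
  have o1 := other p hp
  have yy : x ∉ seg y y := fun h => hy (mem_seg_self.1 h).symm
  refine hno ⟨g, hg, ?_, ?_⟩
  · have := other _ (hne y hy)
    tauto
  · have := other _ (hne z hz)
    tauto

theorem IsOrdinary.notMem_seg_smul {x : T.X} (hx : T.IsOrdinary x) {g : T.G} (hg : g • x = x)
    {p : T.X} (hp : p ≠ x) : x ∉ seg p (g • p) := by
  obtain ⟨side, h1, h2⟩ := hx.exists_side
  have hne : g • p ≠ x := fun e => hp (by
    rw [← hg] at e
    exact MulAction.injective g e)
  rw [h1 _ _ hp hne, h2 g hg p hp]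
  simp

/-- The parity law: an ordinary point separates an even number of the pairs from a triple. -/
theorem IsOrdinary.mem_seg_iff {x : T.X} (hx : T.IsOrdinary x) {p q r : T.X} (hp : p ≠ x)
    (hq : q ≠ x) (hr : r ≠ x) : x ∈ seg p r ↔ ¬ (x ∈ seg p q ↔ x ∈ seg q r) := by
  obtain ⟨side, h1, -⟩ := hx.exists_side
  rw [h1 _ _ hp hq, h1 _ _ hq hr, h1 _ _ hp hr]
  tauto

end GTree

/-! ### Edges of simplicial trees -/

namespace SimplicialTree

variable {T : SimplicialTree.{u, v}}

theorem isOrdinary_of_notMem {p : T.X} (hp : p ∉ T.verts) : T.IsOrdinary p := by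
  by_contra h
  exact hp (T.mem_of_not_ordinary p h)

theorem IsEdge.symm {a b : T.X} (h : T.IsEdge a b) : T.IsEdge b a :=
  ⟨h.1.symm, by rw [seg_comm, h.2, Set.pair_comm]⟩

theorem IsEdge.left_mem {a b : T.X} (h : T.IsEdge a b) : a ∈ T.verts :=
  (h.2.symm.subset (Set.mem_insert a _)).2

theorem IsEdge.right_mem {a b : T.X} (h : T.IsEdge a b) : b ∈ T.verts := h.symm.left_mem

theorem IsEdge.eq_or_eq {a b p : T.X} (h : T.IsEdge a b) (hp : p ∈ seg a b) (hv : p ∈ T.verts) :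
    p = a ∨ p = b := by
  have : p ∈ ({a, b} : Set T.X) := h.2 ▸ ⟨hp, hv⟩
  simpa using this

theorem IsEdge.notMem_verts {a b p : T.X} (h : T.IsEdge a b) (hp : p ∈ seg a b) (ha : p ≠ a)
    (hb : p ≠ b) : p ∉ T.verts := fun hv => (h.eq_or_eq hp hv).elim ha hb

theorem smul_mem_verts_iff {g : T.G} {p : T.X} : g • p ∈ T.verts ↔ p ∈ T.verts := by
  refine ⟨fun h => ?_, T.smul_mem g p⟩
  have := T.smul_mem g⁻¹ _ h
  rwa [inv_smul_smul] at this

theorem IsEdge.smul {a b : T.X} (h : T.IsEdge a b) (g : T.G) : T.IsEdge (g • a) (g • b) := by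
  refine ⟨fun e => h.1 (MulAction.injective g e), ?_⟩
  ext p
  rw [Set.mem_inter_iff, T.toGTree.smul_mem_seg', ← smul_mem_verts_iff (g := g⁻¹),
    ← Set.mem_inter_iff, h.2]
  simp [inv_smul_eq_iff]

/-- A branch point is a vertex. -/
theorem mem_verts_of_branch {o p q r : T.X} (hp : p ≠ o) (hq : q ≠ o) (hr : r ≠ o)
    (h1 : o ∈ seg p q) (h2 : o ∈ seg q r) (h3 : o ∈ seg p r) : o ∈ T.verts := by
  by_contra hv
  have := (isOrdinary_of_notMem hv).mem_seg_iff hp hq hr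
  tauto

/-- A segment that starts inside an edge stays in the edge or leaves it through an end. -/
theorem IsEdge.exit {a b p : T.X} (h : T.IsEdge a b) (hp : p ∈ seg a b) (ha : p ≠ a) (hb : p ≠ b)
    (q : T.X) : q ∈ seg a b ∨ a ∈ seg p q ∨ b ∈ seg p q := by
  by_cases hqp : q = p
  · exact Or.inl (hqp ▸ hp)
  have main : ∀ a b : T.X, T.IsEdge a b → p ∈ seg a b → p ≠ a → p ≠ b → p ∉ seg q a →
      q ∈ seg a b ∨ a ∈ seg p q := by
    intro a b h hp ha hb hqa
    obtain ⟨o, h1, h2, h3⟩ := T.isRTree.exists_median p q a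
    have hop : o ≠ p := fun e => hqa (e ▸ h3)
    have hpa := mem_seg_comm.1 hp
    by_cases hoq : o = q
    · left
      rw [← hoq, seg_comm]
      exact seg_subset_right hpa (mem_seg_comm.1 (mem_seg_comm.1 h2))
    by_cases hoa : o = a
    · right
      rwa [← hoa]
    have hv : o ∈ T.verts := mem_verts_of_branch (Ne.symm hop) (Ne.symm hoq) (Ne.symm hoa) h1 h3 h2
    have hab : o ∈ seg b a := seg_subset_right hpa h2
    rcases h.eq_or_eq (mem_seg_comm.1 hab) hv with e | e
    · exact absurd e hoa
    · exact absurd (eq_of_mem_seg_of_mem_seg (x := a) hp (mem_seg_comm.1 (e ▸ h2))) hb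
  have hord := isOrdinary_of_notMem (h.notMem_verts hp ha hb)
  by_cases hqa : p ∈ seg q a
  · have hqb : p ∉ seg q b := by
      have := hord.mem_seg_iff hqp (Ne.symm ha) (Ne.symm hb)
      tauto
    rcases main b a h.symm (mem_seg_comm.1 hp) hb ha hqb with h1 | h1
    · exact Or.inl (mem_seg_comm.1 h1)
    · exact Or.inr (Or.inr h1)
  · rcases main a b h hp ha hb hqa with h1 | h1
    · exact Or.inl h1
    · exact Or.inr (Or.inl h1)

/-- Two edges that share a point which is inside one of them are equal. -/
theorem IsEdge.ends_eq {a b c d p : T.X} (h : T.IsEdge a b) (h' : T.IsEdge c d)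
    (hp : p ∈ seg a b) (ha : p ≠ a) (hb : p ≠ b) (hp' : p ∈ seg c d) :
    (c = a ∧ d = b) ∨ (c = b ∧ d = a) := by
  have hv := h.notMem_verts hp ha hb
  have hc : p ≠ c := fun e => hv (e ▸ h'.left_mem)
  have hd : p ≠ d := fun e => hv (e ▸ h'.right_mem)
  have key : ∀ c d : T.X, T.IsEdge c d → p ∈ seg c d → p ≠ d → c = a ∨ c = b := by
    intro c d h' hp' hd
    have aux : ∀ a : T.X, a ∈ T.verts → a ∈ seg p c → c = a := by
      intro a hav h1
      have h2 : a ∈ seg c d := mem_seg_trans hp' (mem_seg_comm.1 h1)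
      rcases h'.eq_or_eq h2 hav with e | e
      · exact e.symm
      · exact absurd (eq_of_mem_seg_of_mem_seg (x := c) hp' (mem_seg_comm.1 (e ▸ h1))) hd
    rcases h.exit hp ha hb c with h1 | h1 | h1
    · exact h.eq_or_eq h1 h'.left_mem
    · exact Or.inl (aux a h.left_mem h1)
    · exact Or.inr (aux b h.right_mem h1)
  have k1 := key c d h' hp' hd
  have k2 := key d c h'.symm (mem_seg_comm.1 hp') hc
  have hne := h'.1
  rcases k1 with rfl | rfl <;> rcases k2 with rfl | rfl <;> simp_all

/-- The stabilizer of a point inside an edge fixes the edge. -/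
theorem IsEdge.smul_eq {a b p : T.X} (h : T.IsEdge a b) (hp : p ∈ seg a b) (ha : p ≠ a)
    (hb : p ≠ b) {g : T.G} (hg : g • p = p) : g • a = a ∧ g • b = b := by
  have hp' : p ∈ seg (g • a) (g • b) := by
    rw [T.toGTree.smul_mem_seg', inv_smul_eq_iff.2 hg.symm]
    exact hp
  rcases h.ends_eq (h.smul g) hp ha hb hp' with h1 | h1
  · exact h1
  · exfalso
    refine (isOrdinary_of_notMem (h.notMem_verts hp ha hb)).notMem_seg_smul hg (Ne.symm ha) ?_
    rw [h1.1]
    exact hp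

theorem exists_isEdge {p : T.X} (hp : p ∉ T.verts) :
    ∃ a b, T.IsEdge a b ∧ p ∈ seg a b ∧ p ≠ a ∧ p ≠ b := by
  rcases T.covered p with h | ⟨a, b, hab, hv, h⟩
  · exact absurd h hp
  · have he : T.IsEdge a b := ⟨hab, hv⟩
    exact ⟨a, b, he, h, fun e => hp (e ▸ he.left_mem), fun e => hp (e ▸ he.right_mem)⟩

theorem finite_verts_inter_seg (p q : T.X) : (T.verts ∩ seg p q).Finite := by
  have hc : IsCompact (T.verts ∩ seg p q) := (T.isRTree.isCompact_seg p q).inter_left T.closed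
  refine hc.finite ?_
  have : IsDiscrete T.verts := ⟨T.discrete⟩
  exact this.mono Set.inter_subset_left

/-- If no vertex lies strictly between two points, then they lie in a common edge. -/
theorem exists_isEdge_of_forall {p q : T.X} (hne : p ≠ q)
    (hv : ∀ u ∈ T.verts, u ∈ seg p q → u = p ∨ u = q) :
    ∃ a b, T.IsEdge a b ∧ p ∈ seg a b ∧ q ∈ seg a b := by
  have main : ∀ p q : T.X, p ≠ q → p ∉ T.verts →
      (∀ u ∈ T.verts, u ∈ seg p q → u = p ∨ u = q) →
      ∃ a b, T.IsEdge a b ∧ p ∈ seg a b ∧ q ∈ seg a b := by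
    intro p q hne hp hv
    obtain ⟨a, b, he, hpe, ha, hb⟩ := exists_isEdge hp
    refine ⟨a, b, he, hpe, ?_⟩
    rcases he.exit hpe ha hb q with h | h | h
    · exact h
    · rcases hv a he.left_mem h with e | e
      · exact absurd e.symm ha
      · exact e ▸ left_mem_seg a b
    · rcases hv b he.right_mem h with e | e
      · exact absurd e.symm hb
      · exact e ▸ right_mem_seg a b
  by_cases hp : p ∈ T.verts
  · by_cases hq : q ∈ T.verts
    · refine ⟨p, q, ⟨hne, ?_⟩, left_mem_seg p q, right_mem_seg p q⟩
      ext u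
      constructor
      · rintro ⟨h1, h2⟩
        simpa using hv u h2 h1
      · rintro (rfl | rfl)
        · exact ⟨left_mem_seg _ _, hp⟩
        · exact ⟨right_mem_seg _ _, hq⟩
    · obtain ⟨a, b, he, h1, h2⟩ := main q p hne.symm hq
        (fun u hu hm => (hv u hu (mem_seg_comm.1 hm)).symm)
      exact ⟨a, b, he, h2, h1⟩
  · exact main p q hne hp hv

/-- Induction along segments: a relation that holds for points of a common edge and can be
concatenated along segments at vertices holds for all pairs of points. -/
theorem seg_induction {R : T.X → T.X → Prop} (hrefl : ∀ p, R p p)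
    (hedge : ∀ a b p q, T.IsEdge a b → p ∈ seg a b → q ∈ seg a b → R p q)
    (htrans : ∀ p q u, u ∈ T.verts → u ∈ seg p q → u ≠ p → u ≠ q → R p u → R u q → R p q)
    (p q : T.X) : R p q := by
  induction hn : ((T.verts ∩ seg p q) \ {p, q}).ncard using Nat.strong_induction_on
    generalizing p q with
  | _ n ih =>
    by_cases hne : p = q
    · exact hne ▸ hrefl p
    by_cases hv : ∀ u ∈ T.verts, u ∈ seg p q → u = p ∨ u = q
    · obtain ⟨a, b, he, h1, h2⟩ := exists_isEdge_of_forall hne hv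
      exact hedge a b p q he h1 h2
    · push Not at hv
      obtain ⟨u, hu, hm, hup, huq⟩ := hv
      have hfin : ((T.verts ∩ seg p q) \ {p, q}).Finite :=
        (finite_verts_inter_seg p q).subset Set.sdiff_subset
      have hmem : u ∈ (T.verts ∩ seg p q) \ {p, q} := ⟨⟨hu, hm⟩, by simp [hup, huq]⟩
      refine htrans p q u hu hm hup huq (ih _ ?_ p u rfl) (ih _ ?_ u q rfl)
      · rw [← hn]
        refine Set.ncard_lt_ncard ⟨?_, fun h => ?_⟩ hfin
        · rintro w ⟨⟨h1, h2⟩, h3⟩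
          have h4 := seg_subset_left hm h2
          refine ⟨⟨h1, h4⟩, ?_⟩
          simp only [Set.mem_insert_iff, Set.mem_singleton_iff, not_or] at h3 ⊢
          refine ⟨h3.1, ?_⟩
          rintro rfl
          exact huq (eq_of_mem_seg_of_mem_seg hm h2)
        · exact (h hmem).2 (by simp)
      · rw [← hn]
        refine Set.ncard_lt_ncard ⟨?_, fun h => ?_⟩ hfin
        · rintro w ⟨⟨h1, h2⟩, h3⟩
          have h4 := seg_subset_right hm h2
          refine ⟨⟨h1, h4⟩, ?_⟩
          simp only [Set.mem_insert_iff, Set.mem_singleton_iff, not_or] at h3 ⊢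
          refine ⟨?_, h3.2⟩
          rintro rfl
          exact hup (eq_of_mem_seg_of_mem_seg (mem_seg_comm.1 hm) (mem_seg_comm.1 h2))
        · exact (h hmem).2 (by simp)

/-- A segment between two points outside an open edge that contains a point inside the edge
contains the edge. -/
theorem IsEdge.ends_mem_seg {a b z p q : T.X} (h : T.IsEdge a b) (hz : z ∈ seg a b) (ha : z ≠ a)
    (hb : z ≠ b) (hzp : z ∈ seg p q) (hp : p ∈ seg a b → p = a ∨ p = b)
    (hq : q ∈ seg a b → q = a ∨ q = b) : (a ∈ seg p z ∧ b ∈ seg z q) ∨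
      (b ∈ seg p z ∧ a ∈ seg z q) := by
  have key : ∀ p : T.X, (p ∈ seg a b → p = a ∨ p = b) → a ∈ seg z p ∨ b ∈ seg z p := by
    intro p hp
    rcases h.exit hz ha hb p with h1 | h1
    · rcases hp h1 with rfl | rfl
      · exact Or.inl (right_mem_seg _ _)
      · exact Or.inr (right_mem_seg _ _)
    · exact h1
  have bad : ∀ c : T.X, z ≠ c → c ∈ seg z p → c ∈ seg z q → False := by
    intro c hc h1 h2
    exact hc.symm (eq_of_mem_seg_both hzp (mem_seg_comm.1 h1) h2)
  rcases key p hp with h1 | h1 <;> rcases key q hq with h2 | h2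
  · exact (bad a ha h1 h2).elim
  · exact Or.inl ⟨mem_seg_comm.1 h1, h2⟩
  · exact Or.inr ⟨mem_seg_comm.1 h1, h2⟩
  · exact (bad b hb h1 h2).elim

/-- A minimal tree of a finitely generated group is covered by the translates of finitely many
segments. -/
theorem exists_finite_cover (T : SimplicialTree.{u, v}) (hfg : Group.FG T.G)
    (hmin : T.toGTree.IsMinimal) {b : T.X} :
    ∃ S : Set T.G, S.Finite ∧ ∀ p : T.X, ∃ g : T.G, g • p = b ∨ ∃ s ∈ S, g • p ∈ seg b (s • b) := by
  obtain ⟨S, hS, hfin⟩ := Group.fg_iff.1 hfg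
  refine ⟨S, hfin, ?_⟩
  set Z : Set T.X := {p | ∃ g : T.G, g • p = b ∨ ∃ s ∈ S, g • p ∈ seg b (s • b)} with hZ
  have hinv : ∀ (g : T.G), ∀ p ∈ Z, g • p ∈ Z := by
    rintro g p ⟨k, hk⟩
    exact ⟨k * g⁻¹, by simpa [mul_smul] using hk⟩
  have hb : b ∈ Z := ⟨1, Or.inl (one_smul _ _)⟩
  have htr : ∀ p q r : T.X, seg p q ⊆ Z → seg q r ⊆ Z → seg p r ⊆ Z := fun p q r h1 h2 z hz =>
    (T.isRTree.seg_subset_union p r q hz).elim (fun h => h1 h) (fun h => h2 h)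
  have hsm : ∀ (g : T.G) (p q : T.X), seg p q ⊆ Z → seg (g • p) (g • q) ⊆ Z := by
    intro g p q h z hz
    rw [T.toGTree.smul_mem_seg'] at hz
    have := hinv g _ (h hz)
    rwa [smul_inv_smul] at this
  have hgb : ∀ g : T.G, seg b (g • b) ⊆ Z := by
    intro g
    have hg : g ∈ Subgroup.closure S := by rw [hS]; trivial
    induction hg using Subgroup.closure_induction with
    | mem s hs => exact fun z hz => ⟨1, Or.inr ⟨s, hs, by rwa [one_smul]⟩⟩
    | one =>
      intro z hz
      rw [one_smul, mem_seg_self] at hz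
      rwa [hz]
    | mul g k _ _ h1 h2 =>
      refine htr _ _ _ h1 ?_
      rw [mul_smul]
      exact hsm g _ _ h2
    | inv g _ h1 =>
      have := hsm g⁻¹ _ _ h1
      rwa [inv_smul_smul, seg_comm] at this
  have hpb : ∀ p ∈ Z, ∃ g : T.G, seg p (g • b) ⊆ Z := by
    rintro p ⟨g, h | ⟨s, hs, h⟩⟩
    · refine ⟨g⁻¹, fun z hz => ?_⟩
      rw [← h, inv_smul_smul, mem_seg_self] at hz
      exact hz ▸ ⟨g, Or.inl h⟩
    · refine ⟨g⁻¹, ?_⟩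
      have : seg (g • p) b ⊆ Z := by
        intro z hz
        rw [seg_comm] at hz
        exact ⟨1, Or.inr ⟨s, hs, by rw [one_smul]; exact seg_subset_left h hz⟩⟩
      have := hsm g⁻¹ _ _ this
      rwa [inv_smul_smul] at this
  have huniv := hmin Z ⟨b, hb⟩ (by
    intro x hx y hy
    obtain ⟨g, hg⟩ := hpb x hx
    obtain ⟨k, hk⟩ := hpb y hy
    refine htr _ (g • b) _ hg (htr _ (k • b) _ ?_ (by rwa [seg_comm]))
    have := hsm g _ _ (hgb (g⁻¹ * k))
    rwa [mul_smul, smul_inv_smul] at this) hinv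
  intro p
  have : p ∈ Z := huniv ▸ Set.mem_univ p
  exact this

/-- A minimal simplicial tree of a finitely generated group has only finitely many orbits of
vertices and edges. -/
theorem exists_finite_representatives (T : SimplicialTree.{u, v}) (hfg : Group.FG T.G)
    (hmin : T.toGTree.IsMinimal) :
    ∃ W : Set T.X, W.Finite ∧ W ⊆ T.verts ∧ (∀ p ∈ T.verts, ∃ g : T.G, g • p ∈ W) ∧
      ∀ p ∉ T.verts, ∃ g : T.G, ∃ a ∈ W, ∃ a' ∈ W, T.IsEdge a a' ∧ g • p ∈ seg a a' := by
  obtain ⟨b, hb⟩ := T.nonempty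
  obtain ⟨S, hfin, hS⟩ := exists_finite_cover T hfg hmin (b := b)
  refine ⟨{b} ∪ ⋃ s ∈ S, T.verts ∩ seg b (s • b), ?_, ?_, ?_, ?_⟩
  · exact (Set.finite_singleton b).union (hfin.biUnion fun s _ => finite_verts_inter_seg _ _)
  · rintro p (rfl | hp)
    · exact hb
    · simp only [Set.mem_iUnion] at hp
      obtain ⟨s, -, h⟩ := hp
      exact h.1
  · intro p hp
    obtain ⟨g, h | ⟨s, hs, h⟩⟩ := hS p
    · exact ⟨g, Or.inl h⟩
    · refine ⟨g, Or.inr ?_⟩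
      simp only [Set.mem_iUnion]
      exact ⟨s, hs, T.smul_mem g p hp, h⟩
  · intro p hp
    obtain ⟨g, h | ⟨s, hs, h⟩⟩ := hS p
    · exact absurd (smul_mem_verts_iff.1 (h ▸ hb)) hp
    · have hgp : g • p ∉ T.verts := fun h' => hp (smul_mem_verts_iff.1 h')
      obtain ⟨a, a', he, hm, ha, ha'⟩ := exists_isEdge hgp
      have hmem : ∀ c, c ∈ T.verts → c ∈ seg b (s • b) →
          c ∈ {b} ∪ ⋃ s ∈ S, T.verts ∩ seg b (s • b) := by
        intro c h1 h2
        right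
        simp only [Set.mem_iUnion]
        exact ⟨s, hs, h1, h2⟩
      have hends := he.ends_mem_seg hm ha ha' h (fun h' => he.eq_or_eq h' hb)
        (fun h' => he.eq_or_eq h' (T.smul_mem s b hb))
      refine ⟨g, a, hmem a he.left_mem ?_, a', hmem a' he.right_mem ?_, he, hm⟩
      · rcases hends with h1 | h1
        · exact seg_subset_left h h1.1
        · exact seg_subset_right h h1.2
      · rcases hends with h1 | h1
        · exact seg_subset_right h h1.2
        · exact seg_subset_left h h1.1

/-- The translates of a point inside an edge are separated. -/
theorem finite_orbit_inter_seg {a b m : T.X} (h : T.IsEdge a b) (hm : m ∈ seg a b)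
    (hd : dist a m = dist a b / 2) (p q : T.X) :
    ({z | T.SameOrbit m z} ∩ seg p q).Finite := by
  have hpos := dist_pos.2 h.1
  have hmb : dist b m = dist a b / 2 := by
    rw [mem_seg] at hm
    rw [dist_comm]
    linarith
  have ha : m ≠ a := by
    rintro rfl
    rw [dist_self] at hd
    linarith
  have hb : m ≠ b := by
    rintro rfl
    rw [dist_self] at hmb
    linarith
  have key : ∀ g : T.G, g • m ≠ m → dist a b / 2 ≤ dist m (g • m) := by
    intro g hg
    rcases h.exit hm ha hb (g • m) with h1 | h1 | h1
    · exfalso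
      have hg1 : g • m ∈ seg (g • a) (g • b) := T.toGTree.smul_mem_seg.2 hm
      have e1 := T.isometric g a m
      have e2 := T.isometric g b m
      have hne : ∀ c, m ≠ c → c ∈ T.verts → g • m ≠ c := fun c _ hc e =>
        h.notMem_verts hm ha hb (smul_mem_verts_iff.1 (e ▸ hc))
      have := h.ends_eq (h.smul g) h1 (hne a ha h.left_mem) (hne b hb h.right_mem) hg1
      refine hg (T.isRTree.eq_of_dist_eq h1 hm ?_)
      rcases this with ⟨ea, eb⟩ | ⟨ea, eb⟩
      · rw [ea] at e1
        rw [e1]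
      · rw [eb] at e2
        rw [e2, hd, hmb]
    · have := dist_le_of_mem_seg h1
      rw [dist_comm m a] at this
      linarith
    · have := dist_le_of_mem_seg h1
      rw [dist_comm m b] at this
      linarith
  have hsep : ({z | T.SameOrbit m z} : Set T.X).Pairwise fun x y => dist a b / 2 ≤ dist x y := by
    rintro x ⟨g, rfl⟩ y ⟨k, rfl⟩ hxy
    have e := T.isometric g⁻¹ (g • m) (k • m)
    rw [inv_smul_smul, ← mul_smul] at e
    rw [← e]
    refine key _ fun e' => hxy ?_
    rw [mul_smul, inv_smul_eq_iff] at e'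
    exact e'.symm
  have hc : IsCompact ({z | T.SameOrbit m z} ∩ seg p q) :=
    (T.isRTree.isCompact_seg p q).inter_left
      (Metric.isClosed_of_pairwise_le_dist (by linarith) hsep)
  refine hc.finite ⟨?_⟩
  refine DiscreteTopology.of_forall_le_dist (r := dist a b / 2) (by linarith) ?_
  rintro ⟨x, hx⟩ ⟨y, hy⟩ hxy
  exact hsep hx.1 hy.1 fun e => hxy (Subtype.ext e)

end SimplicialTree

/-! ### Labels and thick points -/

section Labels

variable {G : Type*} [Group G]

/-- The label of a point: the image of its stabilizer in a fixed target group. -/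
def label (T : GTree.{u, v}) (ψ : T.G →* G) (p : T.X) : Subgroup G :=
  (MulAction.stabilizer T.G p).map ψ

/-- A family of subgroups that is closed under passing to subgroups and to conjugates. -/
structure IsFamily (𝒟 : Set (Subgroup G)) : Prop where
  down : ∀ K L : Subgroup G, K ≤ L → L ∈ 𝒟 → K ∈ 𝒟
  conj : ∀ (g : G) (K : Subgroup G), K ∈ 𝒟 → K.map (MulAut.conj g).toMonoidHom ∈ 𝒟

/-- The thick points: those whose label is outside the family `𝒟`. In a simplicial tree they form
a closed subforest. -/
def thick (T : GTree.{u, v}) (ψ : T.G →* G) (𝒟 : Set (Subgroup G)) : Set T.X :=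
  {p | label T ψ p ∉ 𝒟}

variable {T T' : GTree.{u, v}} {ψ : T.G →* G} {ψ' : T'.G →* G} {𝒟 : Set (Subgroup G)}

theorem mem_label {p : T.X} {k : G} : k ∈ label T ψ p ↔ ∃ g : T.G, g • p = p ∧ ψ g = k := Iff.rfl

theorem label_le_of_stabilizer_le {p q : T.X} (h : ∀ g : T.G, g • p = p → g • q = q) :
    label T ψ p ≤ label T ψ q :=
  Subgroup.map_mono fun g hg => h g hg

theorem label_smul (g : T.G) (p : T.X) :
    label T ψ (g • p) = (label T ψ p).map (MulAut.conj (ψ g)).toMonoidHom := by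
  ext k
  simp only [mem_label, Subgroup.mem_map, MulEquiv.coe_toMonoidHom, MulAut.conj_apply]
  constructor
  · rintro ⟨h, hh, rfl⟩
    refine ⟨_, ⟨g⁻¹ * h * g, ?_, rfl⟩, ?_⟩
    · rw [mul_smul, mul_smul, hh, inv_smul_smul]
    · simp [mul_assoc]
  · rintro ⟨_, ⟨h, hh, rfl⟩, rfl⟩
    refine ⟨g * h * g⁻¹, ?_, by simp⟩
    rw [mul_smul, mul_smul, inv_smul_smul, hh]

theorem smul_mem_thick_iff (h𝒟 : IsFamily 𝒟) {g : T.G} {p : T.X} :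
    g • p ∈ thick T ψ 𝒟 ↔ p ∈ thick T ψ 𝒟 := by
  have main : ∀ (g : T.G) (p : T.X), p ∉ thick T ψ 𝒟 → g • p ∉ thick T ψ 𝒟 := by
    intro g p hp
    simp only [thick, Set.mem_ofPred_eq, not_not] at *
    rw [label_smul]
    exact h𝒟.conj _ _ hp
  constructor
  · intro h
    by_contra h'
    exact main g p h' h
  · intro h
    by_contra h'
    have := main g⁻¹ _ h'
    rw [inv_smul_smul] at this
    exact this h

theorem mem_thick_of_stabilizer_le (h𝒟 : IsFamily 𝒟) {p q : T.X} (hp : p ∈ thick T ψ 𝒟)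
    (h : ∀ g : T.G, g • p = p → g • q = q) : q ∈ thick T ψ 𝒟 :=
  fun hq => hp (h𝒟.down _ _ (label_le_of_stabilizer_le h) hq)

theorem label_le_label_map (f : Morphism T T') (hψ : ∀ g, ψ' (f.hom g) = ψ g) (p : T.X) :
    label T ψ p ≤ label T' ψ' (f.map p) := by
  rintro _ ⟨g, hg, rfl⟩
  refine ⟨f.hom g, ?_, hψ g⟩
  have hg' : g • p = p := hg
  show f.hom g • f.map p = f.map p
  rw [← f.map_smul, hg']

theorem map_mem_thick (h𝒟 : IsFamily 𝒟) (f : Morphism T T') (hψ : ∀ g, ψ' (f.hom g) = ψ g)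
    {p : T.X} (hp : p ∈ thick T ψ 𝒟) : f.map p ∈ thick T' ψ' 𝒟 :=
  fun h => hp (h𝒟.down _ _ (label_le_label_map f hψ p) h)

theorem seg_map_subset_thick (h𝒟 : IsFamily 𝒟) (f : Morphism T T')
    (hψ : ∀ g, ψ' (f.hom g) = ψ g) {p q : T.X} (hpq : seg p q ⊆ thick T ψ 𝒟) :
    seg (f.map p) (f.map q) ⊆ thick T' ψ' 𝒟 := by
  intro z hz
  obtain ⟨w, hw, rfl⟩ := f.seg_subset_image p q hz
  exact map_mem_thick h𝒟 f hψ (hpq hw)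

theorem seg_subset_thick_trans {p q r : T.X} (h1 : seg p q ⊆ thick T ψ 𝒟)
    (h2 : seg q r ⊆ thick T ψ 𝒟) : seg p r ⊆ thick T ψ 𝒟 := fun _ hz =>
  (T.isRTree.seg_subset_union p r q hz).elim (fun h => h1 h) (fun h => h2 h)

theorem seg_subset_thick_smul (h𝒟 : IsFamily 𝒟) {p q : T.X} (g : T.G)
    (h : seg p q ⊆ thick T ψ 𝒟) : seg (g • p) (g • q) ⊆ thick T ψ 𝒟 := by
  intro z hz
  rw [T.smul_mem_seg'] at hz
  exact (smul_mem_thick_iff h𝒟).1 (h hz)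

theorem seg_self_subset_thick {p : T.X} (h : p ∈ thick T ψ 𝒟) : seg p p ⊆ thick T ψ 𝒟 := by
  intro z hz
  rwa [mem_seg_self.1 hz]

theorem seg_subset_thick_of_fixed (h𝒟 : IsFamily 𝒟) {p q : T.X} (hp : p ∈ thick T ψ 𝒟)
    (h : ∀ g : T.G, g • p = p → g • q = q) : seg p q ⊆ thick T ψ 𝒟 := fun _ hz =>
  mem_thick_of_stabilizer_le h𝒟 hp fun g hg => T.smul_eq_of_mem_seg hg (h g hg) hz

theorem SimplicialTree.IsEdge.seg_subset_thick {T : SimplicialTree.{u, v}}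
    {ψ : T.G →* G} (h𝒟 : IsFamily 𝒟) {a b p : T.X} (h : T.IsEdge a b) (hp : p ∈ seg a b)
    (ha : p ≠ a) (hb : p ≠ b) (ht : p ∈ thick T.toGTree ψ 𝒟) :
    seg a b ⊆ thick T.toGTree ψ 𝒟 := fun _ hz =>
  mem_thick_of_stabilizer_le h𝒟 ht fun _ hg =>
    T.toGTree.smul_eq_of_mem_seg (h.smul_eq hp ha hb hg).1 (h.smul_eq hp ha hb hg).2 hz

/-! ### Invariant cocycles on the thick points -/

/-- The invariant cocycles modulo `2` on the thick points that vanish on pairs of points in the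
same component. -/
structure IsCocycle (T : GTree.{u, v}) (ψ : T.G →* G) (𝒟 : Set (Subgroup G))
    (c : thick T ψ 𝒟 → thick T ψ 𝒟 → ZMod 2) : Prop where
  add : ∀ p q r, c p q + c q r = c p r
  inv : ∀ (g : T.G) (p q p' q' : thick T ψ 𝒟), (p' : T.X) = g • (p : T.X) →
    (q' : T.X) = g • (q : T.X) → c p' q' = c p q
  zero : ∀ p q : thick T ψ 𝒟, seg (p : T.X) q ⊆ thick T ψ 𝒟 → c p q = 0

/-- Every component of the thick part of `T'` meets the image of the thick part of `T`. -/
def Hits (ψ : T.G →* G) (ψ' : T'.G →* G) (𝒟 : Set (Subgroup G)) (f : T.X → T'.X) : Prop :=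
  ∀ q ∈ thick T' ψ' 𝒟, ∃ p ∈ thick T ψ 𝒟, seg (f p) q ⊆ thick T' ψ' 𝒟

theorem finite_setOf_isCocycle {T : SimplicialTree.{u, v}} {ψ : T.G →* G} (h𝒟 : IsFamily 𝒟)
    (hfg : Group.FG T.G) (hmin : T.toGTree.IsMinimal) :
    {c | IsCocycle T.toGTree ψ 𝒟 c}.Finite := by
  rcases isEmpty_or_nonempty (thick T.toGTree ψ 𝒟) with hE | ⟨⟨b⟩⟩
  · exact Set.toFinite _
  obtain ⟨S, hS, hSfin⟩ := Group.fg_iff.1 hfg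
  obtain ⟨W, hWfin, -, hW1, hW2⟩ := SimplicialTree.exists_finite_representatives T hfg hmin
  have : Finite S := hSfin
  have : Finite W := hWfin
  let sm : T.G → thick T.toGTree ψ 𝒟 → thick T.toGTree ψ 𝒟 := fun g p =>
    ⟨g • (p : T.X), (smul_mem_thick_iff h𝒟).2 p.2⟩
  classical
  -- a cocycle is determined by its values at `(b, s • b)` and at `(b, w)`
  let ev : (thick T.toGTree ψ 𝒟 → thick T.toGTree ψ 𝒟 → ZMod 2) →
      (S → ZMod 2) × (W → ZMod 2) := fun c =>
    (fun s => c b (sm s b), fun w => if h : (w : T.X) ∈ thick T.toGTree ψ 𝒟 then c b ⟨w, h⟩ else 0)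
  refine Set.Finite.of_finite_image (f := ev) (Set.toFinite _) ?_
  intro c hc c' hc' hcc
  have e1 : ∀ s ∈ S, c b (sm s b) = c' b (sm s b) := fun s hs =>
    congrFun (congrArg Prod.fst hcc) ⟨s, hs⟩
  have e2 : ∀ w ∈ W, ∀ h : w ∈ thick T.toGTree ψ 𝒟, c b ⟨w, h⟩ = c' b ⟨w, h⟩ := by
    intro w hw h
    have := congrFun (congrArg Prod.snd hcc) ⟨w, hw⟩
    simpa [ev, h] using this
  have self0 : ∀ {c}, IsCocycle T.toGTree ψ 𝒟 c → ∀ p, c p p = 0 := fun hc p =>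
    hc.zero p p (seg_self_subset_thick p.2)
  have eg : ∀ g : T.G, c b (sm g b) = c' b (sm g b) := by
    intro g
    have hg : g ∈ Subgroup.closure S := by rw [hS]; trivial
    induction hg using Subgroup.closure_induction with
    | mem s hs => exact e1 s hs
    | one =>
      have : sm 1 b = b := Subtype.ext (one_smul _ _)
      rw [this, self0 hc, self0 hc']
    | mul g k _ _ h1 h2 =>
      have hm : ((sm (g * k) b : thick T.toGTree ψ 𝒟) : T.X) = g • ((sm k b : _) : T.X) :=
        mul_smul g k _
      rw [← hc.add b (sm g b) (sm (g * k) b), ← hc'.add b (sm g b) (sm (g * k) b), h1,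
        hc.inv g b (sm k b) (sm g b) _ rfl hm, hc'.inv g b (sm k b) (sm g b) _ rfl hm, h2]
    | inv g _ h1 =>
      have hm : (b : T.X) = g • ((sm g⁻¹ b : _) : T.X) := (smul_inv_smul g (b : T.X)).symm
      rw [← hc.inv g b (sm g⁻¹ b) (sm g b) b rfl hm, ← hc'.inv g b (sm g⁻¹ b) (sm g b) b rfl hm]
      have a1 := hc.add b (sm g b) b
      have a2 := hc'.add b (sm g b) b
      rw [self0 hc] at a1
      rw [self0 hc'] at a2
      rw [h1] at a1
      exact add_left_cancel (a1.trans a2.symm)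
  have ebp : ∀ p, c b p = c' b p := by
    intro p
    have hjoin : ∃ (g : T.G) (w : T.X), w ∈ W ∧ seg (g • (p : T.X)) w ⊆ thick T.toGTree ψ 𝒟 := by
      by_cases hp : (p : T.X) ∈ T.verts
      · obtain ⟨g, hg⟩ := hW1 p hp
        exact ⟨g, _, hg, seg_self_subset_thick (sm g p).2⟩
      · obtain ⟨g, a, ha, a', -, he, hm⟩ := hW2 p hp
        have hgp : g • (p : T.X) ∉ T.verts := fun h => hp (SimplicialTree.smul_mem_verts_iff.1 h)
        have := he.seg_subset_thick h𝒟 hm (fun e => hgp (e ▸ he.left_mem))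
          (fun e => hgp (e ▸ he.right_mem)) (sm g p).2
        refine ⟨g, a, ha, ?_⟩
        rw [seg_comm]
        exact (seg_subset_left hm).trans this
    obtain ⟨g, w, hw, hseg⟩ := hjoin
    have hwt : w ∈ thick T.toGTree ψ 𝒟 := hseg (right_mem_seg _ _)
    have : ∀ {c}, IsCocycle T.toGTree ψ 𝒟 c → c b p = -c b (sm g b) + c b ⟨w, hwt⟩ := by
      intro c hc
      have h1 := hc.inv g b p (sm g b) (sm g p) rfl rfl
      have h2 := hc.zero (sm g p) ⟨w, hwt⟩ hseg
      have h3 := hc.add b (sm g b) (sm g p)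
      have h4 := hc.add b (sm g p) ⟨w, hwt⟩
      rw [h2, add_zero] at h4
      rw [← h1, ← h4, ← h3]
      ring
    rw [this hc, this hc', eg, e2 w hw hwt]
  funext p q
  have h1 := hc.add b p q
  have h2 := hc'.add b p q
  rw [ebp, ebp, ← h2] at h1
  exact add_left_cancel h1

theorem ncard_isCocycle_le (h𝒟 : IsFamily 𝒟) (f : Morphism T T')
    (hψ : ∀ g, ψ' (f.hom g) = ψ g) (hits : Hits ψ ψ' 𝒟 f.map)
    (hfin : {c | IsCocycle T ψ 𝒟 c}.Finite) :
    {c | IsCocycle T' ψ' 𝒟 c}.ncard ≤ {c | IsCocycle T ψ 𝒟 c}.ncard ∧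
    ((∃ c, IsCocycle T ψ 𝒟 c ∧ ∃ p q, c p q ≠ 0 ∧
        seg (f.map (p : T.X)) (f.map (q : T.X)) ⊆ thick T' ψ' 𝒟) →
      {c | IsCocycle T' ψ' 𝒟 c}.ncard < {c | IsCocycle T ψ 𝒟 c}.ncard) := by
  let fm : thick T ψ 𝒟 → thick T' ψ' 𝒟 := fun p => ⟨f.map p, map_mem_thick h𝒟 f hψ p.2⟩
  let pull : (thick T' ψ' 𝒟 → thick T' ψ' 𝒟 → ZMod 2) → (thick T ψ 𝒟 → thick T ψ 𝒟 → ZMod 2) :=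
    fun c p q => c (fm p) (fm q)
  have hpull : ∀ c, IsCocycle T' ψ' 𝒟 c → IsCocycle T ψ 𝒟 (pull c) := by
    intro c hc
    refine ⟨fun p q r => hc.add _ _ _, fun g p q p' q' hp hq => ?_, fun p q hpq => ?_⟩
    · exact hc.inv (f.hom g) _ _ _ _ (by simp [fm, hp, f.map_smul]) (by simp [fm, hq, f.map_smul])
    · exact hc.zero _ _ (seg_map_subset_thick h𝒟 f hψ hpq)
  have hinj : Set.InjOn pull {c | IsCocycle T' ψ' 𝒟 c} := by
    intro c hc c' hc' hcc
    funext q r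
    obtain ⟨p, hp, hpq⟩ := hits q q.2
    obtain ⟨s, hs, hsr⟩ := hits r r.2
    have key : ∀ {c}, IsCocycle T' ψ' 𝒟 c → c q r = pull c ⟨p, hp⟩ ⟨s, hs⟩ := by
      intro c hc
      have h1 := hc.add (fm ⟨p, hp⟩) q r
      have h2 := hc.add (fm ⟨p, hp⟩) (fm ⟨s, hs⟩) r
      rw [hc.zero (fm ⟨p, hp⟩) q hpq, zero_add] at h1
      rw [hc.zero (fm ⟨s, hs⟩) r hsr, add_zero] at h2
      exact h1.trans h2.symm
    rw [key hc, key hc', hcc]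
  have himg : pull '' {c | IsCocycle T' ψ' 𝒟 c} ⊆ {c | IsCocycle T ψ 𝒟 c} := by
    rintro _ ⟨c, hc, rfl⟩
    exact hpull c hc
  rw [← hinj.ncard_image]
  refine ⟨Set.ncard_le_ncard himg hfin, ?_⟩
  rintro ⟨c, hc, p, q, hne, hpq⟩
  refine Set.ncard_lt_ncard ⟨himg, fun h => ?_⟩ hfin
  obtain ⟨c', hc', rfl⟩ := h hc
  exact hne (hc'.zero (fm p) (fm q) hpq)

end Labels

/-! ### Counting the translates of a midpoint -/

/-- The parity of the number of translates of `m` in the segment `[p, q]`. -/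
noncomputable def cross (T : GTree.{u, v}) (m p q : T.X) : ZMod 2 :=
  (({z | T.SameOrbit m z} ∩ seg p q).ncard : ZMod 2)

theorem cross_smul {T : GTree.{u, v}} (m p q : T.X) (g : T.G) :
    cross T m (g • p) (g • q) = cross T m p q := by
  have : {z | T.SameOrbit m z} ∩ seg (g • p) (g • q) =
      (fun z => g • z) '' ({z | T.SameOrbit m z} ∩ seg p q) := by
    ext z
    constructor
    · rintro ⟨⟨k, rfl⟩, h2⟩
      exact ⟨g⁻¹ • k • m, ⟨⟨g⁻¹ * k, mul_smul _ _ _⟩, T.smul_mem_seg'.1 h2⟩, smul_inv_smul _ _⟩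
    · rintro ⟨_, ⟨⟨k, rfl⟩, h2⟩, rfl⟩
      exact ⟨⟨g * k, mul_smul _ _ _⟩, T.smul_mem_seg.2 h2⟩
  rw [cross, this, Set.ncard_image_of_injective _ (MulAction.injective g), cross]

theorem cross_eq_zero {T : GTree.{u, v}} {m p q : T.X}
    (h : ∀ g : T.G, g • m ∉ seg p q) : cross T m p q = 0 := by
  have : {z | T.SameOrbit m z} ∩ seg p q = ∅ := by
    ext z
    simp only [Set.mem_inter_iff, Set.mem_ofPred_eq, Set.mem_empty_iff_false, iff_false, not_and]
    rintro ⟨g, rfl⟩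
    exact h g
  rw [cross, this]
  simp

theorem cross_eq_one {T : GTree.{u, v}} {m p q : T.X} (hm : m ∈ seg p q)
    (h : ∀ g : T.G, g • m ∈ seg p q → g • m = m) : cross T m p q = 1 := by
  have : {z | T.SameOrbit m z} ∩ seg p q = {m} := by
    ext z
    simp only [Set.mem_inter_iff, Set.mem_ofPred_eq, Set.mem_singleton_iff]
    constructor
    · rintro ⟨⟨g, rfl⟩, h'⟩
      exact h g h'
    · rintro rfl
      exact ⟨⟨1, one_smul _ _⟩, hm⟩
  rw [cross, this]
  simp

theorem cross_add {T : SimplicialTree.{u, v}} {a b m : T.X} (he : T.IsEdge a b)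
    (hm : m ∈ seg a b) (hd : dist a m = dist a b / 2) {p q r : T.X}
    (hp : ¬ T.SameOrbit m p) (hq : ¬ T.SameOrbit m q) (hr : ¬ T.SameOrbit m r) :
    cross T.toGTree m p q + cross T.toGTree m q r = cross T.toGTree m p r := by
  have hfin := SimplicialTree.finite_orbit_inter_seg he hm hd
  have hpos := dist_pos.2 he.1
  have ha : m ≠ a := by
    rintro rfl
    rw [dist_self] at hd
    linarith
  have hb : m ≠ b := by
    rintro rfl
    linarith
  unfold cross
  set A := {z | T.SameOrbit m z} ∩ seg p q with hA
  set B := {z | T.SameOrbit m z} ∩ seg q r with hB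
  have hC : {z | T.SameOrbit m z} ∩ seg p r = (A \ B) ∪ (B \ A) := by
    ext z
    by_cases hz : T.SameOrbit m z
    · have hv : z ∉ T.verts := by
        obtain ⟨g, rfl⟩ := hz
        exact fun h => he.notMem_verts hm ha hb (SimplicialTree.smul_mem_verts_iff.1 h)
      have hne : ∀ w : T.X, ¬ T.SameOrbit m w → w ≠ z := fun w hw e => hw (e ▸ hz)
      have := (SimplicialTree.isOrdinary_of_notMem hv).mem_seg_iff (hne p hp) (hne q hq) (hne r hr)
      simp only [hA, hB, Set.mem_inter_iff, Set.mem_ofPred_eq, hz, true_and, Set.mem_union,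
        Set.mem_sdiff]
      tauto
    · simp [hA, hB, hz]
  have fA : A.Finite := hfin p q
  have fB : B.Finite := hfin q r
  rw [hC, Set.ncard_union_eq (Set.disjoint_left.2 fun x h1 h2 => h2.2 h1.1)
    (fA.subset Set.sdiff_subset) (fB.subset Set.sdiff_subset)]
  have e1 := Set.ncard_inter_add_ncard_sdiff_eq_ncard A B fA
  have e2 := Set.ncard_inter_add_ncard_sdiff_eq_ncard B A fB
  rw [Set.inter_comm] at e2
  rw [← e1, ← e2]
  push_cast
  have h2 : ((A ∩ B).ncard : ZMod 2) + ((A ∩ B).ncard : ZMod 2) = 0 := CharTwo.add_self_eq_zero _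
  linear_combination h2

theorem isCocycle_cross {G : Type*} [Group G] {T : SimplicialTree.{u, v}} {ψ : T.G →* G}
    {𝒟 : Set (Subgroup G)} (h𝒟 : IsFamily 𝒟) {a b m : T.X} (he : T.IsEdge a b)
    (hm : m ∈ seg a b) (hd : dist a m = dist a b / 2) (ht : m ∉ thick T.toGTree ψ 𝒟) :
    IsCocycle T.toGTree ψ 𝒟 fun p q => cross T.toGTree m p q := by
  have hno : ∀ p ∈ thick T.toGTree ψ 𝒟, ¬ T.SameOrbit m p := by
    rintro _ hp ⟨g, rfl⟩
    exact ht ((smul_mem_thick_iff h𝒟).1 hp)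
  refine ⟨fun p q r => cross_add he hm hd (hno p p.2) (hno q q.2) (hno r r.2), ?_, ?_⟩
  · intro g p q p' q' hp hq
    rw [hp, hq, cross_smul]
  · intro p q hpq
    exact cross_eq_zero fun g hg => hno _ (hpq hg) ⟨g, rfl⟩

/-! ### Characters that vanish on point stabilizers -/

/-- The characters modulo `2` that vanish on all point stabilizers. -/
def ellipticChars (T : GTree.{u, v}) : Set (T.G →* Multiplicative (ZMod 2)) :=
  {χ | ∀ (p : T.X) (g : T.G), g • p = p → χ g = 1}

theorem finite_ellipticChars {T : GTree.{u, v}} (hfg : Group.FG T.G) :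
    (ellipticChars T).Finite := by
  obtain ⟨S, hS, hSfin⟩ := Group.fg_iff.1 hfg
  have : Finite S := hSfin
  have : Finite (Multiplicative (ZMod 2)) := inferInstanceAs (Finite (ZMod 2))
  refine Set.Finite.of_finite_image
    (f := fun (χ : T.G →* Multiplicative (ZMod 2)) (s : S) => χ s) (Set.toFinite _) ?_
  intro χ _ χ' _ h
  refine MonoidHom.eq_of_eqOn_dense hS fun s hs => ?_
  exact congrFun h ⟨s, hs⟩

theorem ncard_ellipticChars_le {T T' : GTree.{u, v}} (f : Morphism T T')
    (hsurj : Function.Surjective f.hom) (hfin : (ellipticChars T).Finite) :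
    (ellipticChars T').ncard ≤ (ellipticChars T).ncard ∧
    ((∃ χ ∈ ellipticChars T, ∃ (g : T.G) (p : T'.X), χ g ≠ 1 ∧ f.hom g • p = p) →
      (ellipticChars T').ncard < (ellipticChars T).ncard) := by
  let pull : (T'.G →* Multiplicative (ZMod 2)) → (T.G →* Multiplicative (ZMod 2)) :=
    fun χ => χ.comp f.hom
  have hinj : Function.Injective pull := fun χ χ' h => MonoidHom.ext fun g' => by
    obtain ⟨g, rfl⟩ := hsurj g'
    exact DFunLike.congr_fun h g
  have himg : pull '' ellipticChars T' ⊆ ellipticChars T := by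
    rintro _ ⟨χ, hχ, rfl⟩ p g hg
    exact hχ (f.map p) (f.hom g) (by rw [← f.map_smul, hg])
  rw [← Set.ncard_image_of_injective _ hinj]
  refine ⟨Set.ncard_le_ncard himg hfin, ?_⟩
  rintro ⟨χ, hχ, g, p, hne, hgp⟩
  refine Set.ncard_lt_ncard ⟨himg, fun h => ?_⟩ hfin
  obtain ⟨χ', hχ', rfl⟩ := h hχ
  exact hne (hχ' p (f.hom g) hgp)

theorem exists_ellipticChar {T : SimplicialTree.{u, v}} {a b m : T.X} (he : T.IsEdge a b)
    (hm : m ∈ seg a b) (hd : dist a m = dist a b / 2) :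
    ∃ χ ∈ ellipticChars T.toGTree, ∀ (g : T.G) (p : T.X), ¬ T.SameOrbit m p →
      χ g = Multiplicative.ofAdd (cross T.toGTree m p (g • p)) := by
  have hpos := dist_pos.2 he.1
  have ha : m ≠ a := by
    rintro rfl
    rw [dist_self] at hd
    linarith
  have hb : m ≠ b := by
    rintro rfl
    linarith
  have hv : ∀ p ∈ T.verts, ¬ T.SameOrbit m p := by
    rintro _ hp ⟨g, rfl⟩
    exact he.notMem_verts hm ha hb (SimplicialTree.smul_mem_verts_iff.1 hp)
  have hsm : ∀ (g : T.G) (p : T.X), ¬ T.SameOrbit m p → ¬ T.SameOrbit m (g • p) := by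
    rintro g p hp ⟨k, hk⟩
    exact hp ⟨g⁻¹ * k, by rw [mul_smul, hk, inv_smul_smul]⟩
  have hself : ∀ p, ¬ T.SameOrbit m p → cross T.toGTree m p p = 0 := fun p hp =>
    cross_eq_zero fun g hg => hp ⟨g, mem_seg_self.1 hg⟩
  have hindep : ∀ (g : T.G) (p q : T.X), ¬ T.SameOrbit m p → ¬ T.SameOrbit m q →
      cross T.toGTree m p (g • p) = cross T.toGTree m q (g • q) := by
    intro g p q hp hq
    have h1 := cross_add he hm hd hp hq (hsm g q hq)
    have h2 := cross_add he hm hd hp (hsm g p hp) (hsm g q hq)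
    rw [cross_smul] at h2
    linear_combination h2 - h1
  have hav := hv a he.left_mem
  let χ : T.G →* Multiplicative (ZMod 2) :=
    { toFun := fun g => Multiplicative.ofAdd (cross T.toGTree m a (g • a))
      map_one' := by rw [one_smul, hself a hav]; rfl
      map_mul' := fun g k => by
        rw [← ofAdd_add, mul_smul, ← cross_add he hm hd hav (hsm g a hav)
          (hsm g _ (hsm k a hav)), cross_smul] }
  have hχ : ∀ (g : T.G) (p : T.X), ¬ T.SameOrbit m p →
      χ g = Multiplicative.ofAdd (cross T.toGTree m p (g • p)) := fun g p hp =>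
    congrArg Multiplicative.ofAdd (hindep g a p hav hp)
  refine ⟨χ, fun p g hg => ?_, hχ⟩
  have main : ∀ q, ¬ T.SameOrbit m q → g • q = q → χ g = 1 := by
    intro q hq hgq
    rw [hχ g q hq, hgq, hself q hq]
    rfl
  by_cases hp : T.SameOrbit m p
  · -- an element that fixes a translate of the midpoint fixes the ends of the edge
    obtain ⟨k, rfl⟩ := hp
    refine main (k • a) (hsm k a hav) ?_
    have h1 : (k⁻¹ * g * k) • m = m := by rw [mul_smul, mul_smul, hg, inv_smul_smul]
    have h2 := (he.smul_eq hm ha hb h1).1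
    rw [mul_smul, mul_smul, inv_smul_eq_iff] at h2
    exact h2
  · exact main p hp hg

/-! ### Folds: identified points and stabilizers -/

theorem SimplicialTree.exists_near {T : SimplicialTree.{u, v}} {a q : T.X} (ha : a ∈ T.verts)
    (hne : a ≠ q) : ∃ c z, T.IsEdge a c ∧ z ∈ seg a q ∧ z ∈ seg a c ∧ z ≠ a ∧ z ≠ c := by
  refine SimplicialTree.seg_induction (T := T) (R := fun a q => a ∈ T.verts → a ≠ q →
    ∃ c z, T.IsEdge a c ∧ z ∈ seg a q ∧ z ∈ seg a c ∧ z ≠ a ∧ z ≠ c)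
    (fun p _ h => absurd rfl h) ?_ ?_ a q ha hne
  · have main : ∀ a b q : T.X, T.IsEdge a b → q ∈ seg a b → a ≠ q →
        ∃ c z, T.IsEdge a c ∧ z ∈ seg a q ∧ z ∈ seg a c ∧ z ≠ a ∧ z ≠ c := by
      intro a b q he hq hne
      obtain ⟨z, hz, h1, h2, -⟩ := T.isRTree.exists_mid hne
      refine ⟨b, z, he, hz, mem_seg_trans hq hz, h1, ?_⟩
      rintro rfl
      exact h2 (eq_of_mem_seg_of_mem_seg hz hq)
    intro a b p q he hp hq hpv hne
    rcases he.eq_or_eq hp hpv with rfl | rfl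
    · exact main _ _ _ he hq hne
    · exact main _ _ _ he.symm (mem_seg_comm.1 hq) hne
  · intro p q u hu hm hup _ h1 _ hp _
    obtain ⟨c, z, h2, h3, h4⟩ := h1 hp hup.symm
    exact ⟨c, z, h2, mem_seg_trans hm h3, h4⟩

/-- `T` is obtained from `S` by folding the edges `[v, x]` and `[v, y]`, where `x` and `y` are not
in the orbit of `v`. -/
structure FoldAt (S T : SimplicialTree.{u, v}) (α : Morphism S.toGTree T.toGTree)
    (v x y : S.X) : Prop where
  bij : Function.Bijective α.hom
  surj : Function.Surjective α.map
  simplicial : IsSimplicialMap S T α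
  left : S.IsEdge v x
  right : S.IsEdge v y
  ne : x ≠ y
  dist_eq : dist v x = dist v y
  orbit_left : ¬ S.SameOrbit v x
  orbit_right : ¬ S.SameOrbit v y
  rel : ∀ p q, α.map p = α.map q ↔ Relation.EqvGen (FoldRel S.toGTree v x y) p q

/-- The fold of `[v, x]` and `[v, y]` is not of type III: if `x` and `y` are in the same orbit, then
so are the two edges. -/
def Untwisted (S : GTree.{u, v}) (v x y : S.X) : Prop :=
  ¬ S.SameOrbit x y ∨ ∃ g : S.G, g • v = v ∧ g • x = y

/-- The subgroup `P` contains the generators of the stabilizer of the common image of `x` and `y`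
under a fold. -/
structure FoldBound (S : GTree.{u, v}) (x y : S.X) (P : Subgroup S.G) : Prop where
  left : ∀ g : S.G, g • x = x → g ∈ P
  right : ∀ g : S.G, g • y = y → g ∈ P
  mid : ∀ g : S.G, g • x = y → g ∈ P

/-- A fold is non-degenerate if the stabilizer of the common image of `x` and `y` is not the image
of a subgroup of the stabilizer of `v`, `x` or `y`. -/
def Nondegenerate (S : GTree.{u, v}) (v x y : S.X) : Prop :=
  ∀ w, w = v ∨ w = x ∨ w = y → ¬ FoldBound S x y (MulAction.stabilizer S.G w)

theorem FoldBound.symm {S : GTree.{u, v}} {x y : S.X} {P : Subgroup S.G} (h : FoldBound S x y P) :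
    FoldBound S y x P :=
  ⟨h.right, h.left, fun g hg => by
    have := h.mid g⁻¹ (by rw [← hg, inv_smul_smul])
    exact (Subgroup.inv_mem_iff P).1 this⟩

theorem Nondegenerate.symm {S : GTree.{u, v}} {v x y : S.X} (h : Nondegenerate S v x y) :
    Nondegenerate S v y x := fun w hw hb => h w (by tauto) hb.symm

theorem Untwisted.symm {S : GTree.{u, v}} {v x y : S.X} (h : Untwisted S v x y) :
    Untwisted S v y x := by
  rcases h with h | ⟨g, h1, h2⟩
  · exact Or.inl fun h' => h h'.symm
  · exact Or.inr ⟨g⁻¹, by rw [inv_smul_eq_iff, h1], by rw [inv_smul_eq_iff, h2]⟩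

theorem foldRel_swap {S : GTree.{u, v}} {v x y p q : S.X} (h : FoldRel S v x y p q) :
    FoldRel S v y x q p := by
  obtain ⟨g, p', hp, q', hq, hd, e1, e2⟩ := h
  exact ⟨g, q', hq, p', hp, hd.symm, e2, e1⟩

theorem eqvGen_foldRel_swap {S : GTree.{u, v}} {v x y p q : S.X}
    (h : Relation.EqvGen (FoldRel S v x y) p q) : Relation.EqvGen (FoldRel S v y x) p q := by
  induction h with
  | rel _ _ h => exact (Relation.EqvGen.rel _ _ (foldRel_swap h)).symm
  | refl _ => exact Relation.EqvGen.refl _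
  | symm _ _ _ h => exact h.symm
  | trans _ _ _ _ _ h1 h2 => exact h1.trans _ _ _ h2

/-- A relation that is stable under a set `C` in both directions does not leave `C`. -/
theorem mem_iff_of_eqvGen {X : Type*} {r : X → X → Prop} {C : Set X}
    (hC : ∀ p q, r p q → (p ∈ C ↔ q ∈ C)) {p q : X} (h : Relation.EqvGen r p q) :
    p ∈ C ↔ q ∈ C := by
  induction h with
  | rel _ _ h => exact hC _ _ h
  | refl _ => exact Iff.rfl
  | symm _ _ _ h => exact h.symm
  | trans _ _ _ _ _ h1 h2 => exact h1.trans h2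

theorem IsFold.exists_foldAt {S T : SimplicialTree.{u, v}} {α : Morphism S.toGTree T.toGTree}
    (h : IsFold S T α) : ∃ v x y, FoldAt S T α v x y := by
  obtain ⟨h1, h2, h3, v, x, y, e1, e2, hne, hd, ht, hr⟩ := h
  have ho : ¬ S.SameOrbit v x ∧ ¬ S.SameOrbit v y := by
    rcases ht with ht | ht | ht
    · exact ⟨ht.1, ht.2.1⟩
    · refine ⟨ht.1, ?_⟩
      rintro ⟨k, hk⟩
      obtain ⟨g, h1, h2⟩ := ht.2
      exact ht.1 ⟨g⁻¹ * k, by rw [mul_smul, hk, ← h2, inv_smul_smul]⟩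
    · refine ⟨ht.1, ?_⟩
      rintro ⟨k, hk⟩
      obtain ⟨g, h2⟩ := ht.2.1
      exact ht.1 ⟨g⁻¹ * k, by rw [mul_smul, hk, ← h2, inv_smul_smul]⟩
  exact ⟨v, x, y, h1, h2, h3, e1, e2, hne, hd, ho.1, ho.2, hr⟩

/-- An element that carries a point of `[v, a]` into `[v, b]` preserves the distance from `v`, and
carries one edge to the other if that point is not a vertex. -/
theorem level {S : SimplicialTree.{u, v}} {v a b r r' : S.X} (ha : S.IsEdge v a)
    (hb : S.IsEdge v b) (hob : ¬ S.SameOrbit v b) (hd : dist v a = dist v b)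
    (hr : r ∈ seg v a) (hr' : r' ∈ seg v b) (hv : r' ≠ v) {k : S.G} (hk : k • r = r') :
    dist v r = dist v r' ∧ (r' ≠ b → k • v = v ∧ k • a = b) := by
  by_cases hrb : r' = b
  · subst hrb
    refine ⟨?_, fun h => absurd rfl h⟩
    have hrv : r ∈ S.verts := SimplicialTree.smul_mem_verts_iff.1 (hk ▸ hb.right_mem)
    rcases ha.eq_or_eq hr hrv with rfl | rfl
    · exact absurd ⟨k, hk⟩ hob
    · exact hd
  · have hm : r' ∈ seg (k • v) (k • a) := by
      rw [← hk]
      exact S.toGTree.smul_mem_seg.2 hr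
    rcases hb.ends_eq (ha.smul k) hr' hv hrb hm with ⟨h1, h2⟩ | ⟨h1, -⟩
    · refine ⟨?_, fun _ => ⟨h1, h2⟩⟩
      rw [← S.isometric k v r, h1, hk]
    · exact absurd ⟨k, h1⟩ hob

namespace FoldAt

variable {S T : SimplicialTree.{u, v}} {α : Morphism S.toGTree T.toGTree} {v x y : S.X}

theorem symm (h : FoldAt S T α v x y) : FoldAt S T α v y x :=
  ⟨h.bij, h.surj, h.simplicial, h.right, h.left, h.ne.symm, h.dist_eq.symm, h.orbit_right,
    h.orbit_left, fun p q => (h.rel p q).trans ⟨eqvGen_foldRel_swap, eqvGen_foldRel_swap⟩⟩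

theorem eq_of_mem (h : FoldAt S T α v x y) {z : S.X} (h1 : z ∈ seg v x) (h2 : z ∈ seg v y) :
    z = v := by
  by_contra hz
  have hx : z ≠ x := by
    rintro rfl
    rcases h.right.eq_or_eq h2 h.left.right_mem with e | e
    · exact hz e
    · exact h.ne e
  rcases h.left.ends_eq h.right h1 hz hx h2 with ⟨-, e⟩ | ⟨e, -⟩
  · exact h.ne e.symm
  · exact h.left.1 e

theorem mem_seg (h : FoldAt S T α v x y) : v ∈ seg x y :=
  S.isRTree.mem_seg_of_inter fun _ h1 h2 => h.eq_of_mem h1 h2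

/-- The points that a fold identifies with a point `p` of `[v, x]` or the corresponding point `q`
of `[v, y]`. -/
theorem exists_of_map_eq (h : FoldAt S T α v x y) {p q : S.X} (hp : p ∈ seg v x)
    (hq : q ∈ seg v y) (hd : dist v p = dist v q) (hpv : p ≠ v) {P : Subgroup S.G}
    (hP : FoldBound S.toGTree p q P) {z : S.X} (hz : α.map z = α.map p) :
    ∃ g ∈ P, z = g • p ∨ z = g • q := by
  have hqv : q ≠ v := by
    rintro rfl
    rw [dist_self] at hd
    exact hpv (dist_eq_zero.1 hd).symm
  have hxy := h.dist_eq
  have hle : ∀ g : S.G, g • q = p → g ∈ P := hP.symm.mid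
  let C : Set S.X := {z | ∃ g ∈ P, z = g • p ∨ z = g • q}
  have hC : ∀ z w, FoldRel S.toGTree v x y z w → (z ∈ C ↔ w ∈ C) := by
    rintro _ _ ⟨g, p', hp', q', hq', hd', rfl, rfl⟩
    have fin : ∀ k ∈ P, g = k → dist v p' = dist v p → g • p' ∈ C ∧ g • q' ∈ C := by
      rintro k hk rfl e
      have e1 : p' = p := S.isRTree.eq_of_dist_eq hp' hp e
      have e2 : q' = q := S.isRTree.eq_of_dist_eq hq' hq (by rw [← hd', e, hd])
      exact ⟨⟨g, hk, Or.inl (by rw [e1])⟩, ⟨g, hk, Or.inr (by rw [e2])⟩⟩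
    have e1 : ∀ (k : S.G) (s t : S.X), g • s = k • t → (k⁻¹ * g) • s = t := fun k s t e => by
      rw [mul_smul, e, inv_smul_smul]
    constructor
    · rintro ⟨k, hk, e | e⟩
      · have l := (level h.left h.left h.orbit_left rfl hp' hp hpv (e1 _ _ _ e)).1
        have ep : p' = p := S.isRTree.eq_of_dist_eq hp' hp l
        have := hP.left _ (ep ▸ e1 _ _ _ e)
        exact (fin (k * (k⁻¹ * g)) (P.mul_mem hk this) (by group) l).2
      · have l := (level h.left h.right h.orbit_right hxy hp' hq hqv (e1 _ _ _ e)).1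
        have ep : p' = p := S.isRTree.eq_of_dist_eq hp' hp (by rw [l, hd])
        have := hP.mid _ (ep ▸ e1 _ _ _ e)
        exact (fin (k * (k⁻¹ * g)) (P.mul_mem hk this) (by group) (by rw [l, hd])).2
    · rintro ⟨k, hk, e | e⟩
      · have l := (level h.right h.left h.orbit_left hxy.symm hq' hp hpv (e1 _ _ _ e)).1
        have eq' : q' = q := S.isRTree.eq_of_dist_eq hq' hq (by rw [l, hd])
        have := hle _ (eq' ▸ e1 _ _ _ e)
        exact (fin (k * (k⁻¹ * g)) (P.mul_mem hk this) (by group) (by rw [hd', l])).1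
      · have l := (level h.right h.right h.orbit_right rfl hq' hq hqv (e1 _ _ _ e)).1
        have eq' : q' = q := S.isRTree.eq_of_dist_eq hq' hq l
        have := hP.right _ (eq' ▸ e1 _ _ _ e)
        exact (fin (k * (k⁻¹ * g)) (P.mul_mem hk this) (by group) (by rw [hd', l, hd])).1
  have hpC : p ∈ C := ⟨1, P.one_mem, Or.inl (one_smul _ _).symm⟩
  exact (mem_iff_of_eqvGen hC ((h.rel z p).1 hz)).2 hpC

theorem mem_of_map_smul_eq (h : FoldAt S T α v x y) {p q : S.X} (hp : p ∈ seg v x)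
    (hq : q ∈ seg v y) (hd : dist v p = dist v q) (hpv : p ≠ v) {P : Subgroup S.G}
    (hP : FoldBound S.toGTree p q P) {g : S.G} (hg : α.map (g • p) = α.map p) : g ∈ P := by
  obtain ⟨k, hk, e | e⟩ := h.exists_of_map_eq hp hq hd hpv hP hg
  · have := hP.left (k⁻¹ * g) (by rw [mul_smul, e, inv_smul_smul])
    have := P.mul_mem hk this
    rwa [mul_inv_cancel_left] at this
  · have := hP.mid (k⁻¹ * g) (by rw [mul_smul, e, inv_smul_smul])
    have := P.mul_mem hk this
    rwa [mul_inv_cancel_left] at this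

theorem exists_partner (h : FoldAt S T α v x y) {p : S.X} (hp : p ∈ seg v x) :
    ∃ q ∈ seg v y, dist v p = dist v q ∧ α.map p = α.map q := by
  obtain ⟨q, hq, hd⟩ := S.isRTree.exists_mem_seg (x := v) (y := y) (t := dist v p) dist_nonneg
    (by rw [← h.dist_eq]; exact dist_le_of_mem_seg hp)
  refine ⟨q, hq, hd.symm, (h.rel p q).2 (Relation.EqvGen.rel _ _ ?_)⟩
  exact ⟨1, p, hp, q, hq, hd.symm, (one_smul _ _).symm, (one_smul _ _).symm⟩

theorem map_eq (h : FoldAt S T α v x y) : α.map x = α.map y := by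
  obtain ⟨q, hq, hd, e⟩ := h.exists_partner (right_mem_seg v x)
  rw [e, S.isRTree.eq_of_dist_eq hq (right_mem_seg v y) (by rw [← hd, h.dist_eq])]

/-- The stabilizer of the image of a point inside a folded edge comes from the stabilizer
of `v`. -/
theorem smul_eq_of_map_smul_eq (h : FoldAt S T α v x y) {p : S.X} (hp : p ∈ seg v x)
    (hpv : p ≠ v) (hpx : p ≠ x) {g : S.G} (hg : α.map (g • p) = α.map p) : g • v = v := by
  obtain ⟨q, hq, hd, -⟩ := h.exists_partner hp
  have hqv : q ≠ v := by
    rintro rfl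
    rw [dist_self] at hd
    exact hpv (dist_eq_zero.1 hd).symm
  have hqy : q ≠ y := by
    rintro rfl
    exact hpx (S.isRTree.eq_of_dist_eq hp (right_mem_seg v x) (by rw [hd, h.dist_eq]))
  refine h.mem_of_map_smul_eq hp hq hd hpv (P := MulAction.stabilizer S.G v) ⟨?_, ?_, ?_⟩ hg
  · exact fun k hk => (h.left.smul_eq hp hpv hpx hk).1
  · exact fun k hk => (h.right.smul_eq hq hqv hqy hk).1
  · exact fun k hk => ((level h.left h.right h.orbit_right h.dist_eq hp hq hqv hk).2 hqy).1

theorem mem_of_map_smul_eq_end (h : FoldAt S T α v x y) {P : Subgroup S.G}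
    (hP : FoldBound S.toGTree x y P) {g : S.G} (hg : α.map (g • x) = α.map x) : g ∈ P :=
  h.mem_of_map_smul_eq (right_mem_seg v x) (right_mem_seg v y) h.dist_eq h.left.1.symm hP hg

/-- A point is identified with no other point, unless it lies in a translate of one of the two
folded edges. -/
theorem classify (h : FoldAt S T α v x y) (p : S.X) : (∀ w, α.map w = α.map p → w = p) ∨
    ∃ (g : S.G) (r : S.X), p = g • r ∧ (r ∈ seg v x ∨ r ∈ seg v y) ∧ r ≠ v := by
  by_cases hp : ∃ (g : S.G) (r : S.X), p = g • r ∧ (r ∈ seg v x ∨ r ∈ seg v y) ∧ r ≠ v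
  · exact Or.inr hp
  left
  intro w hw
  have hC : ∀ z w, FoldRel S.toGTree v x y z w → (z ∈ ({p} : Set S.X) ↔ w ∈ ({p} : Set S.X)) := by
    rintro _ _ ⟨g, p', hp', q', hq', hd', rfl, rfl⟩
    constructor
    · rintro rfl
      have : p' = v := by
        by_contra hv
        exact hp ⟨g, p', rfl, Or.inl hp', hv⟩
      rw [this, dist_self] at hd'
      rw [this, ← dist_eq_zero.1 hd'.symm]
      rfl
    · rintro rfl
      have : q' = v := by
        by_contra hv
        exact hp ⟨g, q', rfl, Or.inr hq', hv⟩
      rw [this, dist_self] at hd'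
      rw [this, ← dist_eq_zero.1 hd']
      rfl
  exact (mem_iff_of_eqvGen hC ((h.rel w p).1 hw)).2 rfl

/-- If a fold is degenerate, then every element that fixes a point of the folded tree already
fixes a point before the fold. -/
theorem exists_fixed_of_not_nondegenerate (h : FoldAt S T α v x y)
    (hn : ¬ Nondegenerate S.toGTree v x y) {p : S.X} {g : S.G} (hg : α.map (g • p) = α.map p) :
    ∃ w : S.X, g • w = w := by
  have base : ∀ {x y : S.X}, FoldAt S T α v x y → ¬ Nondegenerate S.toGTree v x y →
      ∀ (r : S.X) (g : S.G), r ∈ seg v x → r ≠ v → α.map (g • r) = α.map r → ∃ w : S.X, g • w = w := by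
    intro x y h hn r g hr hrv hg
    by_cases hrx : r = x
    · subst hrx
      simp only [Nondegenerate, not_forall, not_not] at hn
      obtain ⟨w, -, hw⟩ := hn
      exact ⟨w, h.mem_of_map_smul_eq_end hw hg⟩
    · exact ⟨v, h.smul_eq_of_map_smul_eq hr hrv hrx hg⟩
  rcases h.classify p with h1 | ⟨k, r, rfl, hr, hrv⟩
  · exact ⟨p, h1 _ hg⟩
  · have hg' : α.map ((k⁻¹ * g * k) • r) = α.map r := by
      rw [mul_smul, mul_smul, α.map_smul, hg, ← α.map_smul, inv_smul_smul]
    have : ∃ w : S.X, (k⁻¹ * g * k) • w = w := by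
      rcases hr with hr | hr
      · exact base h hn r _ hr hrv hg'
      · exact base h.symm (fun h' => hn h'.symm) r _ hr hrv hg'
    obtain ⟨w, hw⟩ := this
    refine ⟨k • w, ?_⟩
    rw [mul_smul, mul_smul, inv_smul_eq_iff] at hw
    exact hw

/-- In a non-degenerate fold of type I or II, one of the two edges has an end whose stabilizer is
larger than that of the edge. -/
theorem not_le_or_not_le (hu : Untwisted S.toGTree v x y) (hn : Nondegenerate S.toGTree v x y) :
    (¬ ∀ g : S.G, g • x = x → g • v = v) ∨ ¬ ∀ g : S.G, g • y = y → g • v = v := by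
  by_contra hcon
  push Not at hcon
  refine hn v (Or.inl rfl) ⟨hcon.1, hcon.2, fun g hg => ?_⟩
  rcases hu with hu | ⟨k, h1, h2⟩
  · exact absurd ⟨g, hg⟩ hu
  · have : (k⁻¹ * g) • v = v := hcon.1 _ (by rw [mul_smul, hg, ← h2, inv_smul_smul])
    rw [mul_smul, inv_smul_eq_iff, h1] at this
    exact this

/-- In a non-degenerate fold of type I or II in which only `x` has a stabilizer larger than that of
the edge, the stabilizer of `v` does not fix `x`. -/
theorem exists_smul_ne (h : FoldAt S T α v x y) (hu : Untwisted S.toGTree v x y)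
    (hn : Nondegenerate S.toGTree v x y) (hy : ∀ g : S.G, g • y = y → g • v = v) :
    ∃ g : S.G, g • v = v ∧ g • x ≠ x ∧ (g • x = y ∨ g • y = y) := by
  rcases hu with hu | ⟨k, h1, h2⟩
  · by_contra hcon
    push Not at hcon
    refine hn x (Or.inr (Or.inl rfl)) ⟨fun g hg => hg, fun g hg => ?_, fun g hg => ?_⟩
    · by_contra hx
      exact (hcon g (hy g hg) hx).2 hg
    · exact absurd ⟨g, hg⟩ hu
  · exact ⟨k, h1, by rw [h2]; exact h.ne.symm, Or.inl h2⟩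

theorem surj_hom (h : FoldAt S T α v x y) (k : T.G) : ∃ g, α.hom g = k := h.bij.2 k

/-- A point that is not a vertex and that is identified with no other point of a segment stays in
the image of the segment. -/
theorem map_mem_seg (h : FoldAt S T α v x y) {p p' z : S.X} (hz : z ∈ seg p p')
    (hv : z ∉ S.verts) (huniq : ∀ w ∈ seg p p', α.map w = α.map z → w = z) :
    α.map z ∈ seg (α.map p) (α.map p') := by
  by_cases hp : z = p
  · exact hp ▸ left_mem_seg _ _
  by_cases hp' : z = p'
  · exact hp' ▸ right_mem_seg _ _
  obtain ⟨a, b, he, hm, ha, hb⟩ := SimplicialTree.exists_isEdge hv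
  have near : ∀ q : S.X, z ≠ q → ∃ c ∈ seg a b, c ∈ seg z q ∧ c ≠ z := by
    intro q hq
    rcases he.exit hm ha hb q with h1 | h1 | h1
    · exact ⟨q, h1, right_mem_seg _ _, hq.symm⟩
    · exact ⟨a, left_mem_seg _ _, h1, ha.symm⟩
    · exact ⟨b, right_mem_seg _ _, h1, hb.symm⟩
  obtain ⟨c, hc, hcz, hcne⟩ := near p hp
  obtain ⟨c', hc', hcz', hcne'⟩ := near p' hp'
  have hsub : seg c c' ⊆ seg a b :=
    S.isRTree.seg_subset_of_isPreconnected (S.isRTree.isPreconnected_seg a b) hc hc'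
  have hzc : z ∈ seg c c' := by
    have h1 : z ∈ seg c p' := mem_seg_trans_right hz (mem_seg_comm.1 hcz)
    exact mem_seg_comm.1 (mem_seg_trans_right (mem_seg_comm.1 h1) (mem_seg_comm.1 hcz'))
  have hiso := (h.simplicial.2 a b he).2
  have hzim : α.map z ∈ seg (α.map c) (α.map c') :=
    image_mem_seg (fun p hp q hq => hiso p (hsub hp) q (hsub hq)) hzc
  have avoid : ∀ q c : S.X, seg z q ⊆ seg p p' → c ∈ seg z q → c ≠ z →
      α.map z ∉ seg (α.map c) (α.map q) := by
    intro q c hq hc hne hmem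
    obtain ⟨w, hw, e⟩ := α.seg_subset_image c q hmem
    have hw' : w ∈ seg z q := seg_subset_right hc hw
    have : w = z := huniq w (hq hw') e
    rw [this] at hw
    exact hne (eq_of_mem_seg_of_mem_seg (mem_seg_comm.1 hc) (mem_seg_comm.1 hw))
  have a1 := avoid p c (by rw [seg_comm]; exact seg_subset_left hz) hcz hcne
  have a2 := avoid p' c' (seg_subset_right hz) hcz' hcne'
  rcases T.isRTree.seg_subset_union _ _ (α.map p) hzim with h1 | h1
  · exact absurd h1 a1
  · rcases T.isRTree.seg_subset_union _ _ (α.map p') h1 with h2 | h2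
    · exact h2
    · exact absurd (mem_seg_comm.1 h2) a2

end FoldAt

/-! ### Folds: the thick part -/

section FoldThick

variable {G : Type*} [Group G]

/-- A core of the thick part: an invariant subset `Y` that meets each component of the thick part
in a convex set, such that the stabilizer of each thick point `q` fixes a point of `Y` (and then it
fixes a path in the thick part from `q` to `Y`). -/
structure Core (T : GTree.{u, v}) (ψ : T.G →* G) (𝒟 : Set (Subgroup G)) (Y : Set T.X) : Prop where
  subset : Y ⊆ thick T ψ 𝒟
  smul : ∀ (g : T.G), ∀ y ∈ Y, g • y ∈ Y
  convex : ∀ y ∈ Y, ∀ y' ∈ Y, seg y y' ⊆ thick T ψ 𝒟 → seg y y' ⊆ Y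
  retract : ∀ q ∈ thick T ψ 𝒟, ∃ y ∈ Y, ∀ g : T.G, g • q = q → g • y = y

theorem core_thick {T : GTree.{u, v}} {ψ : T.G →* G} {𝒟 : Set (Subgroup G)} (h𝒟 : IsFamily 𝒟) :
    Core T ψ 𝒟 (thick T ψ 𝒟) :=
  ⟨subset_rfl, fun _ _ h => (smul_mem_thick_iff h𝒟).2 h, fun _ _ _ _ h => h,
    fun q hq => ⟨q, hq, fun _ h => h⟩⟩

variable {S T : SimplicialTree.{u, v}} {α : Morphism S.toGTree T.toGTree} {v x y : S.X}
  {ψ : S.G →* G} {ψ' : T.G →* G} {𝒟 : Set (Subgroup G)}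

namespace FoldAt

/-- A bound for the label of the image of a point under a fold. -/
theorem label_le (h : FoldAt S T α v x y) (hψ : ∀ g, ψ' (α.hom g) = ψ g) {p w : S.X}
    (hw : ∀ g : S.G, α.map (g • p) = α.map p → g • w = w) :
    label T.toGTree ψ' (α.map p) ≤ label S.toGTree ψ w := by
  rintro _ ⟨k, hk, rfl⟩
  obtain ⟨g, rfl⟩ := h.surj_hom k
  have hk' : α.hom g • α.map p = α.map p := hk
  rw [← α.map_smul] at hk'
  exact ⟨g, hw g hk', (hψ g).symm⟩

theorem mem_thick_of_map_mem (h : FoldAt S T α v x y) (h𝒟 : IsFamily 𝒟)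
    (hψ : ∀ g, ψ' (α.hom g) = ψ g) {p w : S.X} (hp : α.map p ∈ thick T.toGTree ψ' 𝒟)
    (hw : ∀ g : S.G, α.map (g • p) = α.map p → g • w = w) : w ∈ thick S.toGTree ψ 𝒟 :=
  fun h' => hp (h𝒟.down _ _ (h.label_le hψ hw) h')

theorem smul_map_eq (h : FoldAt S T α v x y) {p w : S.X}
    (hw : ∀ g : S.G, α.map (g • p) = α.map p → g • w = w) {k : T.G}
    (hk : k • α.map p = α.map p) : k • α.map w = α.map w := by
  obtain ⟨g, rfl⟩ := h.surj_hom k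
  rw [← α.map_smul] at hk ⊢
  rw [hw g hk]

/-- A point outside the thick part that is not identified with another point on a segment with
thick image lies in a translate of a folded edge; hence if the segment leaves the thick part inside
`[v, x]`, then the stabilizer of `x` moves `v`. -/
theorem not_le_of_seg (h : FoldAt S T α v x y) (hu : Untwisted S.toGTree v x y)
    (h𝒟 : IsFamily 𝒟) (hψ : ∀ g, ψ' (α.hom g) = ψ g) {p p' z : S.X}
    (hp : p ∈ thick S.toGTree ψ 𝒟) (hp' : p' ∈ thick S.toGTree ψ 𝒟)
    (hseg : seg (α.map p) (α.map p') ⊆ thick T.toGTree ψ' 𝒟) (hz : z ∈ seg p p')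
    (hzx : z ∈ seg v x) (hv : z ≠ v) (hx : z ≠ x) (hzt : z ∉ thick S.toGTree ψ 𝒟) :
    ¬ ∀ g : S.G, g • x = x → g • v = v := by
  intro hle
  have hnot : ∀ q : S.X, q ∈ thick S.toGTree ψ 𝒟 → q ∈ seg v x → q = v ∨ q = x := by
    intro q hq hqs
    by_contra hcon
    push Not at hcon
    exact hzt (h.left.seg_subset_thick h𝒟 hqs hcon.1 hcon.2 hq hzx)
  -- orient the segment so that it runs through `v`, then `x`
  wlog ho : v ∈ seg p z ∧ x ∈ seg z p' generalizing p p'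
  · rcases h.left.ends_mem_seg hzx hv hx hz (hnot p hp) (hnot p' hp') with h1 | h1
    · exact ho h1
    · exact this hp' hp (by rwa [seg_comm]) (mem_seg_comm.1 hz)
        ⟨mem_seg_comm.1 h1.2, mem_seg_comm.1 h1.1⟩
  have hxt : x ∉ thick S.toGTree ψ 𝒟 := fun hxt => hzt (mem_thick_of_stabilizer_le h𝒟 hxt
    fun g hg => S.toGTree.smul_eq_of_mem_seg (hle g hg) hg hzx)
  have hxp' : x ≠ p' := fun e => hxt (e ▸ hp')
  have hxseg : x ∈ seg p p' := seg_subset_right hz ho.2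
  have hxv : x ∈ seg v p' := seg_subset_right (mem_seg_trans_right hz ho.1) ho.2
  -- look at the segment just after `x`
  obtain ⟨c, z₂, hc, h1, h2, h3, h4⟩ := SimplicialTree.exists_near h.left.right_mem hxp'
  have hz2 : z₂ ∈ seg p p' := seg_subset_right hxseg h1
  have hz2v : z₂ ∉ S.verts := hc.notMem_verts h2 h3 h4
  have hz2t : z₂ ∉ thick S.toGTree ψ 𝒟 := fun ht => hxt
    (mem_thick_of_stabilizer_le h𝒟 ht fun g hg => (hc.smul_eq h2 h3 h4 hg).1)
  have hcv : c = v → False := by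
    rintro rfl
    exact h3 (eq_of_mem_seg_both hxv (mem_seg_comm.1 h2) h1)
  rcases h.classify z₂ with h5 | ⟨g, r, e, hr, hrv⟩
  · have := hseg (h.map_mem_seg hz2 hz2v fun w _ hw => h5 w hw)
    exact hz2t (h.mem_thick_of_map_mem h𝒟 hψ this fun g hg => h5 _ hg)
  · have hz2r : ∀ a, r ∈ seg v a → S.IsEdge v a → r ≠ a → (x = g • v ∧ c = g • a) ∨
        (x = g • a ∧ c = g • v) := by
      intro a hra he hne
      refine (he.smul g).ends_eq hc (p := z₂) ?_ ?_ ?_ h2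
      · rw [e]
        exact S.toGTree.smul_mem_seg.2 hra
      · rw [e]
        exact fun e' => hrv (MulAction.injective g e')
      · rw [e]
        exact fun e' => hne (MulAction.injective g e')
    have hnv : ∀ a, a ∈ S.verts → r ≠ a := by
      rintro a ha rfl
      exact hz2v (e ▸ S.smul_mem g _ ha)
    rcases hr with hr | hr
    · rcases hz2r x hr h.left (hnv x h.left.right_mem) with ⟨e1, -⟩ | ⟨e1, e2⟩
      · exact h.orbit_left ⟨g, e1.symm⟩
      · exact hcv (e2.trans (hle g e1.symm))
    · rcases hz2r y hr h.right (hnv y h.right.right_mem) with ⟨e1, -⟩ | ⟨e1, e2⟩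
      · exact h.orbit_left ⟨g, e1.symm⟩
      · rcases hu with hu | ⟨k, k1, k2⟩
        · exact hu ⟨g⁻¹, by rw [e1, inv_smul_smul]⟩
        · have : (g * k) • x = x := by rw [mul_smul, k2, e1.symm]
          have := hle _ this
          rw [mul_smul, k1] at this
          exact hcv (e2.trans this)

theorem seg_thick_aux (h : FoldAt S T α v x y) (hu : Untwisted S.toGTree v x y)
    (h𝒟 : IsFamily 𝒟) (hψ : ∀ g, ψ' (α.hom g) = ψ g)
    (hact : Nondegenerate S.toGTree v x y → (¬ ∀ g : S.G, g • x = x → g • v = v) →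
      seg v x ⊆ thick S.toGTree ψ 𝒟) {p p' z : S.X}
    (hp : p ∈ thick S.toGTree ψ 𝒟) (hp' : p' ∈ thick S.toGTree ψ 𝒟)
    (hseg : seg (α.map p) (α.map p') ⊆ thick T.toGTree ψ' 𝒟) (hz : z ∈ seg p p')
    (hzx : z ∈ seg v x) (hv : z ≠ v) (hx : z ≠ x) (hzt : z ∉ thick S.toGTree ψ 𝒟) : False := by
  have hgx := h.not_le_of_seg hu h𝒟 hψ hp hp' hseg hz hzx hv hx hzt
  have hdeg : ¬ Nondegenerate S.toGTree v x y := fun hn => hzt (hact hn hgx hzx)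
  have hfix : ∀ g : S.G, g • x = x → g • y = y → g • v = v := fun g h1 h2 =>
    S.toGTree.smul_eq_of_mem_seg h1 h2 h.mem_seg
  simp only [Nondegenerate, not_forall, not_not] at hdeg
  obtain ⟨w, hw, hb⟩ := hdeg
  rcases hw with rfl | rfl | rfl
  · exact hgx hb.left
  · -- the stabilizer of `y` is contained in that of `x`
    have hyx : ∀ g : S.G, g • y = y → g • w = w := hb.right
    have hno : ∀ g : S.G, g • w ≠ y := fun g hg => h.ne ((hb.mid g hg).symm.trans hg)
    obtain ⟨q, hq, hd, -⟩ := h.exists_partner hzx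
    have hqv : q ≠ v := by
      rintro rfl
      rw [dist_self] at hd
      exact hv (dist_eq_zero.1 hd).symm
    have hqy : q ≠ y := by
      rintro rfl
      exact hx (S.isRTree.eq_of_dist_eq hzx (right_mem_seg v w) (by rw [hd, h.dist_eq]))
    have hqz : ∀ g : S.G, g • q = q → g • z = z := fun g hg => by
      have := h.right.smul_eq hq hqv hqy hg
      exact S.toGTree.smul_eq_of_mem_seg this.1 (hyx g this.2) hzx
    have hP : FoldBound S.toGTree z q (MulAction.stabilizer S.G z) :=
      ⟨fun g hg => hg, hqz, fun g hg =>
        absurd ((level h.left h.right h.orbit_right h.dist_eq hzx hq hqv hg).2 hqy).2 (hno g)⟩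
    have hzv := h.left.notMem_verts hzx hv hx
    by_cases huniq : ∀ w ∈ seg p p', α.map w = α.map z → w = z
    · exact hzt (h.mem_thick_of_map_mem h𝒟 hψ (hseg (h.map_mem_seg hz hzv huniq))
        fun g hg => h.mem_of_map_smul_eq hzx hq hd hv hP hg)
    · push Not at huniq
      obtain ⟨z', hz', e, hne⟩ := huniq
      obtain ⟨g, hg, e' | e'⟩ := h.exists_of_map_eq hzx hq hd hv hP e
      · exact hne (e'.trans hg)
      · -- the segment leaves the thick part inside a translate of `[v, y]` as well
        have hqt : q ∉ thick S.toGTree ψ 𝒟 := fun hqt =>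
          hzt (mem_thick_of_stabilizer_le h𝒟 hqt hqz)
        have hsegg : seg (α.map (g⁻¹ • p)) (α.map (g⁻¹ • p')) ⊆ thick T.toGTree ψ' 𝒟 := by
          rw [α.map_smul, α.map_smul]
          exact seg_subset_thick_smul h𝒟 _ hseg
        have hqs : q ∈ seg (g⁻¹ • p) (g⁻¹ • p') := by
          rw [S.toGTree.smul_mem_seg', inv_inv, ← e']
          exact hz'
        have hgy := h.symm.not_le_of_seg hu.symm h𝒟 hψ ((smul_mem_thick_iff h𝒟).2 hp)
          ((smul_mem_thick_iff h𝒟).2 hp') hsegg hqs hq hqv hqy hqt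
        exact hgy fun k hk => hfix k (hyx k hk) hk
  · exact hgx fun g hg => hfix g hg (hb.left g hg)

/-- If the active edges of a fold are thick, then the fold joins no two components of the thick
part. -/
theorem seg_subset_thick (h : FoldAt S T α v x y) (hu : Untwisted S.toGTree v x y)
    (h𝒟 : IsFamily 𝒟) (hψ : ∀ g, ψ' (α.hom g) = ψ g)
    (hx : Nondegenerate S.toGTree v x y → (¬ ∀ g : S.G, g • x = x → g • v = v) →
      seg v x ⊆ thick S.toGTree ψ 𝒟)
    (hy : Nondegenerate S.toGTree v x y → (¬ ∀ g : S.G, g • y = y → g • v = v) →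
      seg v y ⊆ thick S.toGTree ψ 𝒟) {p p' : S.X}
    (hp : p ∈ thick S.toGTree ψ 𝒟) (hp' : p' ∈ thick S.toGTree ψ 𝒟)
    (hseg : seg (α.map p) (α.map p') ⊆ thick T.toGTree ψ' 𝒟) : seg p p' ⊆ thick S.toGTree ψ 𝒟 := by
  intro z hz
  by_contra hzt
  wlog hzv : z ∉ S.verts generalizing z
  · rw [not_not] at hzv
    have hne : z ≠ p' := fun e => hzt (e ▸ hp')
    obtain ⟨c, z₂, hc, h1, h2, h3, h4⟩ := SimplicialTree.exists_near hzv hne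
    exact this (seg_subset_right hz h1) (fun ht => hzt
      (mem_thick_of_stabilizer_le h𝒟 ht fun g hg => (hc.smul_eq h2 h3 h4 hg).1))
      (hc.notMem_verts h2 h3 h4)
  rcases h.classify z with h5 | ⟨g, r, rfl, hr, hrv⟩
  · exact hzt (h.mem_thick_of_map_mem h𝒟 hψ
      (hseg (h.map_mem_seg hz hzv fun w _ hw => h5 w hw)) fun g hg => h5 _ hg)
  · have hnv : ∀ a, a ∈ S.verts → r ≠ a := by
      rintro a ha rfl
      exact hzv (S.smul_mem g _ ha)
    have hsegg : seg (α.map (g⁻¹ • p)) (α.map (g⁻¹ • p')) ⊆ thick T.toGTree ψ' 𝒟 := by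
      rw [α.map_smul, α.map_smul]
      exact seg_subset_thick_smul h𝒟 _ hseg
    have hrs : r ∈ seg (g⁻¹ • p) (g⁻¹ • p') := by
      rw [S.toGTree.smul_mem_seg', inv_inv]
      exact hz
    have hrt : r ∉ thick S.toGTree ψ 𝒟 := fun ht => hzt ((smul_mem_thick_iff h𝒟).2 ht)
    have q1 := (smul_mem_thick_iff (ψ := ψ) h𝒟 (g := g⁻¹)).2 hp
    have q2 := (smul_mem_thick_iff (ψ := ψ) h𝒟 (g := g⁻¹)).2 hp'
    rcases hr with hr | hr
    · exact h.seg_thick_aux hu h𝒟 hψ hx q1 q2 hsegg hrs hr hrv (hnv x h.left.right_mem) hrt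
    · exact h.symm.seg_thick_aux hu.symm h𝒟 hψ (fun hn => hy hn.symm) q1 q2 hsegg hrs hr hrv
        (hnv y h.right.right_mem) hrt

/-- Active edges of a fold lie in every core. -/
theorem seg_subset_core (h : FoldAt S T α v x y) (hu : Untwisted S.toGTree v x y)
    (hn : Nondegenerate S.toGTree v x y) {Y : Set S.X} (hY : Core S.toGTree ψ 𝒟 Y)
    (hx : seg v x ⊆ thick S.toGTree ψ 𝒟)
    (hy : (¬ ∀ g : S.G, g • y = y → g • v = v) → seg v y ⊆ thick S.toGTree ψ 𝒟)
    (h𝒟 : IsFamily 𝒟) (hgx : ¬ ∀ g : S.G, g • x = x → g • v = v) : seg v x ⊆ Y := by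
  have thk : ∀ {q y : S.X}, q ∈ thick S.toGTree ψ 𝒟 → (∀ g : S.G, g • q = q → g • y = y) →
      seg q y ⊆ thick S.toGTree ψ 𝒟 := seg_subset_thick_of_fixed h𝒟
  -- the path from an end of a thick edge to the core avoids the edge if the end is not fixed
  have turn : ∀ {a b q : S.X} {g : S.G}, S.IsEdge a b → g • a = a → g • b ≠ b → g • q = q → a ∈ seg q b := by
    intro a b q g he ha hb hq
    refine S.isRTree.mem_seg_of_inter fun z h1 h2 => ?_
    by_contra hza
    have hz := S.toGTree.smul_eq_of_mem_seg ha hq h1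
    by_cases hzb : z = b
    · exact hb (hzb ▸ hz)
    · exact hb (he.smul_eq h2 hza hzb hz).2
  have hxt : x ∈ thick S.toGTree ψ 𝒟 := hx (right_mem_seg v x)
  have hvt : v ∈ thick S.toGTree ψ 𝒟 := hx (left_mem_seg v x)
  obtain ⟨p, hpY, hp⟩ := hY.retract x hxt
  have hxp : x ∈ seg p v := by
    push Not at hgx
    obtain ⟨g, h1, h2⟩ := hgx
    exact turn h.left.symm h1 h2 (hp g h1)
  have fin : ∀ q ∈ Y, seg v q ⊆ thick S.toGTree ψ 𝒟 → v ∈ seg p q → seg v x ⊆ Y := by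
    intro q hq hvq hv
    have hpx : seg p x ⊆ thick S.toGTree ψ 𝒟 := by
      rw [seg_comm]
      exact thk hxt hp
    have hsub := hY.convex p hpY q hq (seg_subset_thick_trans hpx
      (seg_subset_thick_trans (by rwa [seg_comm]) hvq))
    rw [seg_comm]
    exact (seg_subset_right hxp).trans ((seg_subset_left hv).trans hsub)
  by_cases hgy : ∀ g : S.G, g • y = y → g • v = v
  · obtain ⟨g, h1, h2, -⟩ := h.exists_smul_ne hu hn hgy
    obtain ⟨q, hqY, hq⟩ := hY.retract v hvt
    have hvq : v ∈ seg x q := mem_seg_comm.1 (turn h.left h1 h2 (hq g h1))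
    exact fin q hqY (thk hvt hq) (S.isRTree.mem_seg_of_overlap hxp hvq h.left.1.symm).2
  · have hyt := hy hgy
    obtain ⟨q, hqY, hq⟩ := hY.retract y (hyt (right_mem_seg v y))
    have hyq : y ∈ seg v q := by
      push Not at hgy
      obtain ⟨g, h1, h2⟩ := hgy
      exact mem_seg_comm.1 (turn h.right.symm h1 h2 (hq g h1))
    have h3 := (S.isRTree.mem_seg_of_overlap hxp h.mem_seg h.left.1.symm).2
    exact fin q hqY (seg_subset_thick_trans hyt (thk (hyt (right_mem_seg v y)) hq))
      (S.isRTree.mem_seg_of_overlap h3 hyq h.right.1).1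

/-- If the active edges of a fold are thick, then the image of a core is a core. -/
theorem core_image (h : FoldAt S T α v x y) (hu : Untwisted S.toGTree v x y)
    (h𝒟 : IsFamily 𝒟) (hψ : ∀ g, ψ' (α.hom g) = ψ g)
    (hx : Nondegenerate S.toGTree v x y → (¬ ∀ g : S.G, g • x = x → g • v = v) →
      seg v x ⊆ thick S.toGTree ψ 𝒟)
    (hy : Nondegenerate S.toGTree v x y → (¬ ∀ g : S.G, g • y = y → g • v = v) →
      seg v y ⊆ thick S.toGTree ψ 𝒟) {Y : Set S.X} (hY : Core S.toGTree ψ 𝒟 Y) :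
    Core T.toGTree ψ' 𝒟 (α.map '' Y) := by
  refine ⟨?_, ?_, ?_, ?_⟩
  · rintro _ ⟨q, hq, rfl⟩
    exact map_mem_thick h𝒟 α hψ (hY.subset hq)
  · rintro k _ ⟨q, hq, rfl⟩
    obtain ⟨g, rfl⟩ := h.surj_hom k
    exact ⟨g • q, hY.smul g q hq, α.map_smul g q⟩
  · rintro _ ⟨q, hq, rfl⟩ _ ⟨q', hq', rfl⟩ hseg
    have := h.seg_subset_thick hu h𝒟 hψ hx hy (hY.subset hq) (hY.subset hq') hseg
    exact (α.seg_subset_image q q').trans (Set.image_mono (hY.convex q hq q' hq' this))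
  · -- a point whose stabilizer comes from the stabilizer of `w` is treated by means of `w`
    have via : ∀ {p w : S.X}, α.map p ∈ thick T.toGTree ψ' 𝒟 →
        (∀ g : S.G, α.map (g • p) = α.map p → g • w = w) →
        ∃ y ∈ α.map '' Y, ∀ k : T.G, k • α.map p = α.map p → k • y = y := by
      intro p w hp hw
      obtain ⟨q, hqY, hq⟩ := hY.retract w (h.mem_thick_of_map_mem h𝒟 hψ hp hw)
      exact ⟨α.map q, ⟨q, hqY, rfl⟩, fun k hk =>
        h.smul_map_eq (fun g hg => hq g (hw g hg)) hk⟩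
    have hxend : α.map x ∈ thick T.toGTree ψ' 𝒟 →
        ∃ y ∈ α.map '' Y, ∀ k : T.G, k • α.map x = α.map x → k • y = y := by
      intro hp
      by_cases hn : Nondegenerate S.toGTree v x y
      · rcases not_le_or_not_le hu hn with hg | hg
        · have := h.seg_subset_core hu hn hY (hx hn hg) (hy hn) h𝒟 hg
          exact ⟨α.map x, ⟨x, this (right_mem_seg v x), rfl⟩, fun k hk => hk⟩
        · have := h.symm.seg_subset_core hu.symm hn.symm hY (hy hn hg) (hx hn) h𝒟 hg
          exact ⟨α.map x, ⟨y, this (right_mem_seg v y), h.map_eq.symm⟩, fun k hk => hk⟩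
      · simp only [Nondegenerate, not_forall, not_not] at hn
        obtain ⟨w, -, hb⟩ := hn
        exact via hp fun g hg => h.mem_of_map_smul_eq_end hb hg
    intro q hq
    obtain ⟨p, rfl⟩ := h.surj q
    rcases h.classify p with h5 | ⟨g, r, rfl, hr, hrv⟩
    · exact via hq fun g hg => h5 _ hg
    · have hq' : α.map r ∈ thick T.toGTree ψ' 𝒟 := by
        rw [α.map_smul] at hq
        exact (smul_mem_thick_iff h𝒟).1 hq
      have : ∃ y ∈ α.map '' Y, ∀ k : T.G, k • α.map r = α.map r → k • y = y := by
        rcases hr with hr | hr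
        · by_cases hrx : r = x
          · exact hrx ▸ hxend (hrx ▸ hq')
          · exact via hq' fun g hg => h.smul_eq_of_map_smul_eq hr hrv hrx hg
        · by_cases hry : r = y
          · have := hxend (by rw [h.map_eq, ← hry]; exact hq')
            rwa [h.map_eq, ← hry] at this
          · exact via hq' fun g hg => h.symm.smul_eq_of_map_smul_eq hr hrv hry hg
      obtain ⟨_, ⟨w, hw, rfl⟩, hfix⟩ := this
      refine ⟨α.map (g • w), ⟨g • w, hY.smul g w hw, rfl⟩, fun k hk => ?_⟩
      have := hfix ((α.hom g)⁻¹ * k * α.hom g) (by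
        rw [mul_smul, mul_smul, ← α.map_smul, hk, α.map_smul, inv_smul_smul])
      rw [mul_smul, mul_smul, ← α.map_smul, inv_smul_eq_iff, ← α.map_smul] at this
      exact this

/-- If `x` or `y` is thick whenever the fold is non-degenerate, then every component of the thick
part after the fold meets the image of the thick part before it. -/
theorem hits (h : FoldAt S T α v x y) (h𝒟 : IsFamily 𝒟) (hψ : ∀ g, ψ' (α.hom g) = ψ g)
    (hn : Nondegenerate S.toGTree v x y →
      x ∈ thick S.toGTree ψ 𝒟 ∨ y ∈ thick S.toGTree ψ 𝒟) : Hits ψ ψ' 𝒟 α.map := by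
  have via : ∀ {p w : S.X}, α.map p ∈ thick T.toGTree ψ' 𝒟 →
      (∀ g : S.G, α.map (g • p) = α.map p → g • w = w) →
      ∃ w ∈ thick S.toGTree ψ 𝒟, seg (α.map w) (α.map p) ⊆ thick T.toGTree ψ' 𝒟 := by
    intro p w hp hw
    refine ⟨w, h.mem_thick_of_map_mem h𝒟 hψ hp hw, ?_⟩
    rw [seg_comm]
    exact seg_subset_thick_of_fixed h𝒟 hp fun k hk => h.smul_map_eq hw hk
  have hxend : α.map x ∈ thick T.toGTree ψ' 𝒟 →
      ∃ w ∈ thick S.toGTree ψ 𝒟, seg (α.map w) (α.map x) ⊆ thick T.toGTree ψ' 𝒟 := by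
    intro hp
    by_cases hnd : Nondegenerate S.toGTree v x y
    · rcases hn hnd with hg | hg
      · exact ⟨x, hg, seg_self_subset_thick hp⟩
      · exact ⟨y, hg, by rw [← h.map_eq]; exact seg_self_subset_thick hp⟩
    · simp only [Nondegenerate, not_forall, not_not] at hnd
      obtain ⟨w, -, hb⟩ := hnd
      exact via hp fun g hg => h.mem_of_map_smul_eq_end hb hg
  intro q hq
  obtain ⟨p, rfl⟩ := h.surj q
  rcases h.classify p with h5 | ⟨g, r, rfl, hr, hrv⟩
  · exact via hq fun g hg => h5 _ hg
  · have hq' : α.map r ∈ thick T.toGTree ψ' 𝒟 := by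
      rw [α.map_smul] at hq
      exact (smul_mem_thick_iff h𝒟).1 hq
    have : ∃ w ∈ thick S.toGTree ψ 𝒟, seg (α.map w) (α.map r) ⊆ thick T.toGTree ψ' 𝒟 := by
      rcases hr with hr | hr
      · by_cases hrx : r = x
        · exact hrx ▸ hxend (hrx ▸ hq')
        · exact via hq' fun g hg => h.smul_eq_of_map_smul_eq hr hrv hrx hg
      · by_cases hry : r = y
        · have := hxend (by rw [h.map_eq, ← hry]; exact hq')
          rwa [h.map_eq, ← hry] at this
        · exact via hq' fun g hg => h.symm.smul_eq_of_map_smul_eq hr hrv hry hg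
    obtain ⟨w, hw, hsg⟩ := this
    refine ⟨g • w, (smul_mem_thick_iff h𝒟).2 hw, ?_⟩
    rw [α.map_smul, α.map_smul]
    exact seg_subset_thick_smul h𝒟 _ hsg

/-- A non-degenerate fold of type I or II with an active edge whose label is maximal in the family
`𝒟` joins two components of the thick part that some cocycle tells apart. -/
theorem exists_isCocycle (h : FoldAt S T α v x y) (hu : Untwisted S.toGTree v x y)
    (hn : Nondegenerate S.toGTree v x y) (h𝒟 : IsFamily 𝒟) (hψ : ∀ g, ψ' (α.hom g) = ψ g)
    (hinj : ∀ (p : S.X) (g : S.G), g • p = p → ψ g = 1 → g = 1) {m : S.X} (hm : m ∈ seg v x)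
    (hd : dist v m = dist v x / 2) (hmt : m ∉ thick S.toGTree ψ 𝒟)
    (hmax : ∀ K : Subgroup G, label S.toGTree ψ m < K → K ∉ 𝒟)
    (hgx : ¬ ∀ g : S.G, g • x = x → g • v = v)
    (hy : (¬ ∀ g : S.G, g • y = y → g • v = v) → y ∈ thick S.toGTree ψ 𝒟) :
    ∃ c, IsCocycle S.toGTree ψ 𝒟 c ∧ ∃ p q, c p q ≠ 0 ∧
      seg (α.map (p : S.X)) (α.map (q : S.X)) ⊆ thick T.toGTree ψ' 𝒟 := by
  have hpos := dist_pos.2 h.left.1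
  have hmv : m ≠ v := by
    rintro rfl
    rw [dist_self] at hd
    linarith
  have hmx : m ≠ x := by
    rintro rfl
    linarith
  have hmvert := h.left.notMem_verts hm hmv hmx
  -- a group that contains the label of `m` and another element is not in the family
  have hbig : ∀ (w : S.X) (K : Subgroup G) (g : S.G), label S.toGTree ψ m ≤ K →
      (∀ g : S.G, g • m = m → g • w = w) → g • w = w → g • m ≠ m → ψ g ∈ K → K ∉ 𝒟 := by
    intro w K g hK hw hgw hgm hgK
    refine hmax K (lt_of_le_of_ne hK ?_)
    rintro rfl
    obtain ⟨e, he, hee⟩ := hgK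
    have he' : e • m = m := he
    have : g * e⁻¹ = 1 := hinj w _ (by
      rw [mul_smul, inv_smul_eq_iff.2 (hw e he').symm, hgw]) (by
      rw [map_mul, map_inv, hee, mul_inv_cancel])
    rw [mul_inv_eq_one.1 this] at hgm
    exact hgm he'
  have hthick : ∀ (w : S.X) (g : S.G), (∀ g : S.G, g • m = m → g • w = w) → g • w = w →
      g • m ≠ m → w ∈ thick S.toGTree ψ 𝒟 := fun w g h1 h2 h3 =>
    hbig w _ g (label_le_of_stabilizer_le h1) h1 h2 h3 ⟨g, h2, rfl⟩
  have hmfix := fun (g : S.G) (hg : g • m = m) => h.left.smul_eq hm hmv hmx hg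
  have hxt : x ∈ thick S.toGTree ψ 𝒟 := by
    push Not at hgx
    obtain ⟨g, h1, h2⟩ := hgx
    exact hthick x g (fun k hk => (hmfix k hk).2) h1 fun e => h2 (hmfix g e).1
  have hcoc := isCocycle_cross (ψ := ψ) h𝒟 h.left hm hd hmt
  have hself : ∀ g : S.G, g • m ∈ seg v x → g • m = m := by
    intro g hg
    have hne : g • m ≠ v := fun e =>
      hmvert (SimplicialTree.smul_mem_verts_iff.1 (e ▸ h.left.left_mem))
    have := (level h.left h.left h.orbit_left rfl hm hg hne rfl).1
    exact S.isRTree.eq_of_dist_eq hg hm this.symm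
  have hedge : (∃ g : S.G, g • v = v ∧ g • x ≠ x ∧ α.map (g • m) = α.map m) →
      ∃ c, IsCocycle S.toGTree ψ 𝒟 c ∧ ∃ p q, c p q ≠ 0 ∧
        seg (α.map (p : S.X)) (α.map (q : S.X)) ⊆ thick T.toGTree ψ' 𝒟 := by
    rintro ⟨g, h1, h2, h3⟩
    have hgm : g • m ≠ m := fun e => h2 (hmfix g e).2
    have hvt := hthick v g (fun k hk => (hmfix k hk).1) h1 hgm
    refine ⟨_, hcoc, ⟨v, hvt⟩, ⟨x, hxt⟩, ?_, ?_⟩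
    · dsimp only
      rw [cross_eq_one hm hself]
      exact one_ne_zero
    · obtain ⟨he, hiso⟩ := h.simplicial.2 v x h.left
      refine he.seg_subset_thick h𝒟 (image_mem_seg hiso hm) ?_ ?_ ?_
      · intro e
        refine hmv (dist_eq_zero.1 ?_)
        rw [← hiso m hm v (left_mem_seg v x), e, dist_self]
      · intro e
        refine hmx (dist_eq_zero.1 ?_)
        rw [← hiso m hm x (right_mem_seg v x), e, dist_self]
      · refine hbig v _ g (label_le_label_map α hψ m) (fun k hk => (hmfix k hk).1) h1 hgm ?_
        refine ⟨α.hom g, ?_, hψ g⟩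
        show α.hom g • α.map m = α.map m
        rw [← α.map_smul, h3]
  obtain ⟨q, hq, hdq, heq⟩ := h.exists_partner hm
  have hqv : q ≠ v := by
    rintro rfl
    rw [dist_self] at hdq
    exact hmv (dist_eq_zero.1 hdq).symm
  rcases hu with hu | ⟨k, k1, k2⟩
  · by_cases hgy : ∀ g : S.G, g • y = y → g • v = v
    · obtain ⟨g, h1, h2, h3⟩ := h.exists_smul_ne (Or.inl hu) hn hgy
      rcases h3 with h3 | h3
      · exact absurd ⟨g, h3⟩ hu
      · refine hedge ⟨g, h1, h2, ?_⟩
        rw [α.map_smul, heq, ← α.map_smul, S.toGTree.smul_eq_of_mem_seg h1 h3 hq]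
    · refine ⟨_, hcoc, ⟨x, hxt⟩, ⟨y, hy hgy⟩, ?_, ?_⟩
      · dsimp only
        rw [cross_eq_one]
        · exact one_ne_zero
        · exact seg_subset_left h.mem_seg (mem_seg_comm.1 hm)
        · intro g hg
          rcases S.isRTree.seg_subset_union x y v hg with h1 | h1
          · exact hself g (mem_seg_comm.1 h1)
          · exfalso
            have hnv : ∀ w ∈ S.verts, g • m ≠ w := fun w hw e =>
              hmvert (SimplicialTree.smul_mem_verts_iff.1 (e ▸ hw))
            have := (level h.left h.right h.orbit_right h.dist_eq hm h1
              (hnv v h.left.left_mem) rfl).2 (hnv y h.right.right_mem)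
            exact hu ⟨g, this.2⟩
      · show seg (α.map x) (α.map y) ⊆ _
        rw [← h.map_eq]
        exact seg_self_subset_thick (map_mem_thick h𝒟 α hψ hxt)
  · refine hedge ⟨k, k1, by rw [k2]; exact h.ne.symm, ?_⟩
    refine ((h.rel _ _).2 (Relation.EqvGen.rel _ _ ?_)).symm
    refine ⟨1, m, hm, k • m, ?_, ?_, (one_smul _ _).symm, (one_smul _ _).symm⟩
    · have := S.toGTree.smul_mem_seg (g := k).2 hm
      rwa [k1, k2] at this
    · have := S.isometric k v m
      rw [k1] at this
      exact this.symm

/-- A fold of type III makes a character that vanished on all stabilizers non-zero on one. -/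
theorem exists_ellipticChar (h : FoldAt S T α v x y) (hu : ¬ Untwisted S.toGTree v x y) :
    ∃ χ ∈ ellipticChars S.toGTree, ∃ (g : S.G) (p : T.X), χ g ≠ 1 ∧ α.hom g • p = p := by
  simp only [Untwisted, not_or, not_not, not_exists, not_and] at hu
  obtain ⟨⟨g, hg⟩, hno⟩ := hu
  obtain ⟨m, hm, hmv, hmx, hd⟩ := S.isRTree.exists_mid h.left.1
  have hmvert := h.left.notMem_verts hm hmv hmx
  obtain ⟨χ, hχ, hval⟩ := Folding.exists_ellipticChar h.left hm hd
  have hnv : ∀ (g : S.G), ∀ w ∈ S.verts, g • m ≠ w := fun g w hw e =>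
    hmvert (SimplicialTree.smul_mem_verts_iff.1 (e ▸ hw))
  refine ⟨χ, hχ, g, α.map x, ?_, ?_⟩
  · rw [hval g x (by rintro ⟨k, hk⟩; exact hnv k x h.left.right_mem hk), hg, cross_eq_one]
    · decide
    · exact seg_subset_left h.mem_seg (mem_seg_comm.1 hm)
    · intro k hk
      rcases S.isRTree.seg_subset_union x y v hk with h1 | h1
      · have := (level h.left h.left h.orbit_left rfl hm (mem_seg_comm.1 h1)
          (hnv k v h.left.left_mem) rfl).1
        exact S.isRTree.eq_of_dist_eq (mem_seg_comm.1 h1) hm this.symm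
      · exfalso
        have := (level h.left h.right h.orbit_right h.dist_eq hm h1
          (hnv k v h.left.left_mem) rfl).2 (hnv k y h.right.right_mem)
        exact hno k this.1 this.2
  · rw [← α.map_smul, hg, h.map_eq]

end FoldAt

end FoldThick

/-! ### Vertex morphisms -/

/-- A morphism onto the quotient of a tree by the kernel of a surjective homomorphism: it is
surjective on stabilizers and distances are realized by lifts. -/
structure IsQuot {S T : GTree.{u, v}} (θ : Morphism S T) : Prop where
  surj_hom : Function.Surjective θ.hom
  surj : Function.Surjective θ.map
  stab : ∀ p, ∀ h : T.G, h • θ.map p = θ.map p → ∃ g : S.G, g • p = p ∧ θ.hom g = h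
  lift : ∀ p q, ∃ k : S.G, θ.hom k = 1 ∧ dist p (k • q) = dist (θ.map p) (θ.map q)

theorem IsVertexMorphism.exists_smul_eq {S T : SimplicialTree.{u, v}}
    {θ : Morphism S.toGTree T.toGTree} (h : IsVertexMorphism S T θ) {p q : S.X}
    (hpq : θ.map p = θ.map q) : ∃ k : S.G, θ.hom k = 1 ∧ k • p = q := by
  obtain ⟨-, -, -, h4, h5, -⟩ := h
  obtain ⟨g, rfl⟩ := h4 p q ⟨1, by rw [one_smul, hpq]⟩
  obtain ⟨g', h1, h2⟩ := h5 p (θ.hom g) (by rw [← θ.map_smul, ← hpq])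
  refine ⟨g * g'⁻¹, by rw [map_mul, map_inv, h2, mul_inv_cancel], ?_⟩
  rw [mul_smul, inv_smul_eq_iff.2 h1.symm]

theorem IsVertexMorphism.isQuot {S T : SimplicialTree.{u, v}}
    {θ : Morphism S.toGTree T.toGTree} (h : IsVertexMorphism S T θ) : IsQuot θ := by
  have hV := fun {p q : S.X} (e : θ.map p = θ.map q) => h.exists_smul_eq e
  obtain ⟨h1, h2, h3, h4, h5, -⟩ := h
  refine ⟨h1, h2, h5, fun p q => ?_⟩
  have key : ∀ a b : T.X, ∀ p : S.X, θ.map p = a → ∃ r, θ.map r = b ∧ dist p r = dist a b := by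
    refine SimplicialTree.seg_induction (T := T) ?_ ?_ ?_
    · exact fun a p hp => ⟨p, hp, by rw [dist_self, dist_self]⟩
    · intro c d a b he ha hb p hp
      -- an edge lifts to an edge, since a point inside it lifts to a point inside an edge
      obtain ⟨w, hw, hwc, hwd, -⟩ := T.isRTree.exists_mid he.1
      obtain ⟨s, rfl⟩ := h2 w
      have hs : s ∉ S.verts := fun hs => he.notMem_verts hw hwc hwd (h3.1 s hs)
      obtain ⟨e, f, hef, hse, -, -⟩ := SimplicialTree.exists_isEdge hs
      obtain ⟨hedge, hiso⟩ := h3.2 e f hef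
      have hseg : seg (θ.map e) (θ.map f) = seg c d := by
        rcases he.ends_eq hedge hw hwc hwd (image_mem_seg hiso hse) with ⟨e1, e2⟩ | ⟨e1, e2⟩
        · rw [e1, e2]
        · rw [e1, e2, seg_comm]
      rw [← hseg, ← image_seg S.isRTree T.isRTree hiso] at ha hb
      obtain ⟨a', ha', rfl⟩ := ha
      obtain ⟨b', hb', rfl⟩ := hb
      obtain ⟨k, hk, rfl⟩ := hV hp.symm
      refine ⟨k • b', by rw [θ.map_smul, hk, one_smul], ?_⟩
      rw [S.isometric, hiso a' ha' b' hb']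
    · intro a b u _ hm _ _ i1 i2 p hp
      obtain ⟨r, hr, d1⟩ := i1 p hp
      obtain ⟨s, hs, d2⟩ := i2 r hr
      refine ⟨s, hs, le_antisymm ?_ ?_⟩
      · rw [mem_seg] at hm
        linarith [dist_triangle p r s]
      · rw [← hp, ← hs]
        exact θ.dist_le p s
  obtain ⟨r, hr, hd⟩ := key _ (θ.map q) p rfl
  obtain ⟨k, hk, rfl⟩ := hV hr.symm
  exact ⟨k, hk, hd⟩

theorem IsSubdivision.isQuot {S T : SimplicialTree.{u, v}}
    {θ : Morphism S.toGTree T.toGTree} (h : IsSubdivision S T θ) : IsQuot θ := by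
  obtain ⟨h1, h2, h3, -⟩ := h
  refine ⟨h1.2, h2, fun p k hk => ?_, fun p q => ⟨1, map_one _, by rw [one_smul, h3]⟩⟩
  obtain ⟨g, rfl⟩ := h1.2 k
  refine ⟨g, dist_eq_zero.1 ?_, rfl⟩
  rw [← h3, θ.map_smul, hk, dist_self]

section Quot

variable {G : Type*} [Group G] {S T : GTree.{u, v}} {θ : Morphism S T} {ψ : S.G →* G}
  {ψ' : T.G →* G} {𝒟 : Set (Subgroup G)}

namespace IsQuot

theorem map_mem_thick_iff (h : IsQuot θ) (hψ : ∀ g, ψ' (θ.hom g) = ψ g) {p : S.X} :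
    θ.map p ∈ thick T ψ' 𝒟 ↔ p ∈ thick S ψ 𝒟 := by
  have : label T ψ' (θ.map p) = label S ψ p := by
    refine le_antisymm ?_ (label_le_label_map θ hψ p)
    rintro _ ⟨k, hk, rfl⟩
    obtain ⟨g, hg, rfl⟩ := h.stab p k hk
    exact ⟨g, hg, (hψ g).symm⟩
  rw [thick, thick, Set.mem_ofPred_eq, Set.mem_ofPred_eq, this]

theorem hits (h : IsQuot θ) (hψ : ∀ g, ψ' (θ.hom g) = ψ g) : Hits ψ ψ' 𝒟 θ.map := by
  intro q hq
  obtain ⟨p, rfl⟩ := h.surj q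
  exact ⟨p, (h.map_mem_thick_iff hψ).1 hq, seg_self_subset_thick hq⟩

theorem core_image (h : IsQuot θ) (h𝒟 : IsFamily 𝒟) (hψ : ∀ g, ψ' (θ.hom g) = ψ g)
    {Y : Set S.X} (hY : Core S ψ 𝒟 Y) : Core T ψ' 𝒟 (θ.map '' Y) := by
  refine ⟨?_, ?_, ?_, ?_⟩
  · rintro _ ⟨q, hq, rfl⟩
    exact map_mem_thick h𝒟 θ hψ (hY.subset hq)
  · rintro k _ ⟨q, hq, rfl⟩
    obtain ⟨g, rfl⟩ := h.surj_hom k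
    exact ⟨g • q, hY.smul g q hq, θ.map_smul g q⟩
  · rintro _ ⟨p, hp, rfl⟩ _ ⟨q, hq, rfl⟩ hseg
    obtain ⟨k, hk, hd⟩ := h.lift p q
    have hkq : θ.map (k • q) = θ.map q := by rw [θ.map_smul, hk, one_smul]
    have hsub : seg p (k • q) ⊆ thick S ψ 𝒟 := by
      intro z hz
      refine (h.map_mem_thick_iff hψ).1 (hseg ?_)
      have d1 := θ.dist_le p z
      have d2 := θ.dist_le z (k • q)
      rw [hkq] at d2
      rw [mem_seg] at hz ⊢
      linarith [dist_triangle (θ.map p) (θ.map z) (θ.map q)]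
    have := hY.convex p hp _ (hY.smul k q hq) hsub
    rw [← hkq]
    exact (θ.seg_subset_image _ _).trans (Set.image_mono this)
  · intro q hq
    obtain ⟨p, rfl⟩ := h.surj q
    obtain ⟨y, hy, hfix⟩ := hY.retract p ((h.map_mem_thick_iff hψ).1 hq)
    refine ⟨θ.map y, ⟨y, hy, rfl⟩, fun k hk => ?_⟩
    obtain ⟨g, hg, rfl⟩ := h.stab p k hk
    rw [← θ.map_smul, hfix g hg]

end IsQuot

end Quot

/-- A vertex morphism that is injective on all stabilizers is injective: it is locally injective,
hence an isometry. -/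
theorem IsVertexMorphism.injective {S T : SimplicialTree.{u, v}}
    {θ : Morphism S.toGTree T.toGTree} (h : IsVertexMorphism S T θ)
    (hinj : ∀ (p : S.X) (g : S.G), g • p = p → θ.hom g = 1 → g = 1) :
    Function.Injective θ.hom := by
  have hV := fun {p q : S.X} (e : θ.map p = θ.map q) => h.exists_smul_eq e
  obtain ⟨-, -, h3, -⟩ := h
  -- isometry at the ends of a segment propagates to the segment
  have sub : ∀ {p q z : S.X}, dist (θ.map p) (θ.map q) = dist p q → z ∈ seg p q →
      dist (θ.map p) (θ.map z) = dist p z ∧ θ.map z ∈ seg (θ.map p) (θ.map q) := by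
    intro p q z e hz
    have d1 := θ.dist_le p z
    have d2 := θ.dist_le z q
    have d3 := dist_triangle (θ.map p) (θ.map z) (θ.map q)
    rw [mem_seg] at hz ⊢
    constructor <;> linarith
  have key : ∀ p q : S.X, dist (θ.map p) (θ.map q) = dist p q := by
    refine SimplicialTree.seg_induction (T := S) ?_ ?_ ?_
    · intro p
      rw [dist_self, dist_self]
    · exact fun a b p q he hp hq => (h3.2 a b he).2 p hp q hq
    · intro p q u hu hm _ _ i1 i2
      have i1' : dist (θ.map u) (θ.map p) = dist u p := by rw [dist_comm, i1, dist_comm]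
      have hmem : θ.map u ∈ seg (θ.map p) (θ.map q) := by
        refine T.isRTree.mem_seg_of_inter fun w w1 w2 => ?_
        by_contra hw
        obtain ⟨c, z, he, z1, z2, z3, z4⟩ :=
          SimplicialTree.exists_near (h3.1 u hu) (Ne.symm hw)
        have hzv := he.notMem_verts z2 z3 z4
        -- the lifts of `z` to both sides lie in edges at `u`
        have lift : ∀ r : S.X, dist (θ.map u) (θ.map r) = dist u r →
            z ∈ seg (θ.map u) (θ.map r) →
            ∃ s f, s ∈ seg u r ∧ θ.map s = z ∧ S.IsEdge u f ∧ s ∈ seg u f := by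
          intro r hr hzr
          obtain ⟨s, hs, hsz⟩ := θ.seg_subset_image u r hzr
          have hsv : s ∉ S.verts := fun h => hzv (hsz ▸ h3.1 s h)
          obtain ⟨e, f, hef, hse, hs1, hs2⟩ := SimplicialTree.exists_isEdge hsv
          have end_unique : ∀ e : S.X, e ∈ S.verts → e ∈ seg s u → e = u := by
            intro e hev hes
            have h1 : e ∈ seg u s := mem_seg_comm.1 hes
            have h2 := sub hr (mem_seg_trans hs h1)
            have h4 := (sub (sub hr hs).1 h1).2
            rw [hsz] at h4
            rcases he.eq_or_eq (mem_seg_trans z2 h4) (h3.1 e hev) with h5 | h5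
            · rw [h5, dist_self] at h2
              exact (dist_eq_zero.1 h2.1.symm).symm
            · rw [h5] at h4
              exact absurd (eq_of_mem_seg_of_mem_seg z2 h4) z4
          rcases hef.exit hse hs1 hs2 u with h1 | h1 | h1
          · rcases hef.eq_or_eq h1 hu with rfl | rfl
            · exact ⟨s, f, hs, hsz, hef, hse⟩
            · exact ⟨s, e, hs, hsz, hef.symm, mem_seg_comm.1 hse⟩
          · have := end_unique e hef.left_mem h1
            subst this
            exact ⟨s, f, hs, hsz, hef, hse⟩
          · have := end_unique f hef.right_mem h1
            subst this
            exact ⟨s, e, hs, hsz, hef.symm, mem_seg_comm.1 hse⟩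
        obtain ⟨s, f, s1, s2, s3, s4⟩ := lift p i1' (mem_seg_trans w1 z1)
        obtain ⟨t, f', t1, t2, t3, t4⟩ := lift q i2 (mem_seg_trans w2 z1)
        obtain ⟨k, hk, rfl⟩ := hV (s2.trans t2.symm)
        have hnv : ∀ a ∈ S.verts, k • s ≠ a := by
          rintro a ha rfl
          exact hzv (t2 ▸ h3.1 _ ha)
        rcases t3.ends_eq (s3.smul k) t4 (hnv u hu) (hnv f' t3.right_mem)
          (S.toGTree.smul_mem_seg.2 s4) with ⟨e1, -⟩ | ⟨e1, -⟩
        · rw [hinj u k e1 hk, one_smul] at t1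
          have : s = u := eq_of_mem_seg_both hm (mem_seg_comm.1 s1) t1
          exact z3 (by rw [← s2, this])
        · refine (h3.2 u f' t3).1.1 ?_
          rw [← e1, θ.map_smul, hk, one_smul]
      rw [mem_seg] at hm hmem
      rw [← hmem, ← hm, i1, i2]
  rw [injective_iff_map_eq_one]
  intro g hg
  obtain ⟨p⟩ := S.isRTree.nonempty
  refine hinj p g (dist_eq_zero.1 ?_) hg
  rw [← key, θ.map_smul, hg, one_smul, dist_self]

/-! ### The rank of an arc-fixing subgroup -/

section Rank

variable {T : GTree.{u, v}}

theorem FixesArc.mono {K L : Subgroup T.G} (hL : FixesArc T L) (h : K ≤ L) : FixesArc T K := by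
  obtain ⟨x, y, hne, hfix⟩ := hL
  exact ⟨x, y, hne, fun k hk => hfix k (h hk)⟩

theorem FixesArc.conj {K : Subgroup T.G} (hK : FixesArc T K) (g : T.G) :
    FixesArc T (K.map (MulAut.conj g).toMonoidHom) := by
  obtain ⟨x, y, hne, hfix⟩ := hK
  refine ⟨g • x, g • y, fun e => hne (MulAction.injective g e), ?_⟩
  rintro _ ⟨k, hk, rfl⟩ z hz
  rw [T.smul_mem_seg'] at hz
  have := hfix k hk _ hz
  simp only [MulEquiv.coe_toMonoidHom, MulAut.conj_apply]
  rw [mul_smul, mul_smul, this, smul_inv_smul]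

/-- Enlarging a subgroup to an arc-fixing one. -/
def ArcRel (T : GTree.{u, v}) (K L : Subgroup T.G) : Prop := FixesArc T K ∧ L < K

/-- If every subgroup all of whose finitely generated subgroups fix arcs is finitely generated, then
ascending chains of arc-fixing subgroups are finite. -/
theorem wellFounded_arcRel
    (hfg : ∀ H : Subgroup T.G, (∀ K ≤ H, K.FG → FixesArc T K) → H.FG) :
    WellFounded (ArcRel T) := by
  rw [wellFounded_iff_isEmpty_descending_chain]
  refine ⟨fun ⟨f, hf⟩ => ?_⟩
  have hmono : StrictMono fun n => f (n + 1) := strictMono_nat_of_lt_succ fun n => (hf (n + 1)).2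
  have hdir : Directed (· ≤ ·) fun n => f (n + 1) := hmono.monotone.directed_le
  have key : ∀ K : Subgroup T.G, K ≤ ⨆ n, f (n + 1) → K.FG → ∃ n, K ≤ f (n + 1) := by
    rintro K hK ⟨S, rfl⟩
    have : ∀ s ∈ S, ∃ n, s ∈ f (n + 1) := fun s hs =>
      (Subgroup.mem_iSup_of_directed hdir).1 (hK (Subgroup.subset_closure hs))
    choose! i hi using this
    refine ⟨S.sup i, (Subgroup.closure_le _).2 fun s hs => ?_⟩
    exact hmono.monotone (Finset.le_sup hs) (hi s hs)
  have hH := hfg (⨆ n, f (n + 1)) fun K hK hKfg => by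
    obtain ⟨n, hn⟩ := key K hK hKfg
    exact (hf n).1.mono hn
  obtain ⟨n, hn⟩ := key _ le_rfl hH
  exact absurd ((le_iSup (fun n => f (n + 1)) (n + 1)).trans hn) (not_le_of_gt (hmono n.lt_succ_self))

variable (T) in
/-- The arc-fixing subgroups of rank at least `A`, where the rank measures how long ascending chains
of arc-fixing subgroups above a given one can be. -/
def arcFamily [IsWellFounded (Subgroup T.G) (ArcRel T)] (A : Ordinal.{u}) :
    Set (Subgroup T.G) :=
  {K | FixesArc T K ∧ A ≤ IsWellFounded.rank (ArcRel T) K}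

variable [hwf : IsWellFounded (Subgroup T.G) (ArcRel T)]

theorem rank_lt_rank {K L : Subgroup T.G} (hL : FixesArc T L) (h : K < L) :
    IsWellFounded.rank (ArcRel T) L < IsWellFounded.rank (ArcRel T) K :=
  IsWellFounded.rank_lt_of_rel ⟨hL, h⟩

theorem rank_le_rank {K L : Subgroup T.G} (hL : FixesArc T L) (h : K ≤ L) :
    IsWellFounded.rank (ArcRel T) L ≤ IsWellFounded.rank (ArcRel T) K := by
  rcases h.lt_or_eq with h | rfl
  · exact (rank_lt_rank hL h).le
  · exact le_rfl

theorem map_conj_inv_map_conj {G : Type*} [Group G] (g : G) (K : Subgroup G) :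
    (K.map (MulAut.conj g⁻¹).toMonoidHom).map (MulAut.conj g).toMonoidHom = K := by
  ext k
  simp only [Subgroup.mem_map, MulEquiv.coe_toMonoidHom, MulAut.conj_apply]
  constructor
  · rintro ⟨_, ⟨k, hk, rfl⟩, rfl⟩
    simpa [mul_assoc] using hk
  · intro hk
    exact ⟨_, ⟨k, hk, rfl⟩, by simp [mul_assoc]⟩

theorem rank_conj (g : T.G) (K : Subgroup T.G) :
    IsWellFounded.rank (ArcRel T) (K.map (MulAut.conj g).toMonoidHom) =
      IsWellFounded.rank (ArcRel T) K := by
  have main : ∀ (K : Subgroup T.G) (g : T.G),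
      IsWellFounded.rank (ArcRel T) (K.map (MulAut.conj g).toMonoidHom) ≤
        IsWellFounded.rank (ArcRel T) K := by
    intro K
    induction K using hwf.wf.induction with
    | _ K ih =>
      intro g
      rw [IsWellFounded.rank_eq]
      refine Ordinal.iSup_le fun ⟨L, hL, hlt⟩ => ?_
      rw [Order.succ_le_iff]
      have hK : ArcRel T (L.map (MulAut.conj g⁻¹).toMonoidHom) K := by
        refine ⟨hL.conj _, ?_⟩
        have hinj : Function.Injective (MulAut.conj g⁻¹).toMonoidHom :=
          (MulAut.conj g⁻¹).injective
        have := (Subgroup.map_lt_map_iff_of_injective hinj).2 hlt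
        have e := map_conj_inv_map_conj g⁻¹ K
        rw [inv_inv] at e
        rwa [e] at this
      have h1 := ih _ hK g
      rw [map_conj_inv_map_conj] at h1
      exact h1.trans_lt (IsWellFounded.rank_lt_of_rel hK)
  refine le_antisymm (main K g) ?_
  have := main (K.map (MulAut.conj g).toMonoidHom) g⁻¹
  have e := map_conj_inv_map_conj g⁻¹ K
  rw [inv_inv] at e
  rwa [e] at this

theorem isFamily_arcFamily (A : Ordinal.{u}) : IsFamily (arcFamily T A) :=
  ⟨fun _ _ h hL => ⟨hL.1.mono h, hL.2.trans (rank_le_rank hL.1 h)⟩,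
    fun g K hK => ⟨hK.1.conj g, by rw [rank_conj]; exact hK.2⟩⟩

end Rank

/-- The stabilizer of a point inside an edge fixes an arc of the target of each morphism. -/
theorem fixesArc_label {S : SimplicialTree.{u, v}} {T : GTree.{u, v}} (f : Morphism S.toGTree T)
    {a b m : S.X} (he : S.IsEdge a b) (hm : m ∈ seg a b) (ha : m ≠ a) (hb : m ≠ b) :
    FixesArc T (label S.toGTree f.hom m) := by
  obtain ⟨w, hw, hwa, hiso⟩ := f.isometric a b he.1
  refine ⟨f.map a, f.map w, fun e => hwa ?_, ?_⟩
  · have := hiso a (left_mem_seg a w) w (right_mem_seg a w)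
    rw [e, dist_self] at this
    exact (dist_eq_zero.1 this.symm).symm
  · rintro _ ⟨g, hg, rfl⟩ z hz
    rw [← image_seg S.isRTree T.isRTree hiso] at hz
    obtain ⟨p, hp, rfl⟩ := hz
    have hends := he.smul_eq hm ha hb hg
    rw [← f.map_smul, S.toGTree.smul_eq_of_mem_seg hends.1 hends.2 (seg_subset_left hw hp)]

/-- In a minimal simplicial tree of a finitely generated group a conjugation-invariant function
takes finitely many values on the labels. -/
theorem finite_range_label {G : Type*} [Group G] {β : Type*} {S : SimplicialTree.{u, v}}
    {ψ : S.G →* G} (hfg : Group.FG S.G) (hmin : S.toGTree.IsMinimal) (ρ : Subgroup G → β)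
    (hρ : ∀ g K, ρ (K.map (MulAut.conj g).toMonoidHom) = ρ K) :
    (Set.range fun p => ρ (label S.toGTree ψ p)).Finite := by
  obtain ⟨W, hfin, -, h1, h2⟩ := SimplicialTree.exists_finite_representatives S hfg hmin
  have hinv : ∀ (g : S.G) p, ρ (label S.toGTree ψ (g • p)) = ρ (label S.toGTree ψ p) := by
    intro g p
    rw [label_smul, hρ]
  refine ((hfin.image fun p => ρ (label S.toGTree ψ p)).union
    ((hfin.prod hfin).image fun p : S.X × S.X => ρ ((MulAction.stabilizer S.G p.1 ⊓
      MulAction.stabilizer S.G p.2).map ψ))).subset ?_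
  rintro _ ⟨p, rfl⟩
  by_cases hp : p ∈ S.verts
  · obtain ⟨g, hg⟩ := h1 p hp
    exact Or.inl ⟨g • p, hg, hinv g p⟩
  · obtain ⟨g, a, ha, a', ha', he, hm⟩ := h2 p hp
    refine Or.inr ⟨(a, a'), ⟨ha, ha'⟩, ?_⟩
    have hgp : g • p ∉ S.verts := fun h => hp (SimplicialTree.smul_mem_verts_iff.1 h)
    have : MulAction.stabilizer S.G (g • p) =
        MulAction.stabilizer S.G a ⊓ MulAction.stabilizer S.G a' := by
      ext k
      simp only [Subgroup.mem_inf, MulAction.mem_stabilizer_iff]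
      exact ⟨fun hk => he.smul_eq hm (fun e => hgp (e ▸ he.left_mem))
        (fun e => hgp (e ▸ he.right_mem)) hk, fun hk => S.toGTree.smul_eq_of_mem_seg hk.1 hk.2 hm⟩
    show ρ _ = ρ _
    rw [← hinv g p, label, this]

/-- Strict inclusions of stabilizers give strict inclusions of labels. -/
theorem label_lt_label {G : Type*} [Group G] {S : GTree.{u, v}} {ψ : S.G →* G} {m w : S.X}
    (hinj : ∀ (p : S.X) (g : S.G), g • p = p → ψ g = 1 → g = 1)
    (hw : ∀ g : S.G, g • m = m → g • w = w) {g : S.G} (hg : g • w = w) (hgm : g • m ≠ m) :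
    label S ψ m < label S ψ w := by
  refine lt_of_le_of_ne (label_le_of_stabilizer_le hw) fun e => hgm ?_
  have : ψ g ∈ label S ψ m := e ▸ ⟨g, hg, rfl⟩
  obtain ⟨k, hk, hkg⟩ := this
  have hk' : k • m = m := hk
  have h1 : g * k⁻¹ = 1 := hinj w _ (by
    rw [mul_smul, inv_smul_eq_iff.2 (hw k hk').symm, hg]) (by
    rw [map_mul, map_inv, hkg, mul_inv_cancel])
  rw [mul_inv_eq_one.1 h1]
  exact hk'

/-! ### Groups in a direct limit -/

variable {F : FoldingSequence.{u, v}} {T : GTree.{u, v}} {φ : ∀ n, Morphism (F.tree n).toGTree T}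

theorem FoldingSequence.surjective_step (F : FoldingSequence.{u, v}) (n : ℕ) :
    Function.Surjective (F.step n).hom := by
  rcases F.isStep n with h | ⟨S, α, θ, hα, hθ, hh, -⟩
  · exact h.1.2
  · intro k
    obtain ⟨g, rfl⟩ := hθ.1 k
    obtain ⟨g, rfl⟩ := hα.1.2 g
    exact ⟨g, hh g⟩

/-- The homomorphism from the `n`-th group of a folding sequence to the `k`-th one; it is meaningful
for `n ≤ k` and trivial otherwise. -/
noncomputable def FoldingSequence.trans (F : FoldingSequence.{u, v}) (n k : ℕ) :
    (F.tree n).G →* (F.tree k).G :=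
  if h : n ≤ k then
    Nat.leRecOn (C := fun k => (F.tree n).G →* (F.tree k).G) h
      (fun {j} f => (F.step j).hom.comp f) (MonoidHom.id _)
  else 1

theorem FoldingSequence.trans_self (F : FoldingSequence.{u, v}) (n : ℕ) :
    F.trans n n = MonoidHom.id _ := by
  rw [FoldingSequence.trans, dif_pos le_rfl, Nat.leRecOn_self]

theorem FoldingSequence.trans_succ (F : FoldingSequence.{u, v}) {n k : ℕ} (h : n ≤ k) :
    F.trans n (k + 1) = (F.step k).hom.comp (F.trans n k) := by
  rw [FoldingSequence.trans, FoldingSequence.trans, dif_pos h, dif_pos (h.trans k.le_succ),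
    Nat.leRecOn_succ h]

theorem FoldingSequence.trans_step (F : FoldingSequence.{u, v}) {n k : ℕ} (h : n + 1 ≤ k)
    (g : (F.tree n).G) : F.trans (n + 1) k ((F.step n).hom g) = F.trans n k g := by
  induction k, h using Nat.le_induction with
  | base =>
    rw [F.trans_self, F.trans_succ le_rfl, F.trans_self]
    rfl
  | succ k hk ih =>
    rw [F.trans_succ hk, F.trans_succ (by omega), MonoidHom.comp_apply, MonoidHom.comp_apply, ih]

/-- Homomorphisms compatible with the steps factor through the group of the direct limit. The target
acts on the limit tree through a trivial factor. -/
theorem IsDirectLimit.exists_hom (hT : IsDirectLimit F T φ) {Q : Type u} [Group Q]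
    (ρ : ∀ n, (F.tree n).G →* Q) (hρ : ∀ n g, ρ (n + 1) ((F.step n).hom g) = ρ n g) :
    ∃ σ : T.G →* Q, ∀ n g, σ ((φ n).hom g) = ρ n g := by
  let T' : GTree.{u, v} :=
    { G := T.G × Q
      X := T.X
      action := MulAction.compHom T.X (MonoidHom.fst T.G Q)
      isRTree := T.isRTree
      isometric := fun g => T.isometric g.1 }
  let φ' : ∀ n, Morphism (F.tree n).toGTree T' := fun n =>
    { hom := (φ n).hom.prod (ρ n)
      map := (φ n).map
      map_smul := (φ n).map_smul
      isometric := (φ n).isometric }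
  obtain ⟨ψ, hψ, -⟩ := hT.2 T' φ' fun n =>
    ⟨fun g => Prod.ext ((hT.1 n).1 g) (hρ n g), (hT.1 n).2⟩
  exact ⟨(MonoidHom.snd T.G Q).comp ψ.hom, fun n g => congrArg Prod.snd ((hψ n).1 g)⟩

/-- An element that becomes trivial in the limit becomes trivial at some stage: the limit group maps
to the product of all groups of the sequence modulo the eventually trivial families. -/
theorem IsDirectLimit.exists_trans_eq_one (hT : IsDirectLimit F T φ) {n : ℕ} {g : (F.tree n).G}
    (hg : (φ n).hom g = 1) : ∃ k ≥ n, F.trans n k g = 1 := by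
  let N : Subgroup (∀ k, (F.tree k).G) :=
    { carrier := {f | ∃ K, ∀ k ≥ K, f k = 1}
      one_mem' := ⟨0, fun _ _ => rfl⟩
      mul_mem' := by
        rintro a b ⟨K, hK⟩ ⟨L, hL⟩
        refine ⟨max K L, fun k hk => ?_⟩
        rw [Pi.mul_apply, hK k (le_of_max_le_left hk), hL k (le_of_max_le_right hk), one_mul]
      inv_mem' := by
        rintro a ⟨K, hK⟩
        exact ⟨K, fun k hk => by rw [Pi.inv_apply, hK k hk, inv_one]⟩ }
  have hN : N.Normal := ⟨by
    rintro a ⟨K, hK⟩ b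
    refine ⟨K, fun k hk => ?_⟩
    rw [Pi.mul_apply, Pi.mul_apply, Pi.inv_apply, hK k hk, mul_one, mul_inv_cancel]⟩
  obtain ⟨σ, hσ⟩ := hT.exists_hom
    (fun n => (QuotientGroup.mk' N).comp (MonoidHom.pi fun k => F.trans n k)) (by
      intro n g
      refine (QuotientGroup.eq).2 ⟨n + 1, fun k hk => ?_⟩
      rw [Pi.mul_apply, Pi.inv_apply, MonoidHom.pi_apply, MonoidHom.pi_apply, F.trans_step hk,
        inv_mul_cancel])
  have h1 := hσ n g
  rw [hg, map_one] at h1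
  obtain ⟨K, hK⟩ := (QuotientGroup.eq_one_iff _).1 h1.symm
  exact ⟨max K n, le_max_right _ _, hK _ (le_max_left _ _)⟩

/-- The groups of the sequence map onto the group of the limit, because the limit tree with the
action of the common image already is a target of the sequence. -/
theorem IsDirectLimit.surjective (hT : IsDirectLimit F T φ) (n : ℕ) :
    Function.Surjective (φ n).hom := by
  have hR : ∀ n g, (φ n).hom g ∈ (φ 0).hom.range := by
    intro n
    induction n with
    | zero => exact fun g => ⟨g, rfl⟩
    | succ n ih =>
      intro g
      obtain ⟨g, rfl⟩ := F.surjective_step n g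
      rw [(hT.1 n).1]
      exact ih g
  let T' : GTree.{u, v} :=
    { G := (φ 0).hom.range
      X := T.X
      isRTree := T.isRTree
      isometric := fun g => T.isometric (g : T.G) }
  let φ' : ∀ n, Morphism (F.tree n).toGTree T' := fun n =>
    { hom := (φ n).hom.codRestrict _ (hR n)
      map := (φ n).map
      map_smul := (φ n).map_smul
      isometric := (φ n).isometric }
  obtain ⟨ψ, hψ, -⟩ := hT.2 T' φ' fun n => ⟨fun g => Subtype.ext ((hT.1 n).1 g), (hT.1 n).2⟩
  let ψ' : Morphism T T :=
    { hom := (φ 0).hom.range.subtype.comp ψ.hom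
      map := ψ.map
      map_smul := ψ.map_smul
      isometric := ψ.isometric }
  let ι : Morphism T T :=
    { hom := MonoidHom.id _
      map := id
      map_smul := fun _ _ => rfl
      isometric := fun x y h => ⟨y, right_mem_seg x y, h.symm, fun _ _ _ _ => rfl⟩ }
  have e : ψ' = ι := (hT.2 T φ hT.1).unique
    (fun n => ⟨fun g => congrArg Subtype.val ((hψ n).1 g), (hψ n).2⟩)
    fun n => ⟨fun _ => rfl, fun _ => rfl⟩
  have h0 : ∀ k : T.G, ∃ g, (φ 0).hom g = k := fun k => by
    have : ψ'.hom k = k := by rw [e]; rfl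
    rw [← this]
    exact (ψ.hom k).2
  induction n with
  | zero => exact h0
  | succ n ih =>
    intro k
    obtain ⟨g, rfl⟩ := ih k
    exact ⟨_, (hT.1 n).1 g⟩

theorem IsDirectLimit.injective (hT : IsDirectLimit F T φ) {N : ℕ}
    (h : ∀ n ≥ N, Function.Injective (F.step n).hom) {n : ℕ} (hn : N ≤ n) :
    Function.Injective (φ n).hom := by
  refine (injective_iff_map_eq_one _).2 fun g hg => ?_
  obtain ⟨k, hk, h1⟩ := hT.exists_trans_eq_one hg
  clear hg
  induction k, hk using Nat.le_induction with
  | base => rwa [F.trans_self] at h1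
  | succ k hk ih =>
    rw [F.trans_succ hk, MonoidHom.comp_apply] at h1
    exact ih ((injective_iff_map_eq_one _).1 (h k (hn.trans hk)) _ h1)

/-! ### The folds of a folding sequence -/

/-- The `n`-th step of the sequence is the fold `α` of `[v, x]` and `[v, y]`, followed by the vertex
morphism `θ`. -/
structure FoldStep (F : FoldingSequence.{u, v}) (n : ℕ) (S : SimplicialTree.{u, v})
    (α : Morphism (F.tree n).toGTree S.toGTree) (θ : Morphism S.toGTree (F.tree (n + 1)).toGTree)
    (v x y : (F.tree n).X) : Prop where
  fold : FoldAt (F.tree n) S α v x y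
  vertex : IsVertexMorphism S (F.tree (n + 1)) θ
  hom : ∀ g, (F.step n).hom g = θ.hom (α.hom g)
  map : ∀ p, (F.step n).map p = θ.map (α.map p)

theorem FoldingSequence.isSubdivision_or_foldStep (F : FoldingSequence.{u, v}) (n : ℕ) :
    IsSubdivision (F.tree n) (F.tree (n + 1)) (F.step n) ∨
      ∃ S α θ v x y, FoldStep F n S α θ v x y := by
  rcases F.isStep n with h | ⟨S, α, θ, hα, hθ, hh, hm⟩
  · exact Or.inl h
  · obtain ⟨v, x, y, h⟩ := hα.exists_foldAt
    exact Or.inr ⟨S, α, θ, v, x, y, h, hθ, hh, hm⟩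

/-- A non-increasing sequence of natural numbers is eventually constant. -/
theorem exists_forall_ge_not_lt {a : ℕ → ℕ} {N : ℕ} (h : ∀ n ≥ N, a (n + 1) ≤ a n) :
    ∃ N' ≥ N, ∀ n ≥ N', ¬ a (n + 1) < a n := by
  have hne : (a '' Set.Ici N).Nonempty := ⟨_, N, Set.self_mem_Ici, rfl⟩
  obtain ⟨N', hN', hmin⟩ := Nat.sInf_mem hne
  refine ⟨N', hN', fun n hn hlt => ?_⟩
  have h1 : a n ≤ a N' := by
    clear hlt
    induction n, hn using Nat.le_induction with
    | base => exact le_rfl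
    | succ n hn ih => exact (h n (le_trans hN' hn)).trans ih
  have h2 : sInf (a '' Set.Ici N) ≤ a (n + 1) :=
    Nat.sInf_le ⟨n + 1, Set.mem_Ici.2 (hN'.trans (by omega)), rfl⟩
  omega

/-- Folds of type III occur only finitely often, since each of them destroys a homomorphism to `ℤ/2`
that is trivial on stabilizers. -/
theorem FoldingSequence.exists_forall_untwisted (F : FoldingSequence.{u, v}) :
    ∃ N, ∀ n ≥ N, ∀ S α θ v x y, FoldStep F n S α θ v x y →
      Untwisted (F.tree n).toGTree v x y := by
  have key := fun n => ncard_ellipticChars_le (F.step n) (F.surjective_step n)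
    (finite_ellipticChars (F.fg n))
  obtain ⟨N, -, hN⟩ := exists_forall_ge_not_lt
    (a := fun n => (ellipticChars (F.tree n).toGTree).ncard) (N := 0) fun n _ => (key n).1
  refine ⟨N, fun n hn S α θ v x y h => ?_⟩
  by_contra hu
  refine hN n hn ((key n).2 ?_)
  obtain ⟨χ, hχ, g, p, hg, hp⟩ := h.fold.exists_ellipticChar hu
  exact ⟨χ, hχ, g, θ.map p, hg, by rw [h.hom, ← θ.map_smul, hp]⟩

/-- The point `m` is the midpoint of an active edge `[v, x]`: one that takes part in a
non-degenerate fold and is not fixed by the stabilizer of its end `x`. -/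
def IsActive (F : FoldingSequence.{u, v}) (n : ℕ) (m : (F.tree n).X) : Prop :=
  ∃ S α θ v x y, FoldStep F n S α θ v x y ∧ Nondegenerate (F.tree n).toGTree v x y ∧
    (¬ ∀ g : (F.tree n).G, g • x = x → g • v = v) ∧ m ∈ seg v x ∧ dist v m = dist v x / 2

namespace FoldStep

variable {n : ℕ} {S : SimplicialTree.{u, v}} {α : Morphism (F.tree n).toGTree S.toGTree}
  {θ : Morphism S.toGTree (F.tree (n + 1)).toGTree} {v x y : (F.tree n).X}
  {𝒟 : Set (Subgroup T.G)}

theorem symm (h : FoldStep F n S α θ v x y) : FoldStep F n S α θ v y x :=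
  ⟨h.fold.symm, h.vertex, h.hom, h.map⟩

theorem exists_isActive (h : FoldStep F n S α θ v x y)
    (hn : Nondegenerate (F.tree n).toGTree v x y)
    (hx : ¬ ∀ g : (F.tree n).G, g • x = x → g • v = v) :
    ∃ m, IsActive F n m ∧ m ∈ seg v x ∧ m ≠ v ∧ m ≠ x := by
  obtain ⟨m, hm, h1, h2, hd⟩ := (F.tree n).isRTree.exists_mid h.fold.left.1
  exact ⟨m, ⟨S, α, θ, v, x, y, h, hn, hx, hm, hd⟩, hm, h1, h2⟩

theorem seg_subset_thick (h : FoldStep F n S α θ v x y) (h𝒟 : IsFamily 𝒟)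
    (hact : ∀ m, IsActive F n m → m ∈ thick (F.tree n).toGTree (φ n).hom 𝒟)
    (hn : Nondegenerate (F.tree n).toGTree v x y)
    (hx : ¬ ∀ g : (F.tree n).G, g • x = x → g • v = v) :
    seg v x ⊆ thick (F.tree n).toGTree (φ n).hom 𝒟 := by
  obtain ⟨m, hm, hmx, h1, h2⟩ := h.exists_isActive hn hx
  exact h.fold.left.seg_subset_thick h𝒟 hmx h1 h2 (hact m hm)

/-- A step with a degenerate fold does not change the group. -/
theorem injective (h : FoldStep F n S α θ v x y) (hc : IsCocone F T φ)
    (hinj : ∀ (p : (F.tree n).X) (g : (F.tree n).G), g • p = p → (φ n).hom g = 1 → g = 1)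
    (hn : ¬ Nondegenerate (F.tree n).toGTree v x y) : Function.Injective (F.step n).hom := by
  have hθ : Function.Injective θ.hom := h.vertex.injective fun p g hg h1 => by
    obtain ⟨p, rfl⟩ := h.fold.surj p
    obtain ⟨g, rfl⟩ := h.fold.surj_hom g
    obtain ⟨w, hw⟩ := h.fold.exists_fixed_of_not_nondegenerate hn (p := p) (g := g) (by
      rw [α.map_smul, hg])
    rw [hinj w g hw (by rw [← (hc n).1, h.hom, h1, map_one]), map_one]
  intro g g' e
  rw [h.hom, h.hom] at e
  exact h.fold.bij.1 (hθ e)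

end FoldStep

theorem core_image_step (hc : IsCocone F T φ) {𝒟 : Set (Subgroup T.G)} (h𝒟 : IsFamily 𝒟) {n : ℕ}
    (hu : ∀ S α θ v x y, FoldStep F n S α θ v x y → Untwisted (F.tree n).toGTree v x y)
    (hact : ∀ m, IsActive F n m → m ∈ thick (F.tree n).toGTree (φ n).hom 𝒟)
    {Y : Set (F.tree n).X} (hY : Core (F.tree n).toGTree (φ n).hom 𝒟 Y) :
    Core (F.tree (n + 1)).toGTree (φ (n + 1)).hom 𝒟 ((F.step n).map '' Y) := by
  rcases F.isSubdivision_or_foldStep n with h | ⟨S, α, θ, v, x, y, h⟩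
  · exact h.isQuot.core_image h𝒟 (hc n).1 hY
  · have hψ : ∀ g, ((φ (n + 1)).hom.comp θ.hom) (α.hom g) = (φ n).hom g := fun g => by
      rw [MonoidHom.comp_apply, ← h.hom, (hc n).1]
    have := h.vertex.isQuot.core_image h𝒟 (ψ' := (φ (n + 1)).hom) (fun g => rfl)
      (h.fold.core_image (hu _ _ _ _ _ _ h) h𝒟 hψ (h.seg_subset_thick h𝒟 hact)
        (fun hn => h.symm.seg_subset_thick h𝒟 hact hn.symm) hY)
    rwa [Set.image_image, ← funext h.map] at this

theorem IsActive.mem_core {𝒟 : Set (Subgroup T.G)} (h𝒟 : IsFamily 𝒟) {n : ℕ}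
    (hu : ∀ S α θ v x y, FoldStep F n S α θ v x y → Untwisted (F.tree n).toGTree v x y)
    (hact : ∀ m, IsActive F n m → m ∈ thick (F.tree n).toGTree (φ n).hom 𝒟)
    {Y : Set (F.tree n).X} (hY : Core (F.tree n).toGTree (φ n).hom 𝒟 Y) {m : (F.tree n).X}
    (hm : IsActive F n m) : m ∈ Y := by
  obtain ⟨S, α, θ, v, x, y, h, hn, hx, hmx, -⟩ := hm
  exact h.fold.seg_subset_core (hu _ _ _ _ _ _ h) hn hY (h.seg_subset_thick h𝒟 hact hn hx)
    (h.symm.seg_subset_thick h𝒟 hact hn.symm) h𝒟 hx hmx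

theorem IsActive.fixesArc {n : ℕ} {m : (F.tree n).X} (hm : IsActive F n m) :
    FixesArc T (label (F.tree n).toGTree (φ n).hom m) := by
  obtain ⟨S, α, θ, v, x, y, h, hn, hx, hmx, hd⟩ := hm
  have hpos : 0 < dist v x := dist_pos.2 h.fold.left.1
  refine fixesArc_label (φ n) h.fold.left hmx ?_ ?_
  · rintro rfl
    rw [dist_self] at hd
    linarith
  · rintro rfl
    linarith

/-! ### Descent on ranks -/

section Descent

variable [IsWellFounded (Subgroup T.G) (ArcRel T)]

/-- From the stage `N` on, the labels of all active edges have rank less than `A`. -/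
def Quiet (F : FoldingSequence.{u, v}) (φ : ∀ n, Morphism (F.tree n).toGTree T) (N : ℕ)
    (A : Ordinal.{u}) : Prop :=
  ∀ n ≥ N, ∀ m, IsActive F n m →
    IsWellFounded.rank (ArcRel T) (label (F.tree n).toGTree (φ n).hom m) < A

/-- If all active edges have labels of rank less than `A`, then only finitely many ranks occur,
namely ranks of labels of points at the stage where this starts to hold. -/
theorem Quiet.rank_mem (hc : IsCocone F T φ) {N : ℕ} {A : Ordinal.{u}}
    (hu : ∀ n ≥ N, ∀ S α θ v x y, FoldStep F n S α θ v x y →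
      Untwisted (F.tree n).toGTree v x y) (hq : Quiet F φ N A) {n : ℕ} (hn : N ≤ n)
    {m : (F.tree n).X} (hm : IsActive F n m) :
    ∃ p : (F.tree N).X,
      IsWellFounded.rank (ArcRel T) (label (F.tree n).toGTree (φ n).hom m) ≤
        IsWellFounded.rank (ArcRel T) (label (F.tree N).toGTree (φ N).hom p) ∧
      IsWellFounded.rank (ArcRel T) (label (F.tree N).toGTree (φ N).hom p) < A := by
  have h𝒟 : IsFamily (arcFamily T A) := isFamily_arcFamily A
  have hact : ∀ k ≥ N, ∀ m, IsActive F k m →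
      m ∈ thick (F.tree k).toGTree (φ k).hom (arcFamily T A) :=
    fun k hk m hm h => (hq k hk m hm).not_ge h.2
  have key : ∃ Y, Core (F.tree n).toGTree (φ n).hom (arcFamily T A) Y ∧
      ∀ y ∈ Y, ∃ p ∈ thick (F.tree N).toGTree (φ N).hom (arcFamily T A),
        label (F.tree N).toGTree (φ N).hom p ≤ label (F.tree n).toGTree (φ n).hom y := by
    clear hm m
    induction n, hn using Nat.le_induction with
    | base => exact ⟨_, core_thick h𝒟, fun y hy => ⟨y, hy, le_rfl⟩⟩
    | succ k hk ih =>
      obtain ⟨Y, hY, hl⟩ := ih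
      refine ⟨_, core_image_step hc h𝒟 (hu k hk) (hact k hk) hY, ?_⟩
      rintro _ ⟨y, hy, rfl⟩
      obtain ⟨p, hp, hle⟩ := hl y hy
      exact ⟨p, hp, hle.trans (label_le_label_map _ (hc k).1 y)⟩
  obtain ⟨Y, hY, hl⟩ := key
  obtain ⟨p, hp, hle⟩ := hl m (hm.mem_core h𝒟 (hu n hn) (hact n hn) hY)
  have harc := hm.fixesArc (φ := φ)
  exact ⟨p, rank_le_rank harc hle, not_le.1 fun h => hp ⟨harc.mono hle, h⟩⟩

/-- If no active edge has a label of rank greater than `B`, the step does not increase the number of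
cocycles, and it decreases this number if there is an active edge with a label of rank `B`. -/
theorem ncard_isCocycle_step_le (hc : IsCocone F T φ)
    (hinj : ∀ (n : ℕ) (p : (F.tree n).X) (g : (F.tree n).G),
      g • p = p → (φ n).hom g = 1 → g = 1) {n : ℕ} {B : Ordinal.{u}}
    (hu : ∀ S α θ v x y, FoldStep F n S α θ v x y → Untwisted (F.tree n).toGTree v x y)
    (hB : ∀ m, IsActive F n m →
      IsWellFounded.rank (ArcRel T) (label (F.tree n).toGTree (φ n).hom m) ≤ B) :
    {c | IsCocycle (F.tree (n + 1)).toGTree (φ (n + 1)).hom (arcFamily T B) c}.ncard ≤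
        {c | IsCocycle (F.tree n).toGTree (φ n).hom (arcFamily T B) c}.ncard ∧
      ((∃ m, IsActive F n m ∧
          IsWellFounded.rank (ArcRel T) (label (F.tree n).toGTree (φ n).hom m) = B) →
        {c | IsCocycle (F.tree (n + 1)).toGTree (φ (n + 1)).hom (arcFamily T B) c}.ncard <
          {c | IsCocycle (F.tree n).toGTree (φ n).hom (arcFamily T B) c}.ncard) := by
  have h𝒟 : IsFamily (arcFamily T B) := isFamily_arcFamily B
  -- an end whose stabilizer does not fix the active edge has a strictly larger label, which fixes
  -- no arc or has rank less than `B`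
  have hthick : ∀ S α θ v x y, FoldStep F n S α θ v x y →
      Nondegenerate (F.tree n).toGTree v x y → (¬ ∀ g : (F.tree n).G, g • x = x → g • v = v) →
      x ∈ thick (F.tree n).toGTree (φ n).hom (arcFamily T B) := by
    intro S α θ v x y h hn hx hmem
    obtain ⟨m, hm, hmx, h1, h2⟩ := h.exists_isActive hn hx
    push Not at hx
    obtain ⟨g, hgx, hgv⟩ := hx
    have hlt := label_lt_label (ψ := (φ n).hom) (hinj n)
      (fun k hk => (h.fold.left.smul_eq hmx h1 h2 hk).2) hgx
      fun hgm => hgv (h.fold.left.smul_eq hmx h1 h2 hgm).1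
    exact (hmem.2.trans_lt (rank_lt_rank hmem.1 hlt)).not_ge (hB m hm)
  have hfin := finite_setOf_isCocycle (ψ := (φ n).hom) h𝒟 (F.fg n) (F.minimal n)
  have hits : Hits (φ n).hom (φ (n + 1)).hom (arcFamily T B) (F.step n).map := by
    rcases F.isSubdivision_or_foldStep n with h | ⟨S, α, θ, v, x, y, h⟩
    · exact h.isQuot.hits (hc n).1
    · have hψ : ∀ g, ((φ (n + 1)).hom.comp θ.hom) (α.hom g) = (φ n).hom g := fun g => by
        rw [MonoidHom.comp_apply, ← h.hom, (hc n).1]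
      intro q hq
      obtain ⟨r, hr, hrq⟩ := h.vertex.isQuot.hits (ψ := (φ (n + 1)).hom.comp θ.hom)
        (fun g => rfl) q hq
      obtain ⟨p, hp, hpr⟩ := h.fold.hits h𝒟 hψ (fun hn =>
        (FoldAt.not_le_or_not_le (hu _ _ _ _ _ _ h) hn).imp (hthick _ _ _ _ _ _ h hn)
          (hthick _ _ _ _ _ _ h.symm hn.symm)) r hr
      refine ⟨p, hp, ?_⟩
      rw [h.map]
      exact seg_subset_thick_trans (seg_map_subset_thick h𝒟 θ (fun g => rfl) hpr) hrq
  have main := ncard_isCocycle_le h𝒟 (F.step n) (hc n).1 hits hfin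
  refine ⟨main.1, fun ⟨m, ⟨S, α, θ, v, x, y, h, hn, hx, hmx, hd⟩, hr⟩ => main.2 ?_⟩
  have hψ : ∀ g, ((φ (n + 1)).hom.comp θ.hom) (α.hom g) = (φ n).hom g := fun g => by
    rw [MonoidHom.comp_apply, ← h.hom, (hc n).1]
  have harc := IsActive.fixesArc (φ := φ) ⟨S, α, θ, v, x, y, h, hn, hx, hmx, hd⟩
  obtain ⟨c, hc', p, q, hne, hpq⟩ := h.fold.exists_isCocycle (hu _ _ _ _ _ _ h) hn h𝒟 hψ (hinj n)
    hmx hd (fun hm => hm ⟨harc, hr.ge⟩)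
    (fun K hK hmem => (hmem.2.trans_lt (rank_lt_rank hmem.1 hK)).ne hr.symm) hx
    (hthick _ _ _ _ _ _ h.symm hn.symm)
  refine ⟨c, hc', p, q, hne, ?_⟩
  rw [h.map, h.map]
  exact seg_map_subset_thick h𝒟 θ (fun g => rfl) hpq

theorem Quiet.exists_of_succ (hc : IsCocone F T φ)
    (hinj : ∀ (n : ℕ) (p : (F.tree n).X) (g : (F.tree n).G),
      g • p = p → (φ n).hom g = 1 → g = 1) {N : ℕ} {B : Ordinal.{u}}
    (hu : ∀ n ≥ N, ∀ S α θ v x y, FoldStep F n S α θ v x y →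
      Untwisted (F.tree n).toGTree v x y)
    (hq : ∀ n ≥ N, ∀ m, IsActive F n m →
      IsWellFounded.rank (ArcRel T) (label (F.tree n).toGTree (φ n).hom m) ≤ B) :
    ∃ N' ≥ N, Quiet F φ N' B := by
  have key := fun n (hn : n ≥ N) => ncard_isCocycle_step_le hc hinj (hu n hn) (hq n hn)
  obtain ⟨N', hN', hlt⟩ := exists_forall_ge_not_lt (N := N)
    (a := fun n => {c | IsCocycle (F.tree n).toGTree (φ n).hom (arcFamily T B) c}.ncard)
    fun n hn => (key n hn).1
  exact ⟨N', hN', fun n hn m hm => (hq n (hN'.trans hn) m hm).lt_of_ne fun e =>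
    hlt n hn ((key n (hN'.trans hn)).2 ⟨m, hm, e⟩)⟩

/-- From some stage on there are no active edges: the least ordinal that eventually bounds the ranks
of their labels cannot be positive. -/
theorem exists_forall_not_isActive (hc : IsCocone F T φ)
    (hinj : ∀ (n : ℕ) (p : (F.tree n).X) (g : (F.tree n).G),
      g • p = p → (φ n).hom g = 1 → g = 1) :
    ∃ N, (∀ n ≥ N, ∀ S α θ v x y, FoldStep F n S α θ v x y →
      Untwisted (F.tree n).toGTree v x y) ∧ ∀ n ≥ N, ∀ m, ¬ IsActive F n m := by
  obtain ⟨N₀, hN₀⟩ := F.exists_forall_untwisted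
  have hne : {A | ∃ N ≥ N₀, Quiet F φ N A}.Nonempty := by
    refine ⟨⨆ K : Subgroup T.G, Order.succ (IsWellFounded.rank (ArcRel T) K), N₀, le_rfl, ?_⟩
    exact fun n _ m _ => (Order.lt_succ _).trans_le
      (Ordinal.le_iSup (fun K => Order.succ (IsWellFounded.rank (ArcRel T) K)) _)
  have hmin := fun B => Ordinal.lt_wf.not_lt_min {A | ∃ N ≥ N₀, Quiet F φ N A} (x := B)
  obtain ⟨N, hN, hq⟩ := Ordinal.lt_wf.min_mem _ hne
  set A := Ordinal.lt_wf.min _ hne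
  have hu := fun n (hn : n ≥ N) => hN₀ n (hN.trans hn)
  refine ⟨N, hu, fun n hn m hm => ?_⟩
  let R : Set Ordinal.{u} :=
    (Set.range fun p => IsWellFounded.rank (ArcRel T) (label (F.tree N).toGTree (φ N).hom p)) ∩
      Set.Iio A
  have hR : R.Finite := (finite_range_label (F.fg N) (F.minimal N) _ rank_conj).inter_of_left _
  obtain ⟨p, -, hp⟩ := hq.rank_mem hc hu hn hm
  obtain ⟨B, ⟨⟨-, hBA⟩, hmax⟩⟩ := hR.exists_maximal ⟨_, ⟨p, rfl⟩, hp⟩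
  obtain ⟨N', hN', hq'⟩ := Quiet.exists_of_succ hc hinj hu (B := B) fun k hk m hm => by
    obtain ⟨r, hr, hrA⟩ := hq.rank_mem hc hu hk hm
    refine hr.trans (not_lt.1 fun hlt => ?_)
    exact hlt.not_ge (hmax ⟨⟨r, rfl⟩, hrA⟩ hlt.le)
  exact hmin B ⟨N', hN.trans hN', hq'⟩ hBA

end Descent

end Folding

theorem theorem3p3 (F : Folding.FoldingSequence.{u, v}) (T : Folding.GTree.{u, v})
    (φ : ∀ n, Folding.Morphism (F.tree n).toGTree T)
    (hT : Folding.IsDirectLimit F T φ)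
    (hinj : ∀ (n : ℕ) (p : (F.tree n).X) (g : (F.tree n).G),
      g • p = p → (φ n).hom g = 1 → g = 1) :
    (∃ m : ℕ, ∀ n ≥ m, Function.Bijective (φ n).hom) ∨
    ∃ H : Subgroup T.G, ¬ H.FG ∧
      ∀ K : Subgroup T.G, K ≤ H → K.FG → Folding.FixesArc T K := by
  by_contra! hcon
  obtain ⟨hbij, hH⟩ := hcon
  have : IsWellFounded (Subgroup T.G) (Folding.ArcRel T) :=
    ⟨Folding.wellFounded_arcRel fun H hK => by
      by_contra hfg
      obtain ⟨K, h1, h2, h3⟩ := hH H hfg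
      exact h3 (hK K h1 h2)⟩
  obtain ⟨N, hu, hN⟩ := Folding.exists_forall_not_isActive hT.1 hinj
  obtain ⟨n, hn, hnot⟩ := hbij N
  refine hnot ⟨hT.injective (fun k hk => ?_) hn, hT.surjective n⟩
  rcases F.isSubdivision_or_foldStep k with h | ⟨S, α, θ, v, x, y, h⟩
  · exact h.1.1
  · refine h.injective hT.1 (hinj k) fun hnd => ?_
    rcases Folding.FoldAt.not_le_or_not_le (hu k hk _ _ _ _ _ _ h) hnd with hx | hy
    · obtain ⟨m, hm, -⟩ := h.exists_isActive hnd hx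
      exact hN k hk m hm
    · obtain ⟨m, hm, -⟩ := h.symm.exists_isActive hnd.symm hy
      exact hN k hk m hm
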